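/- **Theorem (Infinite to finite approximation error).** *Infinite program.* Let $(\mathbb X,\mathbb C,\|\cdot\|)$ and $(\mathbb B,\mathbb Y,\|\cdot\|)$ be dual pairs of real normed spaces: $\mathbb X,\mathbb B$ are normed (not necessarily complete), the bilinear forms $\langle\cdot,\cdot\rangle$ separate points on both sides, and the dual norms $\|c\|_*=\sup_{\|x\|\le1}\langle x,c\rangle$, $\|y\|_*=\sup_{\|v\|\le1}\langle v,y\rangle$ are finite. Let $\mathcal A:\mathbb X\to\mathbb B$ be linear, weakly continuous and of finite norm $\|\mathcal A\|$, let $\mathbb K\subset\mathbb B$ be a weakly closed convex cone with dual cone $\mathbb K^*=\{y:\langle v,y\rangle\ge0\ \forall v\in\mathbb K\}$, and let $c\in\mathbb C$, $b\in\mathbb B$. Let $J=\inf\{\langle x,c\rangle:\mathcal Ax-b\in\mathbb K\}$, and assume the infimum is attained at $x^\star$. *Semi-infinite program.* Let $x_1,x_2,\dots\in\mathbb X$ be linearly independent with $\|x_i\|=1$; for each $n$ let $\|\cdot\|_{\mathfrak R}$ be a norm on $\mathbb R^n$ with dual norm $\|\cdot\|_{\mathfrak R^*}$, and let $\theta_P\in\mathbb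 R$. Put $\mathcal A_n\alpha=\sum_i\alpha_i\mathcal Ax_i$, $\mathcal A_n^*y=(\langle\mathcal Ax_i,y\rangle)_{i\le n}$, $\mathbf c=(\langle x_i,c\rangle)_{i\le n}$, $\mathscr A=\{\alpha\in\mathbb R^n:\|\alpha\|_{\mathfrak R}\le\theta_P\}$, $\varrho_n=\sup_{\|\alpha\|_{\mathfrak R}\le1}\|\alpha\|_{\ell_1}$ and $J_n=\inf\{\alpha^\top\mathbf c:\alpha\in\mathscr A,\ \mathcal A_n\alpha-b\in\mathbb K\}$. Suppose there are $d>0$ and $D$ such that for every $m\ge1$ a projection residual $r_m$ (that is, $x^\star$ minus a nearest point) of $x^\star$ onto $\{\sum_{i\le m}\alpha_ix_i:\|\alpha\|_{\mathfrak R}\le\theta_P\}$ satisfies $\|r_m\|\le Dm^{-1/d}$. Fix $n\ge1$ such that the program defining $J_n$ is feasible and, for some $\gamma>0$, $\|\mathcal A_n^*y\|_{\mathfrak R^*}\ge\gamma\|y\|_*$ for all $y\in\mathbb K^*$ and $\gamma\theta_P>\|b\|$. For a lower bound $J_n^{\rm LB}\le J_n$ put $$\theta_D=\frac{\theta_P\|\mathbf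 c\|_{\mathfrak R^*}-J_n^{\rm LB}}{\gamma\theta_P-\|b\|}.$$ *Scenario program.* Let $\mathcal K$ be the set of extreme points of $\{y\in\mathbb K^*:\|y\|_*=1\}$, and assume that the weakly closed convex hull of $\mathcal K$ contains this set. Let $\mathds P$ be a Borel probability measure supported on $\mathcal K$, let $y_1,\dots,y_N$ be i.i.d. samples from $\mathds P$, and let $J_{n,N}=\min\{\alpha^\top\mathbf c:\alpha\in\mathscr A,\ \alpha^\top\mathcal A_n^*y_j\ge\langle b,y_j\rangle,\ j\le N\}$; assume that its minimizer $\alpha_N^\star$ is almost surely unique. A *tail bound* is a function $h\ge0$ on $\mathbb R^n\times[0,1)$ with $h(\alpha,\varepsilon)\ge\sup\{\zeta\ge0:\mathds P[y:\sigma_{\mathcal K}(b-\mathcal A_n\alpha)<\langle b-\mathcal A_n\alpha,y\rangle+\zeta]\le\varepsilon\}$ for all $\alpha,\varepsilon$, where $\sigma_{\mathcal K}(v)=\sup_{y\in\mathcal K}\langle v,y\rangle$. Let $\mathsf N(n,\varepsilon,\beta)=\min\{N:\sum_{i=0}^{n-1}\binom Ni\varepsilon^i(1-\varepsilon)^{N-i}\le\beta\}$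 ($=\infty$ if there is no such $N$). *Smoothing algorithm.* Let $\mathscr Y=\{y\in\mathbb K^*:\|y\|_*\le\theta_D\}$, let $\mathsf d:\mathscr Y\to\mathbb R_+$ be strongly convex with respect to $\|\cdot\|_*$, and assume that for all $s>0$, $\alpha\in\mathscr A$ a maximizer $y_s^\star(\alpha)$ of $\langle b-\mathcal A_n\alpha,y\rangle-s\,\mathsf d(y)$ over $y\in\mathscr Y$ exists. Let $\eta,L>0$ be such that $\|\mathcal A_n^*y^\star_\eta(\alpha)-\mathcal A_n^*y^\star_\eta(\alpha')\|_{\mathfrak R^*}\le\frac L\eta\|\alpha-\alpha'\|_{\mathfrak R}$ on $\mathscr A$, let $\vartheta>0$ be a strong convexity parameter of $\frac12\|\cdot\|_{\mathfrak R}^2$ with respect to $\|\cdot\|_{\mathfrak R}$, and let $\mathds T(q,\alpha)=\arg\min_{v\in\mathscr A}\{q^\top v+\frac1{2\vartheta}\|v-\alpha\|_{\mathfrak R}^2\}$. Starting from any $w^{(0)}\in\mathscr A$, the algorithm sets, for $k=0,1,\dots$, $r^{(k)}=\frac\eta L(\mathbf c-\mathcal A_n^*y_\eta^\star(w^{(k)}))$,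 $z^{(k)}=\mathds T(\sum_{j\le k}\frac{j+1}2r^{(j)},0)$, $\alpha^{(k)}=\mathds T(\frac1\vartheta r^{(k)},w^{(k)})$, $w^{(k+1)}=\frac2{k+3}z^{(k)}+\frac{k+1}{k+3}\alpha^{(k)}$. With $\widehat y_\eta=\sum_{j=0}^k\frac{2(j+1)}{(k+1)(k+2)}y_\eta^\star(w^{(j)})$ put $$J^{\rm LB}_{n,\eta}=\langle b,\widehat y_\eta\rangle-\theta_P\|\mathcal A_n^*\widehat y_\eta-\mathbf c\|_{\mathfrak R^*},\qquad J^{\rm UB}_{n,\eta}=\mathbf c^\top\alpha^{(k)}+\sup_{y\in\mathscr Y}\langle b-\mathcal A_n\alpha^{(k)},y\rangle.$$ *Conclusion.* Let $\beta\in(0,1)$. (1) For every tail bound $h$, every $\varepsilon\in(0,1)$, every $N\ge\mathsf N(n,\varepsilon,\beta)$ and all $\eta,k$ as above, with probability at least $1-\beta$, $$\max\{J_{n,N},J^{\rm LB}_{n,\eta}\}-D(\|c\|_*+\theta_D\|\mathcal A\|)n^{-1/d}\le J\le\min\{J^{\rm UB}_{n,\eta},\ J_{n,N}+\theta_Dh(\alpha^\star_N,\varepsilon)\}.$$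 (2) Let $\varepsilon>0$ and $n\ge\big(D(\|c\|_*+\theta_D\|\mathcal A\|)\varepsilon^{-1}\big)^d$. Suppose that **either** $N\ge\mathsf N(n,g(z_n\varepsilon),\beta)$, where $z_n=\big(\theta_D(\theta_P\varrho_n\|\mathcal A\|+\|b\|)\big)^{-1}$ and $g:\mathbb R_+\to[0,1]$ is a non-decreasing function such that every open $\|\cdot\|_*$-ball of radius $r$ centred in $\mathcal K$ has $\mathds P$-probability at least $g(r)$; **or** there are $c_0,C_0>0$ with $\mathsf d(y_s^\star(\alpha))\le C_0\max\{\log(c_0s^{-1}),1\}$ for all $s>0$, $\alpha\in\mathscr A$, and $$\eta\le\frac{\varepsilon}{2C_0\max\{2\log(2c_0C_0\varepsilon^{-1}),1\}},\qquad k\ge5\,\theta_P\sqrt{\frac{L}{\vartheta\,\eta\,\varepsilon}}.$$ Then with probability at least $1-\beta$, $$\min\big\{|J-J_{n,N}|,\ |J-J^{\rm LB}_{n,\eta}|\big\}\le\varepsilon.$$ -/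

import Mathlib

open MeasureTheory Set

noncomputable section

namespace InfLP

/-- The dual norm `sup {ℓ v : ν v ≤ 1}` of a functional `ℓ` with respect to a norm `ν`. -/
def dualNorm {V : Type*} (ν : V → ℝ) (ℓ : V → ℝ) : ℝ :=
  sSup (ℓ '' {v | ν v ≤ 1})

/-- The support function `σ_S(ℓ) = sup_{y ∈ S} ℓ y`. -/
def supportFun {V : Type*} (S : Set V) (ℓ : V → ℝ) : ℝ :=
  sSup (ℓ '' S)

/-- `f` is strongly convex on `S` with parameter `m`, with respect to the norm `ν`. -/
def StronglyConvex {V : Type*} [AddCommGroup V] [Module ℝ V] (ν : V → ℝ) (S : Set V) (m : ℝ)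
    (f : V → ℝ) : Prop :=
  ∀ u ∈ S, ∀ v ∈ S, ∀ s t : ℝ, 0 ≤ s → 0 ≤ t → s + t = 1 →
    f (s • u + t • v) ≤ s * f u + t * f v - m / 2 * (s * t) * ν (u - v) ^ 2

/-- A dual pair of normed vector spaces: the bilinear form separates points on both sides, and
the dual norm it induces on the second space is finite. -/
structure IsDualPair {X C : Type*} [NormedAddCommGroup X] [NormedSpace ℝ X]
    [AddCommGroup C] [Module ℝ C] (p : X →ₗ[ℝ] C →ₗ[ℝ] ℝ) : Prop where
  separatingLeft : p.SeparatingLeft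
  separatingRight : p.SeparatingRight
  bounded : ∀ c : C, BddAbove ((fun x => p x c) '' {x : X | ‖x‖ ≤ 1})

/-- The data of the conic linear program `inf {⟨x, c⟩ : 𝒜 x - b ∈ K}`. -/
structure Program (X C B Y : Type*) [NormedAddCommGroup X] [NormedSpace ℝ X]
    [AddCommGroup C] [Module ℝ C] [NormedAddCommGroup B] [NormedSpace ℝ B]
    [AddCommGroup Y] [Module ℝ Y] where
  /-- the bilinear form on `X × C` -/
  pX : X →ₗ[ℝ] C →ₗ[ℝ] ℝ
  /-- the bilinear form on `B × Y` -/
  pB : B →ₗ[ℝ] Y →ₗ[ℝ] ℝ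
  /-- the linear operator, with finite operator norm -/
  A : X →L[ℝ] B
  /-- the cone defining the conic inequality -/
  K : PointedCone ℝ B
  /-- the cost vector -/
  c : C
  /-- the right-hand side -/
  b : B

/-- The basis elements, the norms `‖·‖_ℜ` on `ℝⁿ` and the radius `θ_P` of the feasible set. The
basis is indexed from `0`, so that `𝕏ₙ` is spanned by `x 0, …, x (n - 1)`. -/
structure Scheme (X : Type*) where
  /-- the basis elements -/
  x : ℕ → X
  /-- the norm on `ℝⁿ` (definiteness is part of `Scheme.Standing`) -/
  R : (n : ℕ) → Seminorm ℝ (Fin n → ℝ)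
  /-- the radius of the norm constraint -/
  θP : ℝ

section

variable {X C B Y : Type*} [NormedAddCommGroup X] [NormedSpace ℝ X]
  [AddCommGroup C] [Module ℝ C] [NormedAddCommGroup B] [NormedSpace ℝ B]
  [AddCommGroup Y] [Module ℝ Y]

/-- The standing assumptions on the program: two dual pairs of normed spaces, a weakly closed
cone and a weakly continuous operator. -/
structure Program.Standing (P : Program X C B Y) : Prop where
  dualPairX : IsDualPair P.pX
  dualPairB : IsDualPair P.pB
  closedCone : IsClosed (X := WeakBilin P.pB) (P.K : Set B)
  weaklyContinuous : Continuous (X := WeakBilin P.pX) (Y := WeakBilin P.pB) (fun x => P.A x)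

/-- The standing assumptions on the basis and on the norms on `ℝⁿ`. -/
structure Scheme.Standing (S : Scheme X) : Prop where
  linearIndependent : LinearIndependent ℝ S.x
  normalized : ∀ i, ‖S.x i‖ = 1
  definite : ∀ n α, S.R n α = 0 → α = 0

namespace Program

variable (P : Program X C B Y) (S : Scheme X)

/-- `‖c‖_*` -/
def normC : ℝ := dualNorm (fun x : X => ‖x‖) (fun x => P.pX x P.c)

/-- `‖y‖_*` -/
def normY (y : Y) : ℝ := dualNorm (fun v : B => ‖v‖) (fun v => P.pB v y)

/-- The dual cone `K^*`. -/
def Kstar : PointedCone ℝ Y := PointedCone.dual P.pB (P.K : Set B)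

/-! The infinite program. -/

/-- The feasible set of the infinite program. -/
def feas : Set X := {x | P.A x - P.b ∈ P.K}

/-- The value `J` of the infinite program. -/
def J : ℝ := sInf ((fun x => P.pX x P.c) '' P.feas)

/-- `x` is an optimizer of the infinite program. -/
def IsOptimizer (x : X) : Prop :=
  x ∈ P.feas ∧ ∀ x' ∈ P.feas, P.pX x P.c ≤ P.pX x' P.c

/-! The semi-infinite program. -/

/-- `𝒜ₙ α = ∑ αᵢ 𝒜 xᵢ` -/
def An (n : ℕ) (α : Fin n → ℝ) : B := ∑ i, α i • P.A (S.x i)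

/-- `𝒜ₙ^* y = (⟨𝒜 x₁, y⟩, …, ⟨𝒜 xₙ, y⟩)` -/
def AnStar (n : ℕ) (y : Y) : Fin n → ℝ := fun i => P.pB (P.A (S.x i)) y

/-- The cost vector `(⟨x₁, c⟩, …, ⟨xₙ, c⟩)`. -/
def cvec (n : ℕ) : Fin n → ℝ := fun i => P.pX (S.x i) P.c

end Program

/-- The dual norm `‖·‖_ℜ*` on `ℝⁿ`. -/
def Scheme.normRStar (S : Scheme X) (n : ℕ) (v : Fin n → ℝ) : ℝ :=
  dualNorm (S.R n) (fun α => α ⬝ᵥ v)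

/-- `ϱₙ = sup {‖α‖_{ℓ₁} : ‖α‖_ℜ ≤ 1}` -/
def Scheme.rho (S : Scheme X) (n : ℕ) : ℝ :=
  sSup ((fun α : Fin n → ℝ => ∑ i, |α i|) '' {α | S.R n α ≤ 1})

/-- The set of `α ∈ ℝⁿ` with `‖α‖_ℜ ≤ θ_P`. -/
def Scheme.ballR (S : Scheme X) (n : ℕ) : Set (Fin n → ℝ) := {α | S.R n α ≤ S.θP}

/-- The image in `𝕏ₙ` of the ball of radius `θ_P`. -/
def Scheme.ballX (S : Scheme X) (n : ℕ) : Set X :=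
  (fun α : Fin n → ℝ => ∑ i, α i • S.x i) '' S.ballR n

/-- `z` is a projection of `x` onto the set `T`. -/
def IsProjection (T : Set X) (x z : X) : Prop :=
  z ∈ T ∧ ∀ z' ∈ T, ‖z - x‖ ≤ ‖z' - x‖

namespace Program

variable (P : Program X C B Y) (S : Scheme X)

/-- The feasible set of the semi-infinite program. -/
def feasN (n : ℕ) : Set (Fin n → ℝ) := {α | P.An S n α - P.b ∈ P.K ∧ α ∈ S.ballR n}

/-- The value `Jₙ` of the semi-infinite program. -/
def Jn (n : ℕ) : ℝ := sInf ((fun α => α ⬝ᵥ P.cvec S n) '' P.feasN S n)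

/-- Semi-infinite regularity with constant `γ`. -/
structure Regular (n : ℕ) (γ : ℝ) : Prop where
  feasible : (P.feasN S n).Nonempty
  pos : 0 < γ
  infSup : ∀ y ∈ P.Kstar, γ * P.normY y ≤ S.normRStar n (P.AnStar S n y)
  large : ‖P.b‖ < γ * S.θP

/-- The dual optimizer bound `θ_D` obtained from a lower bound `JLB` of `Jₙ`. -/
def θD (n : ℕ) (γ JLB : ℝ) : ℝ :=
  (S.θP * S.normRStar n (P.cvec S n) - JLB) / (γ * S.θP - ‖P.b‖)

/-! The scenario program. -/

/-- The part of the dual unit sphere that lies in the dual cone. -/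
def sphere : Set Y := {y | y ∈ P.Kstar ∧ P.normY y = 1}

/-- The set `𝒦` of extreme points of `sphere`. -/
def ext : Set Y := P.sphere.extremePoints ℝ

/-- The weakly closed convex hull of `𝒦` contains `sphere`, so that restricting the conic
constraint to `𝒦` loses nothing. -/
def ExtGenerates : Prop :=
  P.sphere ⊆ closure (X := WeakBilin P.pB.flip) (convexHull ℝ P.ext)

/-- The feasible set of the scenario program with samples `y`. -/
def scenarioFeas (n : ℕ) {N : ℕ} (y : Fin N → Y) : Set (Fin n → ℝ) :=
  {α | (∀ j, P.pB P.b (y j) ≤ α ⬝ᵥ P.AnStar S n (y j)) ∧ α ∈ S.ballR n}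

/-- The value `J_{n,N}` of the scenario program. -/
def JnN (n : ℕ) {N : ℕ} (y : Fin N → Y) : ℝ :=
  sInf ((fun α => α ⬝ᵥ P.cvec S n) '' P.scenarioFeas S n y)

/-- `α` is an optimizer of the scenario program. -/
def IsScenarioOptimizer (n : ℕ) {N : ℕ} (y : Fin N → Y) (α : Fin n → ℝ) : Prop :=
  α ∈ P.scenarioFeas S n y ∧
    ∀ α' ∈ P.scenarioFeas S n y, α ⬝ᵥ P.cvec S n ≤ α' ⬝ᵥ P.cvec S n

/-- `p(α, ζ) = ℙ[y : σ_𝒦(b - 𝒜ₙ α) < ⟨b - 𝒜ₙ α, y⟩ + ζ]` -/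
def tailProb [MeasurableSpace Y] (ℙ : Measure Y) (n : ℕ) (α : Fin n → ℝ) (ζ : ℝ) : ℝ :=
  ℙ.real {y | supportFun P.ext (P.pB (P.b - P.An S n α)) < P.pB (P.b - P.An S n α) y + ζ}

/-- `h` is a tail bound: `h(α, ε) ≥ sup {ζ ≥ 0 : p(α, ζ) ≤ ε}` and `h(α, ε) ≥ 0`. The level
`ε = 1` is left out, because there the supremum is infinite. -/
def IsTailBound [MeasurableSpace Y] (ℙ : Measure Y) (n : ℕ) (h : (Fin n → ℝ) → ℝ → ℝ) : Prop :=
  ∀ α, ∀ ε ∈ Ico (0 : ℝ) 1, 0 ≤ h α ε ∧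
    h α ε ∈ upperBounds {ζ | 0 ≤ ζ ∧ P.tailProb S ℙ n α ζ ≤ ε}

/-- `g : ℝ₊ → [0, 1]` is non-decreasing and bounds from below the probability of the open balls,
in the dual norm, that are centred in `𝒦`. -/
structure IsBallLowerBound [MeasurableSpace Y] (ℙ : Measure Y) (g : ℝ → ℝ) : Prop where
  mono : MonotoneOn g (Ici 0)
  mem : ∀ r, 0 ≤ r → g r ∈ Icc (0 : ℝ) 1
  le : ∀ κ ∈ P.ext, ∀ r, 0 ≤ r → g r ≤ ℙ.real {y | P.normY (y - κ) < r}

end Program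

/-- `𝖭(n, ε, β)`: the least `N` whose binomial tail is at most `β` (`⊤` if there is none). -/
def sampleBound (n : ℕ) (ε β : ℝ) : ℕ∞ :=
  sInf ((fun N : ℕ => (N : ℕ∞)) ''
    {N | ∑ i ∈ Finset.range n, (N.choose i : ℝ) * ε ^ i * (1 - ε) ^ (N - i) ≤ β})

namespace Program

variable (P : Program X C B Y) (S : Scheme X)

/-- `zₙ = (θ_D (θ_P ϱₙ ‖𝒜‖ + ‖b‖))⁻¹` -/
def zn (n : ℕ) (θD : ℝ) : ℝ := (θD * (S.θP * S.rho n * ‖P.A‖ + ‖P.b‖))⁻¹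

/-- A sufficient number `N` of samples for the precision `ε` with confidence `1 - β`. -/
def EnoughSamples [MeasurableSpace Y] (ℙ : Measure Y) (n : ℕ) (θD ε β : ℝ) (N : ℕ) : Prop :=
  ∃ g, P.IsBallLowerBound ℙ g ∧ sampleBound n (g (P.zn S n θD * ε)) β ≤ N

/-! The smoothing algorithm. -/

/-- The set of `y ∈ K^*` with `‖y‖_* ≤ θ_D`. -/
def ballY (θD : ℝ) : Set Y := {y | y ∈ P.Kstar ∧ P.normY y ≤ θD}

/-- `d` is a prox-function on `ballY θD`: non-negative and strongly convex. -/
def IsProxFun (θD : ℝ) (d : Y → ℝ) : Prop :=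
  (∀ y ∈ P.ballY θD, 0 ≤ d y) ∧ ∃ m > 0, StronglyConvex P.normY (P.ballY θD) m d

/-- `ystar η α` maximizes `⟨b - 𝒜ₙ α, y⟩ - η d(y)` over `ballY θD`. -/
def IsProxMaximizer (n : ℕ) (θD : ℝ) (d : Y → ℝ) (ystar : ℝ → (Fin n → ℝ) → Y) : Prop :=
  ∀ η > 0, ∀ α ∈ S.ballR n, ystar η α ∈ P.ballY θD ∧ ∀ y ∈ P.ballY θD,
    P.pB (P.b - P.An S n α) y - η * d y ≤
      P.pB (P.b - P.An S n α) (ystar η α) - η * d (ystar η α)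

/-- The map `α ↦ 𝒜ₙ^* y_η^*(α)` is Lipschitz with constant `L / η`. -/
def LipschitzGradient (n : ℕ) (ystar : ℝ → (Fin n → ℝ) → Y) (L η : ℝ) : Prop :=
  ∀ α ∈ S.ballR n, ∀ α' ∈ S.ballR n,
    S.normRStar n (P.AnStar S n (ystar η α) - P.AnStar S n (ystar η α')) ≤
      L / η * S.R n (α - α')

end Program

/-- The averaged dual point `ŷ_η` after `k` iterations. -/
def yhat {n : ℕ} (ystar : ℝ → (Fin n → ℝ) → Y) (η : ℝ) (w : ℕ → Fin n → ℝ) (k : ℕ) : Y :=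
  ∑ j ∈ Finset.range (k + 1),
    (2 * ((j : ℝ) + 1) / (((k : ℝ) + 1) * ((k : ℝ) + 2))) • ystar η (w j)

/-- `v = 𝕋(q, a)`: the vector `v` minimizes `qᵀ v + ‖v - a‖_ℜ² / (2ϑ)` over the `θ_P`-ball. -/
def Scheme.IsProxStep (S : Scheme X) (n : ℕ) (ϑ : ℝ) (q a v : Fin n → ℝ) : Prop :=
  v ∈ S.ballR n ∧ ∀ v' ∈ S.ballR n,
    q ⬝ᵥ v + 1 / (2 * ϑ) * S.R n (v - a) ^ 2 ≤ q ⬝ᵥ v' + 1 / (2 * ϑ) * S.R n (v' - a) ^ 2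

namespace Program

variable (P : Program X C B Y) (S : Scheme X)

/-- `r⁽ᵏ⁾ = (η / L) (c - 𝒜ₙ^* y_η^*(w⁽ᵏ⁾))` -/
def stepVec (n : ℕ) (ystar : ℝ → (Fin n → ℝ) → Y) (η L : ℝ) (w : ℕ → Fin n → ℝ) (k : ℕ) :
    Fin n → ℝ :=
  (η / L) • (P.cvec S n - P.AnStar S n (ystar η (w k)))

/-- The sequences `w`, `z`, `α` are generated by the optimal scheme for smooth convex
optimization. -/
structure IsRun (n : ℕ) (ystar : ℝ → (Fin n → ℝ) → Y) (η L ϑ : ℝ) (w z α : ℕ → Fin n → ℝ) :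
    Prop where
  init : w 0 ∈ S.ballR n
  stepZ : ∀ k, S.IsProxStep n ϑ
    (∑ j ∈ Finset.range (k + 1), (((j : ℝ) + 1) / 2) • P.stepVec S n ystar η L w j) 0 (z k)
  stepA : ∀ k, S.IsProxStep n ϑ ((1 / ϑ) • P.stepVec S n ystar η L w k) (w k) (α k)
  stepW : ∀ k : ℕ, w (k + 1) =
    (2 / ((k : ℝ) + 3)) • z k + (((k : ℝ) + 1) / ((k : ℝ) + 3)) • α k

/-- The lower bound `⟨b, y⟩ - θ_P ‖𝒜ₙ^* y - c‖_ℜ*` at a dual point `y`. -/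
def lowerVal (n : ℕ) (y : Y) : ℝ :=
  P.pB P.b y - S.θP * S.normRStar n (P.AnStar S n y - P.cvec S n)

/-- The upper bound `αᵀ c + sup {⟨b - 𝒜ₙ α, y⟩ : y ∈ ballY θD}` at a primal point `α`. -/
def upperVal (n : ℕ) (θD : ℝ) (α : Fin n → ℝ) : ℝ :=
  α ⬝ᵥ P.cvec S n + supportFun (P.ballY θD) (P.pB (P.b - P.An S n α))

end Program

/-- A sufficient choice of the regularization parameter `η` and of the number `k` of iterations
for the precision `ε`, under a logarithmic growth bound on the prox-function at the maximizers. -/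
def Scheme.EnoughIterations (S : Scheme X) (n : ℕ) (d : Y → ℝ)
    (ystar : ℝ → (Fin n → ℝ) → Y) (L ϑ ε η : ℝ) (k : ℕ) : Prop :=
  ∃ c₀ C₀ : ℝ, 0 < c₀ ∧ 0 < C₀ ∧
    (∀ s > 0, ∀ α ∈ S.ballR n, d (ystar s α) ≤ C₀ * max (Real.log (c₀ * s⁻¹)) 1) ∧
    η ≤ ε / (2 * C₀ * max (2 * Real.log (2 * c₀ * C₀ * ε⁻¹)) 1) ∧
    5 * S.θP * √(L / (ϑ * η * ε)) ≤ k

end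

end InfLP

end

/-! Everything hinges on an exact penalty. The coefficient ball is compact and the Lagrangian is
affine in each variable, so Sion's theorem gives strong duality up to δ without a Slater point
(`exists_dual_point`). The inf-sup condition bounds the norm of an almost optimal multiplier by
about θ_D; rescaling it into the θ_D-ball shows that Jₙ is at most the cost plus the θ_D-penalty of
the violation, at every α in the ball (`Jn_le_upperVal`). At the projection of the optimizer this
penalty is small, which gives Jₙ - J ≤ (‖c‖ + θ_D ‖𝒜‖) ‖rₙ‖ (`Jn_sub_le_J`); J ≤ Jₙ is an inclusion
of feasible sets.

Sampling only relaxes constraints, so almost surely J_{n,N} ≤ Jₙ. Conversely, the penalty at the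
scenario optimizer needs a bound on its worst violation, and both the tail bound and the ball
condition deduce one from a small violation probability. That probability is governed by a binomial
tail. In general position exactly one set of n constraints is compatible with all others, so by
symmetry the probability of compatibility with n random constraints has the inverse binomial
coefficients as moments. This determines its law, a Beta law, and a union bound over the n-subsets
gives the tail (`measure_violation_le`). Strict convexity and general position are obtained by a
quadratic regularization and a random relaxation, both removed in a limit.

For smoothing, the accelerated method is analysed by an estimate sequence whose averaged
linearizations equal the Lagrangian at `yhat`, minus nonnegative prox terms; the result bounds the
gap to `lowerVal` (`smoothed_le`). The smoothing error is found by integrating the logarithmic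
growth bound over the smoothing parameter. Since `lowerVal` ≤ Jₙ ≤ `upperVal`, a small gap locates
Jₙ. -/

noncomputable section

set_option linter.unusedSectionVars false

namespace InfLP

/-! ### Dual norms -/

section DualNorm

variable {V : Type*} [AddCommGroup V] [Module ℝ V]

/-- The inequality `ℓ v ≤ ‖v‖ ‖ℓ‖_*`, for a seminorm. -/
theorem apply_le_mul_dualNorm (p : Seminorm ℝ V) (ℓ : V →ₗ[ℝ] ℝ)
    (hb : BddAbove (ℓ '' {v | p v ≤ 1})) (v : V) : ℓ v ≤ p v * dualNorm p ℓ := by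
  have key : ∀ u, p u ≤ 1 → ℓ u ≤ dualNorm p ℓ := fun u hu => le_csSup hb ⟨u, hu, rfl⟩
  rcases (apply_nonneg p v).eq_or_lt with h0 | hpos
  · rw [← h0, zero_mul]
    by_contra! hv
    -- All multiples of a vector of seminorm zero lie in the unit ball; this one takes a value one
    -- above the supremum.
    have h1 := key (((dualNorm p ℓ + 1) / ℓ v) • v) (by simp [map_smul_eq_mul, ← h0])
    rw [map_smul, smul_eq_mul, div_mul_cancel₀ _ hv.ne'] at h1
    linarith
  · have h1 := key ((p v)⁻¹ • v) (by
      rw [map_smul_eq_mul, Real.norm_of_nonneg (inv_nonneg.2 hpos.le), inv_mul_cancel₀ hpos.ne'])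
    rw [map_smul, smul_eq_mul, inv_mul_le_iff₀ hpos] at h1
    exact h1

theorem dualNorm_le (p : Seminorm ℝ V) (ℓ : V → ℝ) {M : ℝ} (h : ∀ v, p v ≤ 1 → ℓ v ≤ M) :
    dualNorm p ℓ ≤ M :=
  csSup_le ⟨_, 0, by simp, rfl⟩ (by rintro _ ⟨v, hv, rfl⟩; exact h v hv)

theorem dualNorm_nonneg (p : Seminorm ℝ V) (ℓ : V →ₗ[ℝ] ℝ)
    (hb : BddAbove (ℓ '' {v | p v ≤ 1})) : 0 ≤ dualNorm p ℓ :=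
  le_csSup hb ⟨0, by simp, map_zero ℓ⟩

end DualNorm

/-! ### Norms on `ℝⁿ` -/

section FiniteDim

variable {n : ℕ}

theorem seminorm_continuous (p : Seminorm ℝ (Fin n → ℝ)) : Continuous p :=
  continuousOn_univ.1 (p.convexOn.continuousOn isOpen_univ)

/-- Equivalence of norms: the continuous p has a positive minimum on the unit sphere, and M is its
inverse. The sphere is empty when n = 0. -/
theorem exists_norm_le_mul_seminorm (p : Seminorm ℝ (Fin n → ℝ)) (hp : ∀ α, p α = 0 → α = 0) :
    ∃ M > 0, ∀ α, ‖α‖ ≤ M * p α := by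
  rcases (Metric.sphere (0 : Fin n → ℝ) 1).eq_empty_or_nonempty with he | hne
  · refine ⟨1, one_pos, fun α => ?_⟩
    suffices α = 0 by simp [this]
    by_contra hα
    have : (‖α‖⁻¹ • α) ∈ Metric.sphere (0 : Fin n → ℝ) 1 := by
      simp [norm_smul, inv_mul_cancel₀ (norm_ne_zero_iff.2 hα)]
    rw [he] at this
    exact this
  · obtain ⟨x, hx, hmin⟩ := (isCompact_sphere (0 : Fin n → ℝ) 1).exists_isMinOn hne
      (seminorm_continuous p).continuousOn
    have hx1 : ‖x‖ = 1 := by simpa using hx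
    have hpx : 0 < p x := lt_of_le_of_ne (apply_nonneg p x) fun h => by
      rw [hp x h.symm, norm_zero] at hx1
      exact zero_ne_one hx1
    refine ⟨(p x)⁻¹, inv_pos.2 hpx, fun α => ?_⟩
    rw [← div_eq_inv_mul, le_div_iff₀ hpx]
    rcases eq_or_ne α 0 with rfl | hα
    · simp
    have h0 : 0 < ‖α‖ := norm_pos_iff.2 hα
    have hm := hmin (show (‖α‖⁻¹ • α) ∈ Metric.sphere (0 : Fin n → ℝ) 1 by
      simp [norm_smul, inv_mul_cancel₀ h0.ne'])
    simp only [mem_ofPred_eq, map_smul_eq_mul, norm_inv, norm_norm] at hm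
    rwa [← div_eq_inv_mul, le_div_iff₀ h0, mul_comm] at hm

end FiniteDim

section SchemeNorm

variable {X : Type*} [NormedAddCommGroup X] [NormedSpace ℝ X] {S : Scheme X}

theorem Scheme.Standing.isCompact_ballR (hS : S.Standing) (n : ℕ) : IsCompact (S.ballR n) := by
  obtain ⟨M, hM, h⟩ := exists_norm_le_mul_seminorm (S.R n) (hS.definite n)
  refine Metric.isCompact_of_isClosed_isBounded
    (isClosed_le (seminorm_continuous _) continuous_const) ?_
  refine (Metric.isBounded_closedBall (x := (0 : Fin n → ℝ)) (r := M * S.θP)).subset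
    fun α hα => ?_
  rw [mem_closedBall_zero_iff]
  exact (h α).trans (mul_le_mul_of_nonneg_left hα hM.le)

theorem Scheme.convex_ballR (S : Scheme X) (n : ℕ) : Convex ℝ (S.ballR n) := by
  have := (S.R n).convexOn.convex_le S.θP
  simpa [Scheme.ballR] using this

/-- Makes the `sSup` in `normRStar` and `rho` genuine suprema; the real `sSup` of a set unbounded
above is 0. -/
theorem Scheme.Standing.bddAbove_image (hS : S.Standing) (n : ℕ) {f : (Fin n → ℝ) → ℝ}
    (hf : Continuous f) : BddAbove (f '' {α | S.R n α ≤ 1}) := by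
  obtain ⟨M, hM, h⟩ := exists_norm_le_mul_seminorm (S.R n) (hS.definite n)
  have hc : IsCompact {α | S.R n α ≤ 1} := by
    refine Metric.isCompact_of_isClosed_isBounded
      (isClosed_le (seminorm_continuous _) continuous_const) ?_
    refine (Metric.isBounded_closedBall (x := (0 : Fin n → ℝ)) (r := M)).subset fun α hα => ?_
    rw [mem_closedBall_zero_iff]
    exact (h α).trans (mul_le_of_le_one_right hM.le hα)
  exact hc.bddAbove_image hf.continuousOn

/-- The linear functional `α ↦ α ⬝ᵥ v`. -/
def dotFun {n : ℕ} (v : Fin n → ℝ) : (Fin n → ℝ) →ₗ[ℝ] ℝ where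
  toFun α := α ⬝ᵥ v
  map_add' α α' := add_dotProduct α α' v
  map_smul' s α := smul_dotProduct s α v

theorem continuous_dot {n : ℕ} (v : Fin n → ℝ) : Continuous fun α : Fin n → ℝ => α ⬝ᵥ v := by
  unfold dotProduct
  fun_prop

theorem Scheme.Standing.dot_le (hS : S.Standing) {n : ℕ} (α v : Fin n → ℝ) :
    α ⬝ᵥ v ≤ S.R n α * S.normRStar n v :=
  apply_le_mul_dualNorm (S.R n) (dotFun v) (hS.bddAbove_image n (continuous_dot v)) α

theorem Scheme.normRStar_le {n : ℕ} {v : Fin n → ℝ} {M : ℝ}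
    (h : ∀ α, S.R n α ≤ 1 → α ⬝ᵥ v ≤ M) : S.normRStar n v ≤ M :=
  dualNorm_le (S.R n) _ h

theorem Scheme.Standing.normRStar_nonneg (hS : S.Standing) {n : ℕ} (v : Fin n → ℝ) :
    0 ≤ S.normRStar n v :=
  dualNorm_nonneg (S.R n) (dotFun v) (hS.bddAbove_image n (continuous_dot v))

theorem Scheme.Standing.dot_le_of_mem (hS : S.Standing) {n : ℕ} {α : Fin n → ℝ}
    (hα : α ∈ S.ballR n) (v : Fin n → ℝ) : α ⬝ᵥ v ≤ S.θP * S.normRStar n v :=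
  (hS.dot_le α v).trans (mul_le_mul_of_nonneg_right hα (hS.normRStar_nonneg v))

theorem Scheme.Standing.normRStar_add_le (hS : S.Standing) {n : ℕ} (u v : Fin n → ℝ) :
    S.normRStar n (u + v) ≤ S.normRStar n u + S.normRStar n v := by
  refine Scheme.normRStar_le fun α hα => ?_
  rw [dotProduct_add]
  have h1 := hS.dot_le α u
  have h2 := hS.dot_le α v
  have h3 := mul_le_of_le_one_left (hS.normRStar_nonneg u) hα
  have h4 := mul_le_of_le_one_left (hS.normRStar_nonneg v) hα
  linarith

theorem Scheme.normRStar_neg {n : ℕ} (v : Fin n → ℝ) :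
    S.normRStar n (-v) = S.normRStar n v := by
  unfold Scheme.normRStar dualNorm
  congr 1
  ext r
  constructor
  · rintro ⟨α, hα, rfl⟩
    exact ⟨-α, by simpa using hα, by simp⟩
  · rintro ⟨α, hα, rfl⟩
    exact ⟨-α, by simpa using hα, by simp⟩

/-- A lower bound of a linear functional on the ball of radius `θP` bounds its dual norm. -/
theorem Scheme.mul_normRStar_le (hθ : 0 < S.θP) {n : ℕ} {v : Fin n → ℝ} {M : ℝ}
    (h : ∀ α ∈ S.ballR n, α ⬝ᵥ v ≤ M) : S.θP * S.normRStar n v ≤ M := by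
  rw [← le_div_iff₀' hθ]
  refine Scheme.normRStar_le fun α hα => ?_
  have h1 := h (S.θP • α) (by
    change S.R n (S.θP • α) ≤ S.θP
    rw [map_smul_eq_mul, Real.norm_of_nonneg hθ.le]
    exact mul_le_of_le_one_right hθ.le hα)
  rw [smul_dotProduct, smul_eq_mul] at h1
  rwa [le_div_iff₀' hθ]

theorem Scheme.Standing.sum_abs_le (hS : S.Standing) {n : ℕ} {α : Fin n → ℝ}
    (hα : α ∈ S.ballR n) (hθ : 0 < S.θP) : ∑ i, |α i| ≤ S.θP * S.rho n := by
  have hb : BddAbove ((fun α : Fin n → ℝ => ∑ i, |α i|) '' {α | S.R n α ≤ 1}) :=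
    hS.bddAbove_image n (by fun_prop)
  have h1 : ∑ i, |(S.θP⁻¹ • α) i| ≤ S.rho n := le_csSup hb ⟨_, by
    change S.R n (S.θP⁻¹ • α) ≤ 1
    rw [map_smul_eq_mul, Real.norm_of_nonneg (inv_nonneg.2 hθ.le), inv_mul_le_iff₀ hθ, mul_one]
    exact hα, rfl⟩
  simp only [Pi.smul_apply, smul_eq_mul, abs_mul, abs_of_pos (inv_pos.2 hθ)] at h1
  rwa [← Finset.mul_sum, inv_mul_le_iff₀ hθ] at h1

end SchemeNorm

/-! ### The dual pairing -/

section Pairing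

variable {X C B Y : Type*} [NormedAddCommGroup X] [NormedSpace ℝ X]
  [AddCommGroup C] [Module ℝ C] [NormedAddCommGroup B] [NormedSpace ℝ B]
  [AddCommGroup Y] [Module ℝ Y] {P : Program X C B Y} {S : Scheme X}

theorem Program.Standing.pX_le (hP : P.Standing) (x : X) : P.pX x P.c ≤ ‖x‖ * P.normC :=
  apply_le_mul_dualNorm (normSeminorm ℝ X) (P.pX.flip P.c) (hP.dualPairX.bounded P.c) x

theorem Program.Standing.normC_nonneg (hP : P.Standing) : 0 ≤ P.normC :=
  dualNorm_nonneg (normSeminorm ℝ X) (P.pX.flip P.c) (hP.dualPairX.bounded P.c)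

theorem Program.Standing.pB_le (hP : P.Standing) (v : B) (y : Y) :
    P.pB v y ≤ ‖v‖ * P.normY y :=
  apply_le_mul_dualNorm (normSeminorm ℝ B) (P.pB.flip y) (hP.dualPairB.bounded y) v

theorem Program.Standing.normY_nonneg (hP : P.Standing) (y : Y) : 0 ≤ P.normY y :=
  dualNorm_nonneg (normSeminorm ℝ B) (P.pB.flip y) (hP.dualPairB.bounded y)

theorem Program.normY_le {y : Y} {M : ℝ} (h : ∀ v : B, ‖v‖ ≤ 1 → P.pB v y ≤ M) :
    P.normY y ≤ M :=
  dualNorm_le (normSeminorm ℝ B) _ h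

theorem Program.Standing.normY_smul_le (hP : P.Standing) {t : ℝ} (ht : 0 ≤ t) (y : Y) :
    P.normY (t • y) ≤ t * P.normY y := by
  refine Program.normY_le fun v hv => ?_
  rw [map_smul, smul_eq_mul]
  exact mul_le_mul_of_nonneg_left
    ((hP.pB_le v y).trans (mul_le_of_le_one_left (hP.normY_nonneg y) hv)) ht

theorem Program.Standing.normY_add_le (hP : P.Standing) (y y' : Y) :
    P.normY (y + y') ≤ P.normY y + P.normY y' := by
  refine Program.normY_le fun v hv => ?_
  rw [map_add]
  exact add_le_add
    ((hP.pB_le v y).trans (mul_le_of_le_one_left (hP.normY_nonneg y) hv))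
    ((hP.pB_le v y').trans (mul_le_of_le_one_left (hP.normY_nonneg y') hv))

theorem Program.normY_zero : P.normY 0 = 0 := by
  have : (fun _ : B => (0 : ℝ)) '' {v | ‖v‖ ≤ 1} = {0} :=
    Set.Nonempty.image_const ⟨0, by simp⟩ 0
  simp [Program.normY, dualNorm, this]

theorem Program.Standing.convex_ballY (hP : P.Standing) (θ : ℝ) : Convex ℝ (P.ballY θ) := by
  rintro y ⟨hy, hy'⟩ z ⟨hz, hz'⟩ s t hs ht hst
  refine ⟨P.Kstar.add_mem (P.Kstar.smul_mem hs hy) (P.Kstar.smul_mem ht hz), ?_⟩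
  have h1 := hP.normY_add_le (s • y) (t • z)
  have h2 := hP.normY_smul_le hs y
  have h3 := hP.normY_smul_le ht z
  have h4 := mul_le_mul_of_nonneg_left hy' hs
  have h5 := mul_le_mul_of_nonneg_left hz' ht
  have h6 : s * θ + t * θ = θ := by rw [← add_mul, hst, one_mul]
  linarith

theorem Program.mem_Kstar {y : Y} : y ∈ P.Kstar ↔ ∀ v ∈ P.K, 0 ≤ P.pB v y :=
  PointedCone.mem_dual

theorem Program.pB_An (n : ℕ) (α : Fin n → ℝ) (y : Y) :
    P.pB (P.An S n α) y = α ⬝ᵥ P.AnStar S n y := by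
  simp [Program.An, Program.AnStar, dotProduct]

theorem Program.pX_sum (n : ℕ) (α : Fin n → ℝ) :
    P.pX (∑ i, α i • S.x i) P.c = α ⬝ᵥ P.cvec S n := by
  simp [Program.cvec, dotProduct]

theorem Program.An_eq (n : ℕ) (α : Fin n → ℝ) :
    P.An S n α = P.A (∑ i, α i • S.x i) := by
  simp [Program.An]

theorem Program.norm_An_le (hS : S.Standing) {n : ℕ} (α : Fin n → ℝ) :
    ‖P.An S n α‖ ≤ ‖P.A‖ * ∑ i, |α i| := by
  rw [Program.An, Finset.mul_sum]
  refine (norm_sum_le _ _).trans (Finset.sum_le_sum fun i _ => ?_)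
  rw [norm_smul, Real.norm_eq_abs, mul_comm]
  refine mul_le_mul_of_nonneg_right ?_ (abs_nonneg _)
  simpa [hS.normalized i] using P.A.le_opNorm (S.x i)

/-- The bipolar theorem: a point outside the weakly closed cone is separated from it by an element
of the dual cone. -/
theorem Program.Standing.exists_pB_neg (hP : P.Standing) {v : B} (hv : v ∉ P.K) :
    ∃ y ∈ P.Kstar, P.pB v y < 0 := by
  have hconv : Convex ℝ (E := WeakBilin P.pB) (P.K : Set B) := P.K.convex
  obtain ⟨f, u, hfu, hf⟩ := geometric_hahn_banach_point_closed (E := WeakBilin P.pB)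
    (x := v) hconv hP.closedCone hv
  obtain ⟨y, rfl⟩ := LinearMap.dualEmbedding_surjective P.pB f
  have hu : u < 0 := by
    have h0 : u < P.pB 0 y := hf (0 : B) P.K.zero_mem
    simpa using h0
  have hfu' : P.pB v y < u := hfu
  have hf' : ∀ w ∈ P.K, u < P.pB w y := hf
  refine ⟨y, Program.mem_Kstar.2 fun w hw => ?_, hfu'.trans hu⟩
  by_contra! hneg
  -- Both u and the pairing are negative, so this multiple stays in the cone, yet its pairing with y
  -- is exactly u.
  have h1 := hf' ((u / P.pB w y) • w)
    (P.K.smul_mem (div_pos_of_neg_of_neg hu hneg).le hw)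
  rw [map_smul, LinearMap.smul_apply, smul_eq_mul, div_mul_cancel₀ _ hneg.ne] at h1
  exact lt_irrefl _ h1

end Pairing

/-! ### Duality for the semi-infinite program -/

section Duality

variable {X C B Y : Type*} [NormedAddCommGroup X] [NormedSpace ℝ X]
  [AddCommGroup C] [Module ℝ C] [NormedAddCommGroup B] [NormedSpace ℝ B]
  [AddCommGroup Y] [Module ℝ Y] {P : Program X C B Y} {S : Scheme X} {n : ℕ} {γ : ℝ}

theorem Program.Regular.θP_pos (hreg : P.Regular S n γ) : 0 < S.θP :=
  pos_of_mul_pos_right ((norm_nonneg _).trans_lt hreg.large) hreg.pos.le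

theorem Scheme.Standing.bddBelow_dot (hS : S.Standing) {n : ℕ} (v : Fin n → ℝ)
    {T : Set (Fin n → ℝ)} (hT : T ⊆ S.ballR n) : BddBelow ((fun α => α ⬝ᵥ v) '' T) :=
  ((hS.isCompact_ballR n).bddBelow_image (continuous_dot v).continuousOn).mono (image_mono hT)

theorem Program.Jn_le (hS : S.Standing) {α : Fin n → ℝ} (hα : α ∈ P.feasN S n) :
    P.Jn S n ≤ α ⬝ᵥ P.cvec S n :=
  csInf_le (hS.bddBelow_dot _ fun _ h => h.2) ⟨α, hα, rfl⟩

/-- The Lagrangian of the semi-infinite program. -/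
def Program.lagrangian (P : Program X C B Y) (S : Scheme X) (n : ℕ) (α : Fin n → ℝ) (y : Y) : ℝ :=
  α ⬝ᵥ P.cvec S n + P.pB (P.b - P.An S n α) y

theorem Program.lagrangian_eq (α : Fin n → ℝ) (y : Y) :
    P.lagrangian S n α y = P.pB P.b y - α ⬝ᵥ (P.AnStar S n y - P.cvec S n) := by
  rw [Program.lagrangian, map_sub, LinearMap.sub_apply, Program.pB_An, dotProduct_sub]
  ring

/-- The inner minimum over a symmetric ball is a dual norm: with `le_lowerVal`, this identifies
`lowerVal` with the infimum of the Lagrangian over the coefficient ball. -/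
theorem Program.lowerVal_le_lagrangian (hS : S.Standing) {α : Fin n → ℝ} (hα : α ∈ S.ballR n)
    (y : Y) : P.lowerVal S n y ≤ P.lagrangian S n α y := by
  rw [Program.lagrangian_eq, Program.lowerVal]
  have := hS.dot_le_of_mem hα (P.AnStar S n y - P.cvec S n)
  linarith

theorem Program.le_lowerVal (hθ : 0 < S.θP) {M : ℝ} {y : Y}
    (h : ∀ α ∈ S.ballR n, M ≤ P.lagrangian S n α y) : M ≤ P.lowerVal S n y := by
  have : S.θP * S.normRStar n (P.AnStar S n y - P.cvec S n) ≤ P.pB P.b y - M :=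
    Scheme.mul_normRStar_le hθ fun α hα => by
      have := h α hα
      rw [Program.lagrangian_eq] at this
      linarith
  rw [Program.lowerVal]
  linarith

/-- Weak duality. -/
theorem Program.lowerVal_le_Jn (hS : S.Standing) (hf : (P.feasN S n).Nonempty) {y : Y}
    (hy : y ∈ P.Kstar) : P.lowerVal S n y ≤ P.Jn S n := by
  refine le_csInf (hf.image _) ?_
  rintro _ ⟨α, hα, rfl⟩
  refine (Program.lowerVal_le_lagrangian hS hα.2 y).trans ?_
  have h1 : 0 ≤ P.pB (P.An S n α - P.b) y := Program.mem_Kstar.1 hy _ hα.1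
  rw [Program.lagrangian, ← neg_sub, map_neg, LinearMap.neg_apply]
  linarith

theorem Program.continuous_lagrangian (y : Y) :
    Continuous fun α : Fin n → ℝ => P.lagrangian S n α y := by
  simp only [Program.lagrangian_eq]
  exact continuous_const.sub (continuous_dot _)

theorem Program.lagrangian_affine_left (u v : Fin n → ℝ) (y : Y) {a b : ℝ} (hab : a + b = 1) :
    P.lagrangian S n (a • u + b • v) y =
      a * P.lagrangian S n u y + b * P.lagrangian S n v y := by
  have hb : P.pB P.b y = a * P.pB P.b y + b * P.pB P.b y := by rw [← add_mul, hab, one_mul]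
  simp only [Program.lagrangian_eq, add_dotProduct, smul_dotProduct, smul_eq_mul]
  linarith

theorem Program.lagrangian_affine_right (α : Fin n → ℝ) (u v : Y) {a b : ℝ} (hab : a + b = 1) :
    P.lagrangian S n α (a • u + b • v) =
      a * P.lagrangian S n α u + b * P.lagrangian S n α v := by
  have hb : α ⬝ᵥ P.cvec S n = a * (α ⬝ᵥ P.cvec S n) + b * (α ⬝ᵥ P.cvec S n) := by
    rw [← add_mul, hab, one_mul]
  simp only [Program.lagrangian, map_add, map_smul, smul_eq_mul]
  linarith

/-- Strong duality, up to an arbitrarily small error. -/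
theorem Program.Standing.exists_dual_point (hP : P.Standing) (hS : S.Standing)
    (hf : (P.feasN S n).Nonempty) {δ : ℝ} (hδ : 0 < δ) :
    ∃ y ∈ P.Kstar, ∀ α ∈ S.ballR n, P.Jn S n - δ < P.lagrangian S n α y := by
  -- Pointwise in α: the multiplier 0 serves at a feasible point, a large multiple of a separating
  -- functional at an infeasible one.
  have hcover : ∀ α ∈ S.ballR n, ∃ y ∈ P.Kstar, P.Jn S n - δ < P.lagrangian S n α y := by
    intro α hα
    by_cases hK : P.An S n α - P.b ∈ P.K
    · refine ⟨0, P.Kstar.zero_mem, ?_⟩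
      have := Program.Jn_le hS ⟨hK, hα⟩
      simp only [Program.lagrangian, map_zero]
      linarith
    · obtain ⟨y, hy, hneg⟩ := hP.exists_pB_neg hK
      set q : ℝ := P.pB (P.b - P.An S n α) y with hq
      have hqpos : 0 < q := by
        rw [hq, ← neg_sub, map_neg, LinearMap.neg_apply]
        linarith
      obtain ⟨t, ht⟩ := exists_nat_gt ((P.Jn S n - α ⬝ᵥ P.cvec S n) / q)
      refine ⟨(t : ℝ) • y, P.Kstar.smul_mem (Nat.cast_nonneg t) hy, ?_⟩
      rw [Program.lagrangian, map_smul, smul_eq_mul, ← hq]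
      rw [div_lt_iff₀ hqpos] at ht
      linarith
  -- Compactness leaves finitely many multipliers, one of them good at each α; Sion's theorem merges
  -- them into a single one.
  obtain ⟨s, hsK, hsfin, hs⟩ := (hS.isCompact_ballR n).elim_finite_subcover_image
    (b := (P.Kstar : Set Y)) (c := fun y => {α | P.Jn S n - δ < P.lagrangian S n α y})
    (fun y _ => isOpen_lt continuous_const (Program.continuous_lagrangian y))
    (fun α hα => by
      obtain ⟨y, hy, h⟩ := hcover α hα
      exact mem_biUnion hy h)
  have hs' : ∀ α ∈ S.ballR n, ∃ y ∈ s, P.Jn S n - δ < P.lagrangian S n α y :=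
    fun α hα => by simpa using hs hα
  have hKconv : Convex ℝ (E := WeakBilin P.pB.flip) (P.Kstar : Set Y) := P.Kstar.convex
  refine Sion.exists_lt_iInf_of_lt_iInf_of_finite (F := WeakBilin P.pB.flip) (s := s)
    (f := fun α y => P.lagrangian S n α y)
    (hf.mono fun _ h => h.2) (hS.isCompact_ballR n)
    (fun y _ => (Program.continuous_lagrangian y).lowerSemicontinuous.lowerSemicontinuousOn _)
    (fun y _ => ?_) hKconv (fun α _ => ?_) (fun α _ => ?_) (S.convex_ballR n) hsfin hsK
    (fun α hα => hs' α hα)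
  · exact ConvexOn.quasiconvexOn ⟨S.convex_ballR n, fun u _ v _ a b _ _ hab =>
      (Program.lagrangian_affine_left u v y hab).le⟩
  · have h1 : Continuous fun y : WeakBilin P.pB.flip => P.pB.flip y (P.b - P.An S n α) :=
      WeakBilin.eval_continuous P.pB.flip _
    exact ((continuous_const.add h1).upperSemicontinuous).upperSemicontinuousOn _
  · exact ConcaveOn.quasiconcaveOn ⟨hKconv, fun u _ v _ a b _ _ hab =>
      (Program.lagrangian_affine_right α u v hab).ge⟩

/-! ### Bounded multipliers and the exact penalty. -/

variable {JLB : ℝ}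

theorem Program.Regular.θD_nonneg (hreg : P.Regular S n γ) (hS : S.Standing)
    (hJ : JLB ≤ P.Jn S n) : 0 ≤ P.θD S n γ JLB := by
  obtain ⟨α, hα⟩ := hreg.feasible
  have h1 := Program.Jn_le hS hα
  have h2 := hS.dot_le_of_mem hα.2 (P.cvec S n)
  exact div_nonneg (by linarith) (by linarith [hreg.large])

theorem Program.Standing.bddAbove_ballY (hP : P.Standing) (θ : ℝ) (v : B) :
    BddAbove (P.pB v '' P.ballY θ) := by
  refine ⟨‖v‖ * θ, ?_⟩
  rintro _ ⟨y, hy, rfl⟩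
  exact (hP.pB_le v y).trans (mul_le_mul_of_nonneg_left hy.2 (norm_nonneg v))

/-- The dual points may be taken of norm at most `θD`: the conic constraint can be replaced by an
exact penalty. -/
theorem Program.Regular.Jn_le_upperVal (hreg : P.Regular S n γ) (hP : P.Standing)
    (hS : S.Standing) (hJ : JLB ≤ P.Jn S n) {α : Fin n → ℝ} (hα : α ∈ S.ballR n) :
    P.Jn S n ≤ P.upperVal S n (P.θD S n γ JLB) α := by
  set θ := P.θD S n γ JLB with hθ
  have hθ0 : 0 ≤ θ := hreg.θD_nonneg hS hJ
  set g := γ * S.θP - ‖P.b‖ with hg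
  have hgpos : 0 < g := by linarith [hreg.large]
  set M := ‖P.b - P.An S n α‖
  have hM : 0 ≤ M := norm_nonneg _
  refine le_of_forall_pos_le_add fun ε hε => ?_
  -- Chosen so that the duality error δ plus the cost M δ / g of shrinking the multiplier equals ε.
  set δ := ε / (1 + M / g) with hδdef
  have hden : 0 < 1 + M / g := by positivity
  have hδ : 0 < δ := by positivity
  obtain ⟨y, hyK, hy⟩ := hP.exists_dual_point hS hreg.feasible hδ
  have hynn := hP.normY_nonneg y
  -- Almost optimality reads Jₙ - δ ≤ `lowerVal` y, where the inf-sup inequality makes the right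
  -- side decrease at the rate g in ‖y‖.
  have hnorm : P.normY y ≤ θ + δ / g := by
    have h1 := Program.le_lowerVal hreg.θP_pos fun α hα => (hy α hα).le
    rw [Program.lowerVal] at h1
    have h2 := hP.pB_le P.b y
    have h3 := hreg.infSup y hyK
    have h4 := hS.normRStar_add_le (P.AnStar S n y - P.cvec S n) (P.cvec S n)
    rw [sub_add_cancel] at h4
    have h5 := mul_le_mul_of_nonneg_left (h3.trans h4) hreg.θP_pos.le
    have h6 : g * P.normY y ≤ S.θP * S.normRStar n (P.cvec S n) - JLB + δ := by
      rw [hg]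
      linarith
    have h7 : θ * g = S.θP * S.normRStar n (P.cvec S n) - JLB := by
      rw [hθ, Program.θD, ← hg, div_mul_cancel₀ _ hgpos.ne']
    rw [← h7] at h6
    rw [← sub_le_iff_le_add', le_div_iff₀ hgpos]
    linarith
  -- Rescaling y to norm at most θ changes the pairing by at most M times the excess norm.
  obtain ⟨y', hy'Y, hy'⟩ : ∃ y' ∈ P.ballY θ,
      P.pB (P.b - P.An S n α) y ≤ P.pB (P.b - P.An S n α) y' + M * (δ / g) := by
    rcases le_or_gt (P.normY y) θ with hle | hlt
    · exact ⟨y, ⟨hyK, hle⟩, le_add_of_nonneg_right (by positivity)⟩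
    · have hypos : 0 < P.normY y := hθ0.trans_lt hlt
      have ht : 0 ≤ θ / P.normY y := by positivity
      have ht1 : θ / P.normY y ≤ 1 := (div_le_one hypos).2 hlt.le
      refine ⟨(θ / P.normY y) • y, ⟨P.Kstar.smul_mem ht hyK, ?_⟩, ?_⟩
      · have := hP.normY_smul_le ht y
        rwa [div_mul_cancel₀ _ hypos.ne'] at this
      · rw [map_smul, smul_eq_mul]
        have h1 := mul_le_mul_of_nonneg_left (hP.pB_le (P.b - P.An S n α) y)
          (sub_nonneg.2 ht1)
        have h2 : (1 - θ / P.normY y) * (M * P.normY y) = M * (P.normY y - θ) := by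
          field_simp
        have h3 : M * (P.normY y - θ) ≤ M * (δ / g) :=
          mul_le_mul_of_nonneg_left (by linarith) hM
        linarith [h1.trans_eq h2]
  have hsup : P.pB (P.b - P.An S n α) y' ≤ supportFun (P.ballY θ) (P.pB (P.b - P.An S n α)) :=
    le_csSup (hP.bddAbove_ballY θ _) ⟨y', hy'Y, rfl⟩
  have h1 := hy α hα
  rw [Program.lagrangian] at h1
  rw [Program.upperVal]
  have h2 : δ + M * (δ / g) = ε := by
    rw [hδdef]
    field_simp
  linarith

/-! ### Comparison of the infinite and the semi-infinite program -/

theorem Program.IsOptimizer.J_eq {x : X} (hx : P.IsOptimizer x) : P.J = P.pX x P.c :=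
  IsLeast.csInf_eq ⟨⟨x, hx.1, rfl⟩, by rintro _ ⟨x', hx', rfl⟩; exact hx.2 x' hx'⟩

theorem Program.IsOptimizer.J_le_Jn {x : X} (hx : P.IsOptimizer x)
    (hf : (P.feasN S n).Nonempty) : P.J ≤ P.Jn S n := by
  refine le_csInf (hf.image _) ?_
  rintro _ ⟨α, hα, rfl⟩
  rw [hx.J_eq]
  simp only [← Program.pX_sum]
  refine hx.2 _ ?_
  change P.A (∑ i, α i • S.x i) - P.b ∈ P.K
  rw [← Program.An_eq]
  exact hα.1

/-- The point z need not be feasible: its residual differs by 𝒜 (x - z) from that of x, which is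
nonpositive on the dual cone. The exact penalty thus costs at most θ_D ‖𝒜‖ ‖x - z‖, and the
objective changes by at most ‖c‖ ‖x - z‖. -/
theorem Program.Regular.Jn_sub_le_J (hreg : P.Regular S n γ) (hP : P.Standing) (hS : S.Standing)
    (hJ : JLB ≤ P.Jn S n) {x z : X} (hx : P.IsOptimizer x) (hz : z ∈ S.ballX n) :
    P.Jn S n - (P.normC + P.θD S n γ JLB * ‖P.A‖) * ‖x - z‖ ≤ P.J := by
  obtain ⟨α, hα, rfl⟩ := hz
  set z := ∑ i, α i • S.x i with hzdef
  change P.Jn S n - (P.normC + P.θD S n γ JLB * ‖P.A‖) * ‖x - z‖ ≤ P.J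
  have hθ0 : 0 ≤ P.θD S n γ JLB := hreg.θD_nonneg hS hJ
  have h1 := hreg.Jn_le_upperVal hP hS hJ hα
  rw [Program.upperVal, ← Program.pX_sum, ← hzdef] at h1
  have h2 : supportFun (P.ballY (P.θD S n γ JLB)) (P.pB (P.b - P.An S n α)) ≤
      P.θD S n γ JLB * ‖P.A‖ * ‖x - z‖ := by
    refine csSup_le ?_ ?_
    · exact ⟨_, 0, ⟨P.Kstar.zero_mem, by rwa [Program.normY_zero]⟩, rfl⟩
    · rintro _ ⟨y, hy, rfl⟩
      have h3 : 0 ≤ P.pB (P.A x - P.b) y := Program.mem_Kstar.1 hy.1 _ hx.1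
      have h4 : P.pB (P.b - P.An S n α) y = P.pB (P.A (x - z)) y - P.pB (P.A x - P.b) y := by
        rw [Program.An_eq, ← hzdef, ← LinearMap.sub_apply, ← map_sub, map_sub P.A]
        congr 2
        abel
      have h5 := hP.pB_le (P.A (x - z)) y
      have h6 : ‖P.A (x - z)‖ * P.normY y ≤ ‖P.A‖ * ‖x - z‖ * P.θD S n γ JLB :=
        mul_le_mul (P.A.le_opNorm _) hy.2 (hP.normY_nonneg y) (by positivity)
      rw [h4]
      linarith
  have h3 := hP.pX_le (z - x)
  rw [map_sub, LinearMap.sub_apply, norm_sub_rev, ← hx.J_eq] at h3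
  linarith

end Duality

/-! ### An optimal first order method -/

/-- Comparison of increments along an interval: if the increments of `F` are bounded by the right
Riemann sums of `ω`, and those of `G` bound its left Riemann sums, then `F` grows at most like
`G`. -/
theorem sub_le_sub_of_riemann {F G ω : ℝ → ℝ} {a b : ℝ} (hab : a ≤ b)
    (hF : ∀ t t', a ≤ t → t ≤ t' → t' ≤ b → F t' - F t ≤ (t' - t) * ω t')
    (hG : ∀ t t', a ≤ t → t ≤ t' → t' ≤ b → (t' - t) * ω t ≤ G t' - G t) :
    F b - F a ≤ G b - G a := by
  -- On a uniform grid of K + 1 cells the right and left Riemann sums differ by the telescoping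
  -- amount h (ω b - ω a), which tends to 0. Neither integrability nor monotonicity of ω enters.
  have key : ∀ K : ℕ, F b - F a ≤ G b - G a + (b - a) * (ω b - ω a) * (1 / ((K : ℝ) + 1)) := by
    intro K
    set h := (b - a) / ((K : ℝ) + 1) with hh
    have hK : (0 : ℝ) < (K : ℝ) + 1 := by positivity
    have h0 : 0 ≤ h := div_nonneg (sub_nonneg.2 hab) hK.le
    have hKh : ((K : ℝ) + 1) * h = b - a := by rw [hh]; field_simp
    have ind : ∀ i : ℕ, i ≤ K + 1 →
        F (a + i * h) - F a ≤ G (a + i * h) - G a + h * (ω (a + i * h) - ω a) := by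
      intro i
      induction i with
      | zero => simp
      | succ i ih =>
        intro hi
        have hi' : (i : ℝ) + 1 ≤ (K : ℝ) + 1 := by exact_mod_cast hi
        have h1 : a ≤ a + i * h := le_add_of_nonneg_right (by positivity)
        have h2 : a + i * h ≤ a + ((i + 1 : ℕ) : ℝ) * h := by
          push_cast
          linarith
        have h3 : a + ((i + 1 : ℕ) : ℝ) * h ≤ b := by
          push_cast
          have := mul_le_mul_of_nonneg_right hi' h0
          linarith
        have e1 := hF _ _ h1 h2 h3
        have e2 := hG _ _ h1 h2 h3
        have e3 : a + ((i + 1 : ℕ) : ℝ) * h - (a + i * h) = h := by push_cast; ring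
        rw [e3] at e1 e2
        have e4 := ih (by omega)
        linarith
    have := ind (K + 1) le_rfl
    have hb : a + ((K + 1 : ℕ) : ℝ) * h = b := by push_cast; linarith
    rw [hb] at this
    have e : h * (ω b - ω a) = (b - a) * (ω b - ω a) * (1 / ((K : ℝ) + 1)) := by
      rw [hh]; ring
    linarith
  have hlim : Filter.Tendsto
      (fun K : ℕ => G b - G a + (b - a) * (ω b - ω a) * (1 / ((K : ℝ) + 1))) Filter.atTop
      (nhds (G b - G a + (b - a) * (ω b - ω a) * 0)) :=
    (tendsto_one_div_add_atTop_nhds_zero_nat.const_mul _).const_add _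
  rw [mul_zero, add_zero] at hlim
  exact ge_of_tendsto' hlim key

section Method

variable {X : Type*} [NormedAddCommGroup X] [NormedSpace ℝ X] {S : Scheme X} {n : ℕ}
  {φ : (Fin n → ℝ) → ℝ} {g : (Fin n → ℝ) → Fin n → ℝ} {M ϑ : ℝ}

/-- The quadratic upper bound for a convex function with Lipschitz gradient. -/
theorem Scheme.Standing.descent (hS : S.Standing)
    (hsub : ∀ u ∈ S.ballR n, ∀ v ∈ S.ballR n, φ v + (u - v) ⬝ᵥ g v ≤ φ u)
    (hLip : ∀ u ∈ S.ballR n, ∀ v ∈ S.ballR n, S.normRStar n (g u - g v) ≤ M * S.R n (u - v))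
    {v w : Fin n → ℝ} (hv : v ∈ S.ballR n) (hw : w ∈ S.ballR n) :
    φ v ≤ φ w + (v - w) ⬝ᵥ g w + M / 2 * S.R n (v - w) ^ 2 := by
  set p : ℝ → Fin n → ℝ := fun t => w + t • (v - w) with hp
  have hmem : ∀ t, 0 ≤ t → t ≤ 1 → p t ∈ S.ballR n := fun t h0 h1 => by
    have := S.convex_ballR n hw hv (sub_nonneg.2 h1) h0 (by ring)
    convert this using 1
    simp only [hp]
    module
  -- Along the segment, the subgradient inequality at the later point bounds each increment by the
  -- slope there; ω is the Lipschitz majorant of the slope and G its primitive. No differentiability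
  -- of φ is needed.
  have key := sub_le_sub_of_riemann (a := 0) (b := 1) (F := fun t => φ (p t))
    (ω := fun t => (v - w) ⬝ᵥ g w + t * (M * S.R n (v - w) ^ 2))
    (G := fun t => t * ((v - w) ⬝ᵥ g w) + t ^ 2 / 2 * (M * S.R n (v - w) ^ 2)) zero_le_one
    (fun t t' h0 htt' h1 => by
      have e1 := hsub (p t) (hmem t h0 (htt'.trans h1)) (p t') (hmem t' (h0.trans htt') h1)
      have e2 : p t - p t' = (t - t') • (v - w) := by simp only [hp]; module
      rw [e2, smul_dotProduct, smul_eq_mul] at e1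
      have e3 := hS.dot_le (v - w) (g (p t') - g w)
      have e4 := hLip (p t') (hmem t' (h0.trans htt') h1) w hw
      have e5 : p t' - w = t' • (v - w) := by simp only [hp]; module
      rw [e5, map_smul_eq_mul, Real.norm_of_nonneg (h0.trans htt')] at e4
      rw [dotProduct_sub] at e3
      have e6 := e3.trans (mul_le_mul_of_nonneg_left e4 (apply_nonneg (S.R n) (v - w)))
      have e7 := mul_le_mul_of_nonneg_left (sub_le_iff_le_add.1 e6) (sub_nonneg.2 htt')
      have e8 : S.R n (v - w) * (M * (t' * S.R n (v - w))) = t' * (M * S.R n (v - w) ^ 2) := by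
        ring
      rw [e8] at e7
      linarith)
    (fun t t' h0 htt' h1 => by
      have hM : 0 ≤ M * S.R n (v - w) ^ 2 := by
        have e := (hS.normRStar_nonneg _).trans (hLip v hv w hw)
        have := mul_nonneg e (apply_nonneg (S.R n) (v - w))
        linarith
      have := mul_nonneg hM (sq_nonneg (t' - t))
      nlinarith)
  have hp1 : p 1 = v := by simp [hp]
  have hp0 : p 0 = w := by simp [hp]
  simp only [hp1, hp0] at key
  linarith

/-- The minimizer of a linear functional plus the squared norm is a strong minimizer. -/
theorem Scheme.IsProxStep.strong_min (hϑ : 0 < ϑ)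
    (hconv : StronglyConvex (S.R n) univ ϑ (fun α => S.R n α ^ 2 / 2)) {q z x : Fin n → ℝ}
    (hz : S.IsProxStep n ϑ q 0 z) (hx : x ∈ S.ballR n) :
    q ⬝ᵥ z + 1 / (2 * ϑ) * S.R n z ^ 2 + 1 / 2 * S.R n (x - z) ^ 2 ≤
      q ⬝ᵥ x + 1 / (2 * ϑ) * S.R n x ^ 2 := by
  -- Compare z with the point a fraction t = 1 / (K + 1) of the way to x, cancel t, and let K tend
  -- to infinity.
  have key : ∀ K : ℕ, 1 / 2 * (1 - 1 / ((K : ℝ) + 1)) * S.R n (x - z) ^ 2 ≤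
      q ⬝ᵥ x + 1 / (2 * ϑ) * S.R n x ^ 2 - (q ⬝ᵥ z + 1 / (2 * ϑ) * S.R n z ^ 2) := by
    intro K
    set t : ℝ := 1 / ((K : ℝ) + 1) with ht
    have ht0 : 0 < t := by positivity
    have ht1 : 0 ≤ 1 - t := sub_nonneg.2 (by
      rw [ht, div_le_one (by positivity)]
      linarith [(Nat.cast_nonneg K : (0 : ℝ) ≤ K)])
    have h1 := hz.2 _ (S.convex_ballR n hx hz.1 ht0.le ht1 (by ring))
    have h2 := hconv x (mem_univ _) z (mem_univ _) t (1 - t) ht0.le ht1 (by ring)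
    have h3 := mul_le_mul_of_nonneg_left h2 (inv_pos.2 hϑ).le
    simp only [sub_zero, dotProduct_add, dotProduct_smul, smul_eq_mul] at h1 h3
    have e1 : ϑ⁻¹ * (S.R n (t • x + (1 - t) • z) ^ 2 / 2) =
      1 / (2 * ϑ) * S.R n (t • x + (1 - t) • z) ^ 2 := by field_simp
    have e2 : ϑ⁻¹ * (t * (S.R n x ^ 2 / 2) + (1 - t) * (S.R n z ^ 2 / 2) -
        ϑ / 2 * (t * (1 - t)) * S.R n (x - z) ^ 2) =
      t * (1 / (2 * ϑ) * S.R n x ^ 2) + (1 - t) * (1 / (2 * ϑ) * S.R n z ^ 2) -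
        t * (1 / 2 * (1 - t) * S.R n (x - z) ^ 2) := by field_simp
    rw [e1, e2] at h3
    have h4 : t * (1 / 2 * (1 - t) * S.R n (x - z) ^ 2) ≤
        t * (q ⬝ᵥ x + 1 / (2 * ϑ) * S.R n x ^ 2 - (q ⬝ᵥ z + 1 / (2 * ϑ) * S.R n z ^ 2)) := by
      linarith
    exact le_of_mul_le_mul_left h4 ht0
  have hlim : Filter.Tendsto
      (fun K : ℕ => 1 / 2 * (1 - 1 / ((K : ℝ) + 1)) * S.R n (x - z) ^ 2) Filter.atTop
      (nhds (1 / 2 * (1 - 0) * S.R n (x - z) ^ 2)) :=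
    ((tendsto_one_div_add_atTop_nhds_zero_nat.const_sub 1).const_mul _).mul_const _
  have := le_of_tendsto' hlim key
  linarith

/-- Strong convexity at the midpoint of 0 and the all-ones vector, nonzero since n ≥ 1. It lets M /
2 be absorbed by M / (2 ϑ). -/
theorem Scheme.Standing.param_le_one (hS : S.Standing) (hn : 1 ≤ n)
    (hconv : StronglyConvex (S.R n) univ ϑ (fun α => S.R n α ^ 2 / 2)) : ϑ ≤ 1 := by
  have hpos : 0 < S.R n 1 := lt_of_le_of_ne (apply_nonneg _ _) fun h => by
    have := congrFun (hS.definite n 1 h.symm) ⟨0, hn⟩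
    simp at this
  have h := hconv 1 (mem_univ _) 0 (mem_univ _) (1 / 2) (1 / 2) (by norm_num) (by norm_num)
    (by norm_num)
  simp only [smul_zero, add_zero, sub_zero, map_smul_eq_mul, map_zero] at h
  rw [Real.norm_of_nonneg (by norm_num)] at h
  have := sq_pos_of_pos hpos
  nlinarith

/-- The estimate sequence of the optimal scheme. -/
def estimate (S : Scheme X) (φ : (Fin n → ℝ) → ℝ) (g : (Fin n → ℝ) → Fin n → ℝ) (M ϑ : ℝ)
    (w : ℕ → Fin n → ℝ) (k : ℕ) (x : Fin n → ℝ) : ℝ :=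
  M / (2 * ϑ) * S.R n x ^ 2 +
    ∑ j ∈ Finset.range (k + 1), ((j : ℝ) + 1) / 2 * (φ (w j) + (x - w j) ⬝ᵥ g (w j))

/-- Convergence of the optimal scheme for an arbitrary starting point. -/
theorem Scheme.Standing.le_estimate (hS : S.Standing) (hM : 0 < M) (hϑ : 0 < ϑ) (hϑ1 : ϑ ≤ 1)
    (hsub : ∀ u ∈ S.ballR n, ∀ v ∈ S.ballR n, φ v + (u - v) ⬝ᵥ g v ≤ φ u)
    (hLip : ∀ u ∈ S.ballR n, ∀ v ∈ S.ballR n, S.normRStar n (g u - g v) ≤ M * S.R n (u - v))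
    (hconv : StronglyConvex (S.R n) univ ϑ (fun α => S.R n α ^ 2 / 2))
    {w z a : ℕ → Fin n → ℝ} (hw : ∀ k, w k ∈ S.ballR n)
    (hz : ∀ k, S.IsProxStep n ϑ
      (∑ j ∈ Finset.range (k + 1), (((j : ℝ) + 1) / 2) • M⁻¹ • g (w j)) 0 (z k))
    (ha : ∀ k, S.IsProxStep n ϑ ((1 / ϑ) • M⁻¹ • g (w k)) (w k) (a k))
    (hstep : ∀ k : ℕ, w (k + 1) =
      (2 / ((k : ℝ) + 3)) • z k + (((k : ℝ) + 1) / ((k : ℝ) + 3)) • a k)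
    (k : ℕ) {x : Fin n → ℝ} (hx : x ∈ S.ballR n) :
    ((k : ℝ) + 1) * ((k : ℝ) + 2) / 4 * φ (a k) ≤
      estimate S φ g M ϑ w k x + M / 2 * S.θP ^ 2 := by
  have hθ : 0 ≤ S.θP := (apply_nonneg (S.R n) x).trans hx
  -- Multiplied by M ϑ, the prox objective is the quadratic upper model of φ at `w k` up to a
  -- constant, so `a k` minimizes this model.
  have hstepA : ∀ k, ∀ v ∈ S.ballR n,
      φ (a k) ≤ φ (w k) + (v - w k) ⬝ᵥ g (w k) + M / 2 * S.R n (v - w k) ^ 2 := by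
    intro k v hv
    have h1 := hS.descent hsub hLip (ha k).1 (hw k)
    have h2 := mul_le_mul_of_nonneg_left ((ha k).2 v hv) (mul_pos hM hϑ).le
    simp only [smul_dotProduct, smul_eq_mul] at h2
    have e : ∀ p r : ℝ, M * ϑ * (1 / ϑ * (M⁻¹ * p) + 1 / (2 * ϑ) * r) = p + M / 2 * r := by
      intro p r
      field_simp
    rw [e, e, dotProduct_comm _ (a k), dotProduct_comm _ v] at h2
    rw [sub_dotProduct] at h1 ⊢
    linarith
  -- Up to a constant, the estimate function is M times the prox objective minimized by `z k`.
  have hstrong : ∀ k, ∀ x ∈ S.ballR n,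
      estimate S φ g M ϑ w k (z k) + M / 2 * S.R n (x - z k) ^ 2 ≤
        estimate S φ g M ϑ w k x := by
    intro k x hx
    have h1 := mul_le_mul_of_nonneg_left ((hz k).strong_min hϑ hconv hx) hM.le
    have e : ∀ u : Fin n → ℝ, estimate S φ g M ϑ w k u =
        M * ((∑ j ∈ Finset.range (k + 1), (((j : ℝ) + 1) / 2) • M⁻¹ • g (w j)) ⬝ᵥ u +
          1 / (2 * ϑ) * S.R n u ^ 2) +
        ∑ j ∈ Finset.range (k + 1), ((j : ℝ) + 1) / 2 * (φ (w j) - w j ⬝ᵥ g (w j)) := by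
      intro u
      rw [estimate, mul_add, sum_dotProduct, Finset.mul_sum, add_right_comm,
        ← Finset.sum_add_distrib, add_comm]
      congr 1
      · refine Finset.sum_congr rfl fun j _ => ?_
        rw [smul_dotProduct, smul_dotProduct, smul_eq_mul, smul_eq_mul, sub_dotProduct,
          dotProduct_comm u]
        field_simp
        ring
      · field_simp
    rw [e, e]
    linarith
  induction k generalizing x with
  | zero =>
    have h1 := hstepA 0 x hx
    -- The start `w 0` need not be the prox centre 0; this is what the extra M / 2 * θP ^ 2 pays
    -- for.
    have h2 : S.R n (x - w 0) ≤ S.R n x + S.θP :=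
      (map_sub_le_add (S.R n) x (w 0)).trans (add_le_add_right (hw 0) _)
    have h3 : S.R n (x - w 0) ^ 2 ≤ (S.R n x + S.θP) ^ 2 :=
      pow_le_pow_left₀ (apply_nonneg _ _) h2 2
    have h4 : M / 2 * S.R n x ^ 2 ≤ M / (2 * ϑ) * S.R n x ^ 2 := by
      refine mul_le_mul_of_nonneg_right ?_ (sq_nonneg _)
      exact div_le_div_of_nonneg_left hM.le (by positivity) (by linarith)
    have h5 : M / 4 * S.R n (x - w 0) ^ 2 ≤ M / 2 * S.R n x ^ 2 + M / 2 * S.θP ^ 2 := by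
      have : S.R n (x - w 0) ^ 2 ≤ 2 * S.R n x ^ 2 + 2 * S.θP ^ 2 := by
        nlinarith [sq_nonneg (S.R n x - S.θP)]
      nlinarith
    simp only [estimate, zero_add, Finset.sum_range_one, Nat.cast_zero]
    linarith
  | succ k ih =>
    have hk : (0 : ℝ) ≤ k := Nat.cast_nonneg k
    set τ : ℝ := 2 / ((k : ℝ) + 3) with hτ
    have hτ1 : ((k : ℝ) + 1) / ((k : ℝ) + 3) = 1 - τ := by
      rw [hτ]
      field_simp
      ring
    have hτ0 : 0 ≤ τ := by positivity
    have hτ2 : 0 ≤ 1 - τ := by rw [← hτ1]; positivity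
    -- The displacement of v from `w (k + 1)` is τ (x - z k), so the quadratic term of the model is
    -- covered by the strong minimality of `z k`.
    set v := τ • x + (1 - τ) • a k with hv
    have hvmem : v ∈ S.ballR n := S.convex_ballR n hx (ha k).1 hτ0 hτ2 (by ring)
    have hvw : v - w (k + 1) = τ • (x - z k) := by
      rw [hstep, hτ1, hv]
      module
    have h1 := hstepA (k + 1) v hvmem
    have hR : S.R n (v - w (k + 1)) = τ * S.R n (x - z k) := by
      rw [hvw, map_smul_eq_mul, Real.norm_of_nonneg hτ0]
    rw [hR] at h1
    have h2 := (ih (hz k).1).trans (add_le_add_left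
      (le_sub_iff_add_le.2 (hstrong k x hx)) _)
    have h3 := hsub (a k) (ha k).1 (w (k + 1)) (hw (k + 1))
    have h4 : estimate S φ g M ϑ w (k + 1) x = estimate S φ g M ϑ w k x +
        ((k : ℝ) + 2) / 2 * (φ (w (k + 1)) + (x - w (k + 1)) ⬝ᵥ g (w (k + 1))) := by
      rw [estimate, estimate, Finset.sum_range_succ _ (k + 1), ← add_assoc]
      push_cast
      ring
    have hlin : (v - w (k + 1)) ⬝ᵥ g (w (k + 1)) =
        τ * ((x - w (k + 1)) ⬝ᵥ g (w (k + 1))) +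
          (1 - τ) * ((a k - w (k + 1)) ⬝ᵥ g (w (k + 1))) := by
      have : v - w (k + 1) = τ • (x - w (k + 1)) + (1 - τ) • (a k - w (k + 1)) := by
        rw [hv]
        module
      rw [this, add_dotProduct, smul_dotProduct, smul_dotProduct, smul_eq_mul, smul_eq_mul]
    rw [hlin] at h1
    -- With A_k = (k + 1)(k + 2) / 4: A_{k+1} τ is the new weight in the estimate, A_{k+1} (1 - τ) =
    -- A_k, and A_{k+1} τ² ≤ 1.
    have hA : ((k : ℝ) + 2) * ((k : ℝ) + 3) / 4 * τ = ((k : ℝ) + 2) / 2 := by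
      rw [hτ]
      field_simp
      ring
    have hA' : ((k : ℝ) + 2) * ((k : ℝ) + 3) / 4 * (1 - τ) = ((k : ℝ) + 1) * ((k : ℝ) + 2) / 4 := by
      rw [mul_sub, hA]
      ring
    have hA2 : ((k : ℝ) + 2) * ((k : ℝ) + 3) / 4 * τ ^ 2 ≤ 1 := by
      rw [pow_two, ← mul_assoc, hA, hτ, div_mul_div_comm, div_le_one (by positivity)]
      linarith
    have hApos : 0 ≤ ((k : ℝ) + 2) * ((k : ℝ) + 3) / 4 := by positivity
    have h5 := mul_le_mul_of_nonneg_left h1 hApos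
    have h6 := mul_le_mul_of_nonneg_left h3
      (show 0 ≤ ((k : ℝ) + 1) * ((k : ℝ) + 2) / 4 by positivity)
    have h7 : ((k : ℝ) + 2) * ((k : ℝ) + 3) / 4 * (M / 2 * (τ * S.R n (x - z k)) ^ 2) ≤
        M / 2 * S.R n (x - z k) ^ 2 := by
      have e : ((k : ℝ) + 2) * ((k : ℝ) + 3) / 4 * (M / 2 * (τ * S.R n (x - z k)) ^ 2) =
        (((k : ℝ) + 2) * ((k : ℝ) + 3) / 4 * τ ^ 2) * (M / 2 * S.R n (x - z k) ^ 2) := by ring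
      rw [e]
      exact mul_le_of_le_one_left (by positivity) hA2
    have e8 : ((k : ℝ) + 2) * ((k : ℝ) + 3) / 4 *
        (φ (w (k + 1)) + (τ * ((x - w (k + 1)) ⬝ᵥ g (w (k + 1))) +
          (1 - τ) * ((a k - w (k + 1)) ⬝ᵥ g (w (k + 1)))) +
            M / 2 * (τ * S.R n (x - z k)) ^ 2) =
        ((k : ℝ) + 2) / 2 * (φ (w (k + 1)) + (x - w (k + 1)) ⬝ᵥ g (w (k + 1))) +
        ((k : ℝ) + 1) * ((k : ℝ) + 2) / 4 *
          (φ (w (k + 1)) + (a k - w (k + 1)) ⬝ᵥ g (w (k + 1))) +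
        ((k : ℝ) + 2) * ((k : ℝ) + 3) / 4 * (M / 2 * (τ * S.R n (x - z k)) ^ 2) := by
      rw [← hA, ← hA']
      ring
    rw [e8] at h5
    rw [h4]
    push_cast
    have e9 : ((k : ℝ) + 1 + 1) * ((k : ℝ) + 1 + 2) / 4 = ((k : ℝ) + 2) * ((k : ℝ) + 3) / 4 := by
      ring
    rw [e9]
    linarith

end Method

/-! ### Smoothing -/

/-- A primitive of `s ↦ max (log (c₀ / s)) 1` that vanishes at `0`. -/
def logPrimitive (c₀ s : ℝ) : ℝ :=
  s * max (Real.log (c₀ * s⁻¹)) 1 + min s (c₀ / Real.exp 1)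

/-- The two regimes meet at s = c₀ / e; the truncation of s at that point gives one formula for
both. -/
theorem max_log_eq {c₀ s : ℝ} (hc : 0 < c₀) (hs : 0 < s) :
    max (Real.log (c₀ * s⁻¹)) 1 =
      Real.log (c₀ / Real.exp 1) - Real.log (min s (c₀ / Real.exp 1)) + 1 := by
  have he := Real.exp_pos 1
  have h1 : Real.log (c₀ * s⁻¹) = Real.log c₀ - Real.log s := by
    rw [Real.log_mul hc.ne' (inv_pos.2 hs).ne', Real.log_inv]
    ring
  have h2 : Real.log (c₀ / Real.exp 1) = Real.log c₀ - 1 := by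
    rw [Real.log_div hc.ne' he.ne', Real.log_exp]
  rcases le_total s (c₀ / Real.exp 1) with h | h
  · rw [min_eq_left h, max_eq_left, h1, h2]
    · ring
    · have := Real.log_le_log hs h
      rw [h1]
      linarith
  · rw [min_eq_right h, sub_self, zero_add, max_eq_right]
    have := Real.log_le_log (div_pos hc he) h
    rw [h1]
    linarith

/-- The integrand is nonincreasing, so the right-endpoint rectangle lies below the integral. In
terms of the truncations this is s (log m' - log m) ≤ m' - m, a case of log x ≤ x - 1. -/
theorem mul_le_logPrimitive_sub {c₀ s s' : ℝ} (hc : 0 < c₀) (hs : 0 < s) (hss' : s ≤ s') :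
    (s' - s) * max (Real.log (c₀ * s'⁻¹)) 1 ≤ logPrimitive c₀ s' - logPrimitive c₀ s := by
  have hp : 0 < c₀ / Real.exp 1 := div_pos hc (Real.exp_pos 1)
  have hs' : 0 < s' := hs.trans_le hss'
  rw [logPrimitive, logPrimitive, max_log_eq hc hs, max_log_eq hc hs']
  set p := c₀ / Real.exp 1
  set m := min s p with hm
  set m' := min s' p with hm'
  have hmpos : 0 < m := lt_min hs hp
  have hm'pos : 0 < m' := lt_min hs' hp
  have key : s * (Real.log m' - Real.log m) ≤ m' - m := by
    rcases le_total s p with h | h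
    · have e : m = s := min_eq_left h
      have h1 := Real.log_le_sub_one_of_pos (div_pos hm'pos hmpos)
      rw [Real.log_div hm'pos.ne' hmpos.ne'] at h1
      rw [← e]
      have h2 := mul_le_mul_of_nonneg_left h1 hmpos.le
      have e2 : m * (m' / m - 1) = m' - m := by field_simp
      linarith
    · have e : m = p := min_eq_right h
      have e' : m' = p := min_eq_right (h.trans hss')
      rw [e, e']
      simp
  linarith

theorem logPrimitive_mono {c₀ s s' : ℝ} (hc : 0 < c₀) (hs : 0 < s) (hss' : s ≤ s') :
    logPrimitive c₀ s ≤ logPrimitive c₀ s' := by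
  have h1 := mul_le_logPrimitive_sub hc hs hss'
  have h2 : 0 ≤ (s' - s) * max (Real.log (c₀ * s'⁻¹)) 1 :=
    mul_nonneg (sub_nonneg.2 hss') (zero_le_one.trans (le_max_right _ _))
  linarith

theorem logPrimitive_nonneg {c₀ s : ℝ} (hc : 0 < c₀) (hs : 0 < s) : 0 ≤ logPrimitive c₀ s :=
  add_nonneg (mul_nonneg hs.le (zero_le_one.trans (le_max_right _ _)))
    (le_min hs.le (div_pos hc (Real.exp_pos 1)).le)

/-- The choice of the regularization parameter makes the smoothing error less than `21/25 ε`. -/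
theorem mul_logPrimitive_le {c₀ C₀ ε η : ℝ} (hc : 0 < c₀) (hC : 0 < C₀) (hε : 0 < ε) (hη : 0 < η)
    (hle : η ≤ ε / (2 * C₀ * max (2 * Real.log (2 * c₀ * C₀ * ε⁻¹)) 1)) :
    C₀ * logPrimitive c₀ η ≤ 21 / 25 * ε := by
  set u := 2 * c₀ * C₀ * ε⁻¹ with hu
  have hupos : 0 < u := by positivity
  set m := max (2 * Real.log u) 1 with hm
  have hm1 : 1 ≤ m := le_max_right _ _
  have hmpos : 0 < m := zero_lt_one.trans_le hm1
  have hlogu : Real.log u ≤ m / 2 := by linarith [le_max_left (2 * Real.log u) 1]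
  have he := Real.exp_pos 1
  set η' := ε / (2 * C₀ * m) with hη'
  refine (mul_le_mul_of_nonneg_left (logPrimitive_mono hc hη hle) hC.le).trans ?_
  have e1 : c₀ * η'⁻¹ = u * m := by
    rw [hη', hu]
    field_simp
  have e2 : C₀ * η' = ε / 2 * m⁻¹ := by
    rw [hη']
    field_simp
  have e3 : C₀ * (c₀ / Real.exp 1) = ε / 2 * (u / Real.exp 1) := by
    rw [hu]
    field_simp
  have hmin1 : C₀ * min η' (c₀ / Real.exp 1) ≤ ε / 2 * m⁻¹ :=
    (mul_le_mul_of_nonneg_left (min_le_left _ _) hC.le).trans_eq e2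
  have hmin2 : C₀ * min η' (c₀ / Real.exp 1) ≤ ε / 2 * (u / Real.exp 1) :=
    (mul_le_mul_of_nonneg_left (min_le_right _ _) hC.le).trans_eq e3
  rw [logPrimitive, mul_add, ← mul_assoc, e2, e1]
  -- After factoring out ε / 2: if the logarithm is at least 1, log m ≤ m - 1 gives 3 / 2. Otherwise
  -- m ≥ 6 / 5 gives 2 · 5 / 6, while m ≤ 6 / 5 gives log u ≤ 3 / 5 and hence 1 + 17 / 25, which
  -- fixes the constant.
  suffices h : m⁻¹ * max (Real.log (u * m)) 1 + min m⁻¹ (u / Real.exp 1) ≤ 42 / 25 by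
    have h1 : C₀ * min η' (c₀ / Real.exp 1) ≤ ε / 2 * min m⁻¹ (u / Real.exp 1) := by
      rcases min_choice m⁻¹ (u / Real.exp 1) with h' | h' <;> rw [h'] <;> assumption
    have h2 := mul_le_mul_of_nonneg_left h (half_pos hε).le
    linarith
  have hinv : m⁻¹ ≤ 1 := inv_le_one_of_one_le₀ hm1
  rcases le_total 1 (Real.log (u * m)) with h | h
  · rw [max_eq_left h, Real.log_mul hupos.ne' hmpos.ne']
    have h1 := Real.log_le_sub_one_of_pos hmpos
    have h2 : m⁻¹ * (Real.log u + Real.log m) ≤ m⁻¹ * (m / 2 + (m - 1)) :=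
      mul_le_mul_of_nonneg_left (add_le_add hlogu h1) (inv_pos.2 hmpos).le
    have h3 : m⁻¹ * (m / 2 + (m - 1)) = 3 / 2 - m⁻¹ := by
      field_simp
      ring
    have h4 := min_le_left m⁻¹ (u / Real.exp 1)
    linarith
  · rw [max_eq_right h, mul_one]
    rcases le_total (6 / 5) m with h6 | h6
    · have h1 : m⁻¹ ≤ 5 / 6 := by
        rw [inv_le_comm₀ hmpos (by norm_num)]
        linarith
      have h2 := min_le_left m⁻¹ (u / Real.exp 1)
      linarith
    · have h1 : u ≤ Real.exp (3 / 5) := by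
        rw [← Real.log_le_iff_le_exp hupos]
        linarith
      have h2 : u / Real.exp 1 ≤ 17 / 25 := by
        rw [div_le_iff₀ he]
        have h3 : Real.exp 1 = Real.exp (3 / 5) * Real.exp (2 / 5) := by
          rw [← Real.exp_add]
          norm_num
        have h4 := Real.quadratic_le_exp_of_nonneg (x := 2 / 5) (by norm_num)
        have h5 : 1 ≤ 17 / 25 * Real.exp (2 / 5) := by linarith
        have h7 := mul_le_mul_of_nonneg_left h5 (Real.exp_pos (3 / 5)).le
        rw [h3]
        linarith
      have h3 := min_le_right m⁻¹ (u / Real.exp 1)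
      linarith

/-! ### The smoothed objective and its duality gap. -/

section Smoothing

variable {X C B Y : Type*} [NormedAddCommGroup X] [NormedSpace ℝ X]
  [AddCommGroup C] [Module ℝ C] [NormedAddCommGroup B] [NormedSpace ℝ B]
  [AddCommGroup Y] [Module ℝ Y] {P : Program X C B Y} {S : Scheme X} {n : ℕ}
  {θ η L ϑ : ℝ} {d : Y → ℝ} {ystar : ℝ → (Fin n → ℝ) → Y}

/-- The smoothed objective function. -/
def Program.smoothed (P : Program X C B Y) (S : Scheme X) (n : ℕ) (d : Y → ℝ)
    (ystar : ℝ → (Fin n → ℝ) → Y) (η : ℝ) (α : Fin n → ℝ) : ℝ :=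
  P.lagrangian S n α (ystar η α) - η * d (ystar η α)

theorem Program.IsProxMaximizer.le_smoothed (hy : P.IsProxMaximizer S n θ d ystar) (hη : 0 < η)
    {α : Fin n → ℝ} (hα : α ∈ S.ballR n) {y : Y} (hyY : y ∈ P.ballY θ) :
    P.lagrangian S n α y - η * d y ≤ P.smoothed S n d ystar η α := by
  have := (hy η hη α hα).2 y hyY
  rw [Program.smoothed, Program.lagrangian, Program.lagrangian]
  linarith

/-- Discrete envelope theorem: the maximizer for s competes at s'. -/
theorem Program.IsProxMaximizer.smoothed_sub_le (hy : P.IsProxMaximizer S n θ d ystar)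
    {s s' : ℝ} (hs : 0 < s) (hs' : 0 < s') {α : Fin n → ℝ} (hα : α ∈ S.ballR n) :
    P.smoothed S n d ystar s α - P.smoothed S n d ystar s' α ≤ (s' - s) * d (ystar s α) := by
  have := hy.le_smoothed hs' hα (hy s hs α hα).1
  rw [Program.smoothed]
  linarith

/-- The smoothing error under a logarithmic growth bound on the prox-function. -/
theorem Program.IsProxMaximizer.upperVal_le (hy : P.IsProxMaximizer S n θ d ystar)
    (hθ : 0 ≤ θ) (hη : 0 < η) {c₀ C₀ : ℝ} (hc : 0 < c₀) (hC : 0 < C₀)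
    (hgrowth : ∀ s > 0, ∀ α ∈ S.ballR n, d (ystar s α) ≤ C₀ * max (Real.log (c₀ * s⁻¹)) 1)
    {α : Fin n → ℝ} (hα : α ∈ S.ballR n) :
    P.upperVal S n θ α ≤ P.smoothed S n d ystar η α + C₀ * logPrimitive c₀ η := by
  have hint : ∀ s, 0 < s → s ≤ η → P.smoothed S n d ystar s α ≤
      P.smoothed S n d ystar η α + C₀ * logPrimitive c₀ η := by
    intro s hs hsη
    -- Integrates the envelope inequality over the smoothing parameter. The reversal t ↦ -t puts the
    -- smaller parameter, where the prox-function is evaluated, at the right end of each cell.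
    have key := sub_le_sub_of_riemann (a := -η) (b := -s)
      (F := fun t => P.smoothed S n d ystar (-t) α)
      (ω := fun t => C₀ * max (Real.log (c₀ * (-t)⁻¹)) 1)
      (G := fun t => -(C₀ * logPrimitive c₀ (-t))) (neg_le_neg hsη)
      (fun t t' h1 h2 h3 => by
        have h4 := hy.smoothed_sub_le (s := -t') (s' := -t) (by linarith) (by linarith) hα
        have h5 := mul_le_mul_of_nonneg_left (hgrowth (-t') (by linarith) α hα)
          (sub_nonneg.2 h2)
        have h6 : -t - -t' = t' - t := by ring
        rw [h6] at h4
        exact h4.trans h5)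
      (fun t t' h1 h2 h3 => by
        have h4 := mul_le_logPrimitive_sub hc (s := -t') (s' := -t) (by linarith) (by linarith)
        have h5 := mul_le_mul_of_nonneg_left h4 hC.le
        have h6 : -t - -t' = t' - t := by ring
        rw [h6] at h5
        linarith)
    simp only [neg_neg] at key
    have := mul_nonneg hC.le (logPrimitive_nonneg hc hs)
    linarith
  have hbound : ∀ y ∈ P.ballY θ, P.lagrangian S n α y ≤
      P.smoothed S n d ystar η α + C₀ * logPrimitive c₀ η := by
    intro y hyY
    -- For fixed y the regularization term tends to 0 with its parameter, so no bound on the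
    -- prox-function over the whole ball is needed.
    have hlim : Filter.Tendsto (fun K : ℕ => P.lagrangian S n α y - η * (1 / ((K : ℝ) + 1)) * d y)
        Filter.atTop (nhds (P.lagrangian S n α y - η * 0 * d y)) :=
      ((tendsto_one_div_add_atTop_nhds_zero_nat.const_mul η).mul_const _).const_sub _
    rw [mul_zero, zero_mul, sub_zero] at hlim
    refine le_of_tendsto' hlim fun K => ?_
    have h0 : 0 < η * (1 / ((K : ℝ) + 1)) := by positivity
    refine (hy.le_smoothed h0 hα hyY).trans (hint _ h0 (mul_le_of_le_one_right hη.le ?_))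
    rw [div_le_one (by positivity)]
    linarith [(Nat.cast_nonneg K : (0 : ℝ) ≤ K)]
  rw [Program.upperVal, ← le_sub_iff_add_le']
  refine csSup_le ⟨_, 0, ⟨P.Kstar.zero_mem, by rwa [Program.normY_zero]⟩, rfl⟩ ?_
  rintro _ ⟨y, hyY, rfl⟩
  have := hbound y hyY
  rw [Program.lagrangian] at this
  linarith

theorem Program.IsRun.mem_ballR {w z a : ℕ → Fin n → ℝ} (hrun : P.IsRun S n ystar η L ϑ w z a)
    (k : ℕ) : w k ∈ S.ballR n := by
  cases k with
  | zero => exact hrun.init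
  | succ k =>
    rw [hrun.stepW]
    refine S.convex_ballR n (hrun.stepZ k).1 (hrun.stepA k).1 (by positivity) (by positivity) ?_
    field_simp
    ring

theorem sum_weights (k : ℕ) :
    ∑ j ∈ Finset.range (k + 1), (2 * ((j : ℝ) + 1) / (((k : ℝ) + 1) * ((k : ℝ) + 2))) = 1 := by
  rw [← Finset.sum_div, div_eq_one_iff_eq (by positivity)]
  induction k with
  | zero => norm_num
  | succ k ih =>
    rw [Finset.sum_range_succ, ih]
    push_cast
    ring

theorem Program.Standing.yhat_mem (hP : P.Standing) (hy : P.IsProxMaximizer S n θ d ystar)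
    (hη : 0 < η) {w : ℕ → Fin n → ℝ} (hw : ∀ k, w k ∈ S.ballR n) (k : ℕ) :
    yhat ystar η w k ∈ P.ballY θ :=
  (hP.convex_ballY θ).sum_mem (fun _ _ => by positivity) (sum_weights k)
    fun j _ => (hy η hη _ (hw j)).1

theorem lagrangian_yhat (w : ℕ → Fin n → ℝ) (k : ℕ) (x : Fin n → ℝ) :
    P.lagrangian S n x (yhat ystar η w k) =
      ∑ j ∈ Finset.range (k + 1), 2 * ((j : ℝ) + 1) / (((k : ℝ) + 1) * ((k : ℝ) + 2)) *
        P.lagrangian S n x (ystar η (w j)) := by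
  simp only [Program.lagrangian, yhat, map_sum, map_smul, smul_eq_mul]
  rw [Finset.sum_congr rfl fun (j : ℕ) _ => mul_add (2 * ((j : ℝ) + 1) /
    (((k : ℝ) + 1) * ((k : ℝ) + 2))) (x ⬝ᵥ P.cvec S n) _, Finset.sum_add_distrib,
    ← Finset.sum_mul, sum_weights, one_mul]

/-- The duality gap of the smoothed problem after `k` iterations. -/
theorem Program.IsRun.smoothed_le {w z a : ℕ → Fin n → ℝ}
    (hrun : P.IsRun S n ystar η L ϑ w z a) (hS : S.Standing) (hn : 1 ≤ n) (hθP : 0 < S.θP)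
    (hd : ∀ y ∈ P.ballY θ, 0 ≤ d y) (hy : P.IsProxMaximizer S n θ d ystar)
    (hη : 0 < η) (hL : 0 < L) (hLip : P.LipschitzGradient S n ystar L η) (hϑ : 0 < ϑ)
    (hconv : StronglyConvex (S.R n) Set.univ ϑ (fun α => S.R n α ^ 2 / 2)) (k : ℕ) :
    P.smoothed S n d ystar η (a k) ≤ P.lowerVal S n (yhat ystar η w k) +
      4 * L * S.θP ^ 2 / (ϑ * η * (((k : ℝ) + 1) * ((k : ℝ) + 2))) := by
  have hw := hrun.mem_ballR
  -- A subgradient of the smoothed objective: the linearization at v is the regularized Lagrangian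
  -- with the multiplier frozen at `ystar η v`.
  set g : (Fin n → ℝ) → Fin n → ℝ := fun α => P.cvec S n - P.AnStar S n (ystar η α) with hg
  have hM : 0 < L / η := div_pos hL hη
  have hlin : ∀ u v, P.smoothed S n d ystar η v + (u - v) ⬝ᵥ g v =
      P.lagrangian S n u (ystar η v) - η * d (ystar η v) := by
    intro u v
    simp only [Program.smoothed, Program.lagrangian_eq, hg, sub_dotProduct, dotProduct_sub]
    ring
  have hsub : ∀ u ∈ S.ballR n, ∀ v ∈ S.ballR n,
      P.smoothed S n d ystar η v + (u - v) ⬝ᵥ g v ≤ P.smoothed S n d ystar η u := by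
    intro u hu v hv
    rw [hlin]
    exact hy.le_smoothed hη hu (hy η hη v hv).1
  have hgLip : ∀ u ∈ S.ballR n, ∀ v ∈ S.ballR n,
      S.normRStar n (g u - g v) ≤ L / η * S.R n (u - v) := by
    intro u hu v hv
    have := hLip u hu v hv
    rw [← Scheme.normRStar_neg] at this
    convert this using 2
    simp only [hg]
    abel
  have hinv : (L / η)⁻¹ = η / L := inv_div _ _
  have hϑ1 := hS.param_le_one hn hconv
  have key : ∀ x ∈ S.ballR n, P.smoothed S n d ystar η (a k) -
      4 * L * S.θP ^ 2 / (ϑ * η * (((k : ℝ) + 1) * ((k : ℝ) + 2))) ≤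
      P.lagrangian S n x (yhat ystar η w k) := by
    intro x hx
    have h1 := hS.le_estimate hM hϑ hϑ1 hsub hgLip hconv hw
      (fun k => by rw [hinv]; exact hrun.stepZ k)
      (fun k => by rw [hinv]; exact hrun.stepA k) hrun.stepW k hx
    -- The total weight of the linearizations. Dropping the nonnegative prox terms leaves A times
    -- the Lagrangian at `yhat`; the two error terms are each at most L θP² / (2 ϑ η).
    set A := ((k : ℝ) + 1) * ((k : ℝ) + 2) / 4 with hA
    have hApos : 0 < A := by positivity
    have h2 : ∑ j ∈ Finset.range (k + 1), ((j : ℝ) + 1) / 2 *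
        (P.smoothed S n d ystar η (w j) + (x - w j) ⬝ᵥ g (w j)) ≤
        A * P.lagrangian S n x (yhat ystar η w k) := by
      rw [lagrangian_yhat, Finset.mul_sum]
      refine Finset.sum_le_sum fun j _ => ?_
      have e : A * (2 * ((j : ℝ) + 1) / (((k : ℝ) + 1) * ((k : ℝ) + 2)) *
          P.lagrangian S n x (ystar η (w j))) =
          ((j : ℝ) + 1) / 2 * P.lagrangian S n x (ystar η (w j)) := by
        rw [hA]
        field_simp
        ring
      rw [e, hlin]
      refine mul_le_mul_of_nonneg_left ?_ (by positivity)
      have := mul_nonneg hη.le (hd _ (hy η hη _ (hw j)).1)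
      linarith
    have h3 : L / η / (2 * ϑ) * S.R n x ^ 2 ≤ L / η / (2 * ϑ) * S.θP ^ 2 :=
      mul_le_mul_of_nonneg_left (pow_le_pow_left₀ (apply_nonneg _ _) hx 2) (by positivity)
    have h4 : L / η / 2 * S.θP ^ 2 ≤ L / η / (2 * ϑ) * S.θP ^ 2 :=
      mul_le_mul_of_nonneg_right
        (div_le_div_of_nonneg_left hM.le (by positivity) (by linarith)) (sq_nonneg _)
    have h5 : A * (4 * L * S.θP ^ 2 / (ϑ * η * (((k : ℝ) + 1) * ((k : ℝ) + 2)))) =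
        2 * (L / η / (2 * ϑ) * S.θP ^ 2) := by
      rw [hA]
      field_simp
    have h6 : A * (P.smoothed S n d ystar η (a k) -
        4 * L * S.θP ^ 2 / (ϑ * η * (((k : ℝ) + 1) * ((k : ℝ) + 2)))) ≤
        A * P.lagrangian S n x (yhat ystar η w k) := by
      rw [mul_sub, h5]
      rw [estimate] at h1
      linarith
    exact le_of_mul_le_mul_left h6 hApos
  have := Program.le_lowerVal hθP key
  linarith

/-- The smoothing error takes 21 / 25 of ε and the optimization error 4 / 25; the factor 5 in the
iteration count provides the latter. -/
theorem Program.IsRun.upperVal_le_lowerVal_add {w z a : ℕ → Fin n → ℝ}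
    (hrun : P.IsRun S n ystar η L ϑ w z a) (hS : S.Standing) (hn : 1 ≤ n) (hθP : 0 < S.θP)
    (hθ : 0 ≤ θ) (hprox : P.IsProxFun θ d) (hy : P.IsProxMaximizer S n θ d ystar)
    (hη : 0 < η) (hL : 0 < L) (hLip : P.LipschitzGradient S n ystar L η) (hϑ : 0 < ϑ)
    (hconv : StronglyConvex (S.R n) Set.univ ϑ (fun α => S.R n α ^ 2 / 2)) {k : ℕ} {ε : ℝ}
    (hε : 0 < ε) (hit : S.EnoughIterations n d ystar L ϑ ε η k) :
    P.upperVal S n θ (a k) ≤ P.lowerVal S n (yhat ystar η w k) + ε := by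
  obtain ⟨c₀, C₀, hc, hC, hgrowth, hηle, hk⟩ := hit
  have h1 := hrun.smoothed_le hS hn hθP hprox.1 hy hη hL hLip hϑ hconv k
  have h2 := hy.upperVal_le hθ hη hc hC hgrowth (hrun.stepA k).1
  have h3 := mul_logPrimitive_le hc hC hε hη hηle
  have h4 : 4 * L * S.θP ^ 2 / (ϑ * η * (((k : ℝ) + 1) * ((k : ℝ) + 2))) ≤ 4 / 25 * ε := by
    have h5 := pow_le_pow_left₀ (by positivity) hk 2
    rw [mul_pow, Real.sq_sqrt (by positivity), mul_pow] at h5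
    have h6 : (k : ℝ) ^ 2 ≤ ((k : ℝ) + 1) * ((k : ℝ) + 2) := by
      nlinarith [(Nat.cast_nonneg k : (0 : ℝ) ≤ k)]
    have h7 := h5.trans h6
    rw [div_le_iff₀ (by positivity)]
    have h8 := mul_le_mul_of_nonneg_left h7 (show 0 ≤ 4 / 25 * ε * (ϑ * η) by positivity)
    have e : 4 / 25 * ε * (ϑ * η) * (5 ^ 2 * S.θP ^ 2 * (L / (ϑ * η * ε))) =
        4 * L * S.θP ^ 2 := by
      field_simp
      ring
    rw [e] at h8
    linarith
  linarith

end Smoothing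

/-! ### The binomial tail -/

/-- The probability that a binomial variable with parameters `N` and `ε` is less than `n`. -/
def binTail (n N : ℕ) (ε : ℝ) : ℝ :=
  ∑ i ∈ Finset.range n, (N.choose i : ℝ) * ε ^ i * (1 - ε) ^ (N - i)

theorem continuous_binTail (n N : ℕ) : Continuous (binTail n N) := by
  unfold binTail
  fun_prop

/-- The termwise derivatives telescope because (n + 1) C(N, n + 1) = (N - n) C(N, n). -/
theorem hasDerivAt_binTail {n N : ℕ} (hnN : n ≤ N) (ε : ℝ) :
    HasDerivAt (binTail n N)
      (-((n : ℝ) * (N.choose n : ℝ) * ε ^ (n - 1) * (1 - ε) ^ (N - n))) ε := by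
  induction n with
  | zero =>
    have : binTail 0 N = fun _ => 0 := by
      funext x
      simp [binTail]
    rw [this]
    simpa using hasDerivAt_const ε (0 : ℝ)
  | succ n ih =>
    have e : binTail (n + 1) N =
        fun x => binTail n N x + (N.choose n : ℝ) * x ^ n * (1 - x) ^ (N - n) := by
      funext x
      rw [binTail, Finset.sum_range_succ, ← binTail]
    rw [e]
    have h1 : HasDerivAt (fun x : ℝ => (N.choose n : ℝ) * x ^ n) ((N.choose n : ℝ) *
        ((n : ℝ) * ε ^ (n - 1))) ε := (hasDerivAt_pow n ε).const_mul _
    have h2 : HasDerivAt (fun x : ℝ => (1 - x) ^ (N - n))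
        (((N - n : ℕ) : ℝ) * (1 - ε) ^ (N - n - 1) * -1) ε :=
      ((hasDerivAt_id ε).const_sub 1).pow (N - n)
    refine ((ih (by omega)).add (h1.mul h2)).congr_deriv ?_
    have h3 : ((n + 1 : ℕ) : ℝ) * (N.choose (n + 1) : ℝ) = ((N - n : ℕ) : ℝ) * N.choose n := by
      have := Nat.choose_succ_right_eq N n
      rw [mul_comm, mul_comm ((N - n : ℕ) : ℝ)]
      exact_mod_cast this
    rw [h3, Nat.add_sub_cancel, show N - (n + 1) = N - n - 1 by omega]
    ring

theorem binTail_zero {n : ℕ} (hn : 1 ≤ n) (N : ℕ) : binTail n N 0 = 1 := by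
  obtain ⟨m, rfl⟩ : ∃ m, n = m + 1 := ⟨n - 1, by omega⟩
  rw [binTail, Finset.sum_range_succ']
  simp

theorem binTail_one {n N : ℕ} (hnN : n ≤ N) : binTail n N 1 = 0 := by
  rw [binTail]
  refine Finset.sum_eq_zero fun i hi => ?_
  rw [sub_self, zero_pow (by have := Finset.mem_range.1 hi; omega), mul_zero]

theorem binTail_of_lt {n N : ℕ} (h : N < n) (ε : ℝ) : binTail n N ε = 1 := by
  have h1 : binTail n N ε = ∑ i ∈ Finset.range (N + 1),
      (N.choose i : ℝ) * ε ^ i * (1 - ε) ^ (N - i) := by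
    rw [binTail]
    refine (Finset.sum_subset (Finset.range_mono (by omega)) fun i _ hi => ?_).symm
    rw [Nat.choose_eq_zero_of_lt (by simpa using hi)]
    simp
  have h2 := add_pow ε (1 - ε) N
  rw [add_sub_cancel, one_pow] at h2
  exact h1.trans ((Finset.sum_congr rfl fun i _ => by ring).trans h2.symm)

/-- A further trial takes the count out of {0, …, m} exactly when it stood at m and the trial
succeeds; `key` is this identity. -/
theorem binTail_succ_le {ε : ℝ} (h0 : 0 ≤ ε) (h1 : ε ≤ 1) (n N : ℕ) :
    binTail n (N + 1) ε ≤ binTail n N ε := by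
  cases n with
  | zero => simp [binTail]
  | succ n =>
    rcases lt_or_ge N (n + 1) with hN | hN
    · rw [binTail_of_lt hN]
      rcases lt_or_ge (N + 1) (n + 1) with h | h
      · rw [binTail_of_lt h]
      · have h2 := binTail_of_lt (show N + 1 < n + 2 by omega) ε
        rw [← h2, binTail, binTail, Finset.sum_range_succ _ (n + 1)]
        have : 0 ≤ 1 - ε := by linarith
        exact le_add_of_nonneg_right (by positivity)
    · have key : ∀ m ≤ N, binTail (m + 1) (N + 1) ε =
          binTail (m + 1) N ε - (N.choose m : ℝ) * ε ^ (m + 1) * (1 - ε) ^ (N - m) := by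
        intro m
        induction m with
        | zero =>
          intro _
          simp [binTail]
          ring
        | succ m ih =>
          intro hm
          have e : ∀ N' : ℕ, binTail (m + 1 + 1) N' ε = binTail (m + 1) N' ε +
              (N'.choose (m + 1) : ℝ) * ε ^ (m + 1) * (1 - ε) ^ (N' - (m + 1)) :=
            fun N' => Finset.sum_range_succ _ (m + 1)
          rw [e, e, ih (by omega), Nat.choose_succ_succ,
            show N + 1 - (m + 1) = N - m by omega, show N - m = N - (m + 1) + 1 by omega]
          push_cast
          ring
      rw [key n (by omega)]
      have : 0 ≤ 1 - ε := by linarith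
      exact sub_le_self _ (by positivity)

theorem binTail_antitone {ε : ℝ} (h0 : 0 ≤ ε) (h1 : ε ≤ 1) (n : ℕ) :
    Antitone fun N => binTail n N ε :=
  antitone_nat_of_succ_le fun N => binTail_succ_le h0 h1 n N

/-- A finite bound excludes the infimum ⊤ of the empty set, so the least N is attained; larger N
only lower the tail. -/
theorem binTail_le_of_sampleBound {n N : ℕ} {ε β : ℝ} (h0 : 0 ≤ ε) (h1 : ε ≤ 1)
    (h : sampleBound n ε β ≤ N) : binTail n N ε ≤ β := by
  set T := (fun N : ℕ => (N : ℕ∞)) '' {N | binTail n N ε ≤ β} with hT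
  have hs : sInf T ≤ N := h
  have hne : T.Nonempty := by
    by_contra hne
    rw [not_nonempty_iff_eq_empty.1 hne, sInf_empty] at hs
    exact absurd hs (by simp)
  obtain ⟨N₀, hN₀, he⟩ := csInf_mem hne
  have hs' : ((N₀ : ℕ) : ℕ∞) ≤ N := he.trans_le hs
  exact (binTail_antitone h0 h1 n (by exact_mod_cast hs')).trans hN₀

theorem integral_eq_binTail {n N : ℕ} (hnN : n ≤ N) (ε : ℝ) :
    ∫ v in ε..1, (n : ℝ) * (N.choose n : ℝ) * v ^ (n - 1) * (1 - v) ^ (N - n) =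
      binTail n N ε := by
  have h := intervalIntegral.integral_eq_sub_of_hasDerivAt (a := ε) (b := 1)
    (fun x _ => (hasDerivAt_binTail hnN x).neg)
    (Continuous.intervalIntegrable (by fun_prop) _ _)
  simp only [neg_neg, Pi.neg_apply, binTail_one hnN] at h
  rw [h]
  ring

/-! ### The moment problem on the unit interval -/

/-- A finite measure on the unit interval is determined by its moments. -/
theorem measure_ext_of_moments {ν ρ : Measure ℝ} [IsFiniteMeasure ν] [IsFiniteMeasure ρ]
    (hν : ∀ᵐ u ∂ν, u ∈ Icc (0 : ℝ) 1) (hρ : ∀ᵐ u ∂ρ, u ∈ Icc (0 : ℝ) 1)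
    (h : ∀ k : ℕ, ∫ u, u ^ k ∂ν = ∫ u, u ^ k ∂ρ) : ν = ρ := by
  have hint : ∀ (κ : Measure ℝ) [IsFiniteMeasure κ], (∀ᵐ u ∂κ, u ∈ Icc (0 : ℝ) 1) →
      ∀ f : ℝ → ℝ, Continuous f → Integrable f κ := by
    intro κ _ hκ f hf
    obtain ⟨M, hM⟩ := (isCompact_Icc (a := (0 : ℝ)) (b := 1)).exists_bound_of_continuousOn
      hf.continuousOn
    exact Integrable.of_bound hf.aestronglyMeasurable M (hκ.mono fun u hu => hM u hu)
  have hpoly : ∀ p : Polynomial ℝ, ∫ u, p.eval u ∂ν = ∫ u, p.eval u ∂ρ := by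
    intro p
    simp only [Polynomial.eval_eq_sum_range]
    rw [integral_finsetSum _ fun i _ => hint ν hν _ (by fun_prop),
      integral_finsetSum _ fun i _ => hint ρ hρ _ (by fun_prop)]
    refine Finset.sum_congr rfl fun i _ => ?_
    rw [integral_const_mul, integral_const_mul, h]
  refine ext_of_forall_integral_eq_of_IsFiniteMeasure fun f => ?_
  refine eq_of_forall_dist_le fun ε hε => ?_
  -- Weierstrass approximation carries the equality from polynomials to continuous f; the 1 avoids
  -- division by zero.
  set m := ν.real univ + ρ.real univ + 1 with hm
  have hmpos : 0 < m := by positivity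
  obtain ⟨p, hp⟩ := exists_polynomial_near_of_continuousOn 0 1 f f.continuous.continuousOn (ε / m)
    (by positivity)
  have hclose : ∀ (κ : Measure ℝ) [IsFiniteMeasure κ], (∀ᵐ u ∂κ, u ∈ Icc (0 : ℝ) 1) →
      |∫ u, p.eval u ∂κ - ∫ u, f u ∂κ| ≤ ε / m * κ.real univ := by
    intro κ _ hκ
    rw [← integral_sub (hint κ hκ _ p.continuous) (hint κ hκ _ f.continuous)]
    refine norm_integral_le_of_norm_le_const (f := fun u => p.eval u - f u)
      (hκ.mono fun u hu => (hp u hu).le)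
  have h1 := hclose ν hν
  have h2 := hclose ρ hρ
  rw [hpoly p] at h1
  rw [Real.dist_eq]
  have h3 : ε / m * ν.real univ + ε / m * ρ.real univ ≤ ε := by
    rw [← mul_add, div_mul_eq_mul_div, div_le_iff₀ hmpos]
    exact mul_le_mul_of_nonneg_left (by linarith) hε.le
  rw [abs_le] at *
  constructor <;> linarith

/-- The law on the unit interval whose moments are the inverse binomial coefficients. -/
theorem integral_eq_binTail_of_moments {ν : Measure ℝ} [IsFiniteMeasure ν]
    (hν : ∀ᵐ u ∂ν, u ∈ Icc (0 : ℝ) 1) {n : ℕ} (hn : 1 ≤ n)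
    (h : ∀ k : ℕ, ((n + k).choose n : ℝ) * ∫ u, u ^ k ∂ν = 1) {N : ℕ} (hnN : n ≤ N) {ε : ℝ}
    (hε : 0 ≤ ε) (hε1 : ε ≤ 1) :
    (N.choose n : ℝ) * ∫ u in Iio (1 - ε), u ^ (N - n) ∂ν = binTail n N ε := by
  -- The Beta(1, n) density; `hsub` at ε = 0 yields its moments 1 / C(n + k, n).
  set f : ℝ → ℝ := fun u => (n : ℝ) * (1 - u) ^ (n - 1) with hf
  have hfc : Continuous f := by fun_prop
  set ρ : Measure ℝ := (volume.restrict (Icc 0 1)).withDensity fun u => ENNReal.ofReal (f u)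
    with hρdef
  have hf0 : ∀ᵐ u ∂(volume.restrict (Icc (0 : ℝ) 1)), 0 ≤ f u :=
    (ae_restrict_iff' measurableSet_Icc).2 (Filter.Eventually.of_forall fun u hu =>
      mul_nonneg (Nat.cast_nonneg _) (pow_nonneg (by linarith [hu.2]) _))
  have hfi : Integrable f (volume.restrict (Icc 0 1)) := hfc.integrableOn_Icc
  have hρfin : IsFiniteMeasure ρ := isFiniteMeasure_withDensity_ofReal hfi.2
  have hρ : ∀ᵐ u ∂ρ, u ∈ Icc (0 : ℝ) 1 :=
    (withDensity_absolutelyContinuous _ _).ae_le (ae_restrict_mem measurableSet_Icc)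
  have hset : ∀ (b : ℝ) (k : ℕ), 0 ≤ b → b ≤ 1 → ∫ u in Iio b, u ^ k ∂ρ =
      ∫ u in (0 : ℝ)..b, f u * u ^ k := by
    intro b k hb hb1
    rw [hρdef, restrict_withDensity measurableSet_Iio,
      integral_withDensity_eq_integral_toReal_smul (by fun_prop) (by simp)]
    rw [Measure.restrict_restrict measurableSet_Iio]
    have e : Iio b ∩ Icc 0 1 = Ico 0 b := by
      ext u
      simp only [mem_inter_iff, mem_Iio, mem_Icc, mem_Ico]
      constructor
      · rintro ⟨h1, h2, h3⟩; exact ⟨h2, h1⟩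
      · rintro ⟨h1, h2⟩; exact ⟨h2, h1, by linarith⟩
    rw [e, intervalIntegral.integral_of_le hb, integral_Ico_eq_integral_Ioo,
      integral_Ioc_eq_integral_Ioo]
    refine setIntegral_congr_fun measurableSet_Ioo fun u hu => ?_
    have : 0 ≤ f u := mul_nonneg (Nat.cast_nonneg _) (pow_nonneg (by linarith [hu.2]) _)
    simp only [smul_eq_mul, ENNReal.toReal_ofReal this]
  have hsub : ∀ (N : ℕ) (ε : ℝ), n ≤ N → (N.choose n : ℝ) * ∫ u in (0 : ℝ)..(1 - ε),
      f u * u ^ (N - n) = binTail n N ε := by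
    intro N ε hN
    rw [← integral_eq_binTail hN ε, ← intervalIntegral.integral_const_mul]
    have := intervalIntegral.integral_comp_sub_left (a := ε) (b := 1)
      (fun u => (N.choose n : ℝ) * (f u * u ^ (N - n))) 1
    rw [sub_self] at this
    rw [← this]
    refine intervalIntegral.integral_congr fun v _ => ?_
    simp only [hf]
    ring
  have hfull : ∀ k : ℕ, ∫ u, u ^ k ∂ρ = ∫ u in (0 : ℝ)..1, f u * u ^ k := by
    intro k
    rw [← hset 1 k zero_le_one le_rfl, ← setIntegral_univ (μ := ρ)]
    have h1 : ρ {1} = 0 := by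
      refine (withDensity_absolutelyContinuous _ _) ?_
      exact le_antisymm ((Measure.restrict_apply_le _ _).trans_eq Real.volume_singleton) zero_le
    refine setIntegral_congr_set (f := fun u : ℝ => u ^ k) ?_
    rw [Filter.eventuallyEq_set]
    filter_upwards [hρ, compl_mem_ae_iff.2 h1] with u hu hu1
    simp only [mem_Iio, mem_univ, true_iff]
    exact lt_of_le_of_ne hu.2 hu1
  have hνρ : ν = ρ := by
    refine measure_ext_of_moments hν hρ fun k => ?_
    have h1 := h k
    have h2 := hsub (n + k) 0 (by omega)
    rw [binTail_zero hn, sub_zero, Nat.add_sub_cancel_left, ← hfull] at h2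
    have h3 : (((n + k).choose n : ℕ) : ℝ) ≠ 0 := by
      exact_mod_cast (Nat.choose_pos (by omega)).ne'
    exact mul_left_cancel₀ h3 (h1.trans h2.symm)
  rw [hνρ, hset (1 - ε) (N - n) (by linarith) (by linarith), hsub N ε hnN]

/-! ### Strictly convex programs with finitely many half-space constraints -/

/-- `α` minimizes `f` over `F`. -/
def IsMinimizer {E : Type*} (f : E → ℝ) (F : Set E) (α : E) : Prop :=
  α ∈ F ∧ ∀ α' ∈ F, f α ≤ f α'

open Classical in
/-- A minimizer of `f` over `F`, if there is one. -/
def argmin {E : Type*} [Zero E] (f : E → ℝ) (F : Set E) : E :=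
  if h : ∃ α, IsMinimizer f F α then h.choose else 0

theorem isMinimizer_argmin {E : Type*} [Zero E] {f : E → ℝ} {F : Set E}
    (h : ∃ α, IsMinimizer f F α) : IsMinimizer f F (argmin f F) := by
  rw [argmin, dif_pos h]
  exact h.choose_spec

/-- The data of a random convex program: a compact convex domain, a strictly convex objective
function, a random half-space `{α : t ω ≤ α ⬝ᵥ s ω}`, and a random label. -/
structure RandomProgram (Ω : Type*) (n : ℕ) where
  /-- the domain -/
  K : Set (Fin n → ℝ)
  /-- the objective function -/
  f : (Fin n → ℝ) → ℝ
  /-- the normal vector of the half-space -/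
  s : Ω → Fin n → ℝ
  /-- the offset of the half-space -/
  t : Ω → ℝ
  /-- the label -/
  label : Ω → ℝ

namespace RandomProgram

variable {Ω : Type*} {n : ℕ} (R : RandomProgram Ω n)

/-- The standing assumptions on a random program. -/
structure Standing : Prop where
  compact : IsCompact R.K
  convex : Convex ℝ R.K
  continuous : Continuous R.f
  strictConvex : StrictConvexOn ℝ univ R.f
  feasible : ∃ α ∈ R.K, ∀ ω, R.t ω ≤ α ⬝ᵥ R.s ω

variable {ι : Type*}

/-- The feasible set for the constraints `x j`, `j ∈ Q`. -/
def feasSet (x : ι → Ω) (Q : Finset ι) : Set (Fin n → ℝ) :=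
  {α | α ∈ R.K ∧ ∀ j ∈ Q, R.t (x j) ≤ α ⬝ᵥ R.s (x j)}

/-- The optimizer for the constraints `x j`, `j ∈ Q`. -/
def sol (x : ι → Ω) (Q : Finset ι) : Fin n → ℝ := argmin R.f (R.feasSet x Q)

/-- The constraint `ω` is compatible with `Q`: it is satisfied by the optimizer, and its label is
not smaller than that of an inactive constraint in `Q`. -/
def Compatible (x : ι → Ω) (Q : Finset ι) (ω : Ω) : Prop :=
  R.t ω ≤ R.sol x Q ⬝ᵥ R.s ω ∧
    ∀ i ∈ Q, R.t (x i) < R.sol x Q ⬝ᵥ R.s (x i) → R.label (x i) ≤ R.label ω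

/-- General position of the constraints `x`. -/
structure Nondegenerate (x : ι → Ω) : Prop where
  inactive : ∀ (Q : Finset ι) (j : ι), j ∉ Q → R.sol x Q ⬝ᵥ R.s (x j) ≠ R.t (x j)
  labels : ∀ i j, i ≠ j → R.label (x i) ≠ R.label (x j)

variable {R}

theorem feasSet_anti {x : ι → Ω} {Q Q' : Finset ι} (h : Q ⊆ Q') :
    R.feasSet x Q' ⊆ R.feasSet x Q :=
  fun _ hα => ⟨hα.1, fun j hj => hα.2 j (h hj)⟩

namespace Standing

variable (hR : R.Standing)
include hR

theorem isMinimizer_sol (x : ι → Ω) (Q : Finset ι) :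
    IsMinimizer R.f (R.feasSet x Q) (R.sol x Q) := by
  refine isMinimizer_argmin ?_
  obtain ⟨α₀, hα₀, h⟩ := hR.feasible
  have hclosed : IsClosed {α : Fin n → ℝ | ∀ j ∈ Q, R.t (x j) ≤ α ⬝ᵥ R.s (x j)} := by
    simp only [ofPred_forall]
    exact isClosed_iInter fun j => isClosed_iInter fun _ =>
      isClosed_le continuous_const (continuous_dot _)
  obtain ⟨α, hα, hmin⟩ := (hR.compact.inter_right hclosed).exists_isMinOn
    ⟨α₀, hα₀, fun j _ => h (x j)⟩ hR.continuous.continuousOn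
  exact ⟨α, hα, fun α' hα' => hmin hα'⟩

theorem convex_feasSet (x : ι → Ω) (Q : Finset ι) : Convex ℝ (R.feasSet x Q) := by
  intro u hu v hv a b ha hb hab
  refine ⟨hR.convex hu.1 hv.1 ha hb hab, fun j hj => ?_⟩
  rw [add_dotProduct, smul_dotProduct, smul_dotProduct, smul_eq_mul, smul_eq_mul]
  have h1 := mul_le_mul_of_nonneg_left (hu.2 j hj) ha
  have h2 := mul_le_mul_of_nonneg_left (hv.2 j hj) hb
  have h3 : R.t (x j) = a * R.t (x j) + b * R.t (x j) := by rw [← add_mul, hab, one_mul]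
  linarith

theorem eq_sol {x : ι → Ω} {Q : Finset ι} {α : Fin n → ℝ}
    (hα : IsMinimizer R.f (R.feasSet x Q) α) : α = R.sol x Q :=
  (hR.strictConvex.subset (subset_univ _) (hR.convex_feasSet x Q)).eq_of_isMinOn
    (fun _ h => hα.2 _ h) (fun _ h => (hR.isMinimizer_sol x Q).2 _ h)
    hα.1 (hR.isMinimizer_sol x Q).1

theorem sol_mem (x : ι → Ω) (Q : Finset ι) : R.sol x Q ∈ R.K := (hR.isMinimizer_sol x Q).1.1

theorem sol_eq_of_subset {x : ι → Ω} {Q Q' : Finset ι} (h : Q ⊆ Q')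
    (hmem : R.sol x Q ∈ R.feasSet x Q') : R.sol x Q = R.sol x Q' :=
  hR.eq_sol ⟨hmem, fun α hα => (hR.isMinimizer_sol x Q).2 α (feasSet_anti h hα)⟩

theorem sol_eq_of_subset_of_subset {x : ι → Ω} {Q Q' Q'' : Finset ι} (h : Q ⊆ Q') (h' : Q' ⊆ Q'')
    (heq : R.sol x Q = R.sol x Q'') : R.sol x Q' = R.sol x Q'' := by
  rw [← heq]
  refine (hR.sol_eq_of_subset h ?_).symm
  rw [heq]
  exact feasSet_anti h' (hR.isMinimizer_sol x Q'').1

/-- Inactive constraints may be dropped. -/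
theorem sol_eq_of_inactive {x : ι → Ω} {Q Q' : Finset ι} (h : Q ⊆ Q')
    (hin : ∀ j ∈ Q', j ∉ Q → R.t (x j) < R.sol x Q' ⬝ᵥ R.s (x j)) :
    R.sol x Q = R.sol x Q' := by
  set α := R.sol x Q' with hα
  set β := R.sol x Q with hβ
  have hαmem := (hR.isMinimizer_sol x Q').1
  have hβmem := (hR.isMinimizer_sol x Q).1
  refine (hR.eq_sol ⟨feasSet_anti h hαmem, fun γ hγ => ?_⟩).symm
  refine le_trans ?_ ((hR.isMinimizer_sol x Q).2 γ hγ)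
  by_contra! hlt
  have hne : α ≠ β := fun e => by
    rw [← hβ, ← hα, e] at hlt
    exact lt_irrefl _ hlt
  -- If β were strictly better, a small step from α towards β would keep the inactive constraints,
  -- satisfy those in Q by convexity, and lower the objective.
  have hev : ∀ᶠ θ : ℝ in nhdsWithin 0 (Ioi 0), ∀ j ∈ Q', j ∉ Q →
      R.t (x j) < ((1 - θ) • α + θ • β) ⬝ᵥ R.s (x j) := by
    rw [Filter.eventually_all_finset]
    intro j hj
    by_cases hjQ : j ∈ Q
    · exact Filter.Eventually.of_forall fun _ h => absurd hjQ h
    · have hc : Continuous fun θ : ℝ => ((1 - θ) • α + θ • β) ⬝ᵥ R.s (x j) :=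
        (continuous_dot _).comp (by fun_prop)
      have := (hc.tendsto 0).eventually_const_lt (u := R.t (x j)) (by simpa using hin j hj hjQ)
      exact (this.filter_mono nhdsWithin_le_nhds).mono fun _ h _ => h
  have hev1 : ∀ᶠ θ : ℝ in nhdsWithin 0 (Ioi 0), θ ∈ Ioo (0 : ℝ) 1 :=
    Ioo_mem_nhdsGT zero_lt_one
  obtain ⟨θ, hθ, hθ01⟩ := (hev.and hev1).exists
  have hmem : (1 - θ) • α + θ • β ∈ R.feasSet x Q' := by
    refine ⟨hR.convex hαmem.1 hβmem.1 (by linarith [hθ01.2]) hθ01.1.le (by ring), fun j hj => ?_⟩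
    by_cases hjQ : j ∈ Q
    · exact (hR.convex_feasSet x Q (feasSet_anti h hαmem) hβmem (by linarith [hθ01.2]) hθ01.1.le
        (by ring)).2 j hjQ
    · exact (hθ j hj hjQ).le
  have h1 := (hR.isMinimizer_sol x Q').2 _ hmem
  have h2 := hR.strictConvex.2 (mem_univ α) (mem_univ β) hne
    (show 0 < 1 - θ by linarith [hθ01.2]) hθ01.1 (by ring)
  simp only [smul_eq_mul] at h2
  have h3 := mul_lt_mul_of_pos_left hlt hθ01.1
  rw [← hα] at h1
  rw [← hα, ← hβ] at h3
  linarith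

/-- At most `n` constraints determine the optimizer. -/
theorem exists_basis [DecidableEq ι] (x : ι → Ω) (Q : Finset ι) :
    ∃ Q' ⊆ Q, Q'.card ≤ n ∧ R.sol x Q' = R.sol x Q := by
  classical
  obtain ⟨α₀, hα₀, h0⟩ := hR.feasible
  set v := R.f (R.sol x Q) with hv
  -- Helly's theorem is applied to the half-spaces together with the set of strictly better points;
  -- they have no common point.
  let F : Option ι → Set (Fin n → ℝ) := fun o =>
    o.elim {α | α ∈ R.K ∧ R.f α < v} fun j => {α | R.t (x j) ≤ α ⬝ᵥ R.s (x j)}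
  have hFconv : ∀ o ∈ Finset.insertNone Q, Convex ℝ (F o) := by
    rintro (_ | j) _
    · exact (hR.strictConvex.convexOn.subset (subset_univ _) hR.convex).convex_lt v
    · intro u hu w hw a b ha hb hab
      simp only [F, Option.elim_some, mem_ofPred_eq] at hu hw ⊢
      rw [add_dotProduct, smul_dotProduct, smul_dotProduct, smul_eq_mul, smul_eq_mul]
      have h3 : R.t (x j) = a * R.t (x j) + b * R.t (x j) := by rw [← add_mul, hab, one_mul]
      have h1 := mul_le_mul_of_nonneg_left hu ha
      have h2 := mul_le_mul_of_nonneg_left hw hb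
      linarith
  have hempty : ¬ (⋂ o ∈ Finset.insertNone Q, F o).Nonempty := by
    rintro ⟨α, hα⟩
    simp only [mem_iInter] at hα
    have h1 : α ∈ R.K ∧ R.f α < v := hα none (by simp)
    have h2 : α ∈ R.feasSet x Q := ⟨h1.1, fun j hj => hα (some j) (by simpa using hj)⟩
    exact absurd ((hR.isMinimizer_sol x Q).2 α h2) (not_le.2 h1.2)
  have hhelly := mt (Convex.helly_theorem' hFconv) hempty
  push Not at hhelly
  obtain ⟨I, hIQ, hIcard, hI⟩ := hhelly
  -- The half-spaces all contain α₀, so the set of better points belongs to the subfamily of at most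
  -- n + 1 sets and leaves at most n half-spaces.
  have hnone : none ∈ I := by
    by_contra hnone
    have : α₀ ∈ ⋂ o ∈ I, F o := by
      simp only [mem_iInter]
      rintro (_ | j) hj
      · exact absurd hj hnone
      · exact h0 (x j)
    rw [hI] at this
    exact this
  refine ⟨Finset.eraseNone I, fun j hj => ?_, ?_, ?_⟩
  · have := hIQ (Finset.mem_eraseNone.1 hj)
    simpa using this
  · have h1 : (Finset.eraseNone I).card + 1 ≤ I.card := by
      have h2 : ((Finset.eraseNone I).map Function.Embedding.some).card < I.card := by
        refine Finset.card_lt_card ?_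
        rw [Finset.map_some_eraseNone]
        exact Finset.erase_ssubset hnone
      rwa [Finset.card_map] at h2
    rw [Module.finrank_fin_fun] at hIcard
    omega
  · refine (hR.eq_sol ⟨?_, fun α hα => ?_⟩).symm
    · refine feasSet_anti (fun j hj => ?_) (hR.isMinimizer_sol x Q).1
      simpa using hIQ (Finset.mem_eraseNone.1 hj)
    · by_contra! hlt
      have : α ∈ ⋂ o ∈ I, F o := by
        simp only [mem_iInter]
        rintro (_ | j) hj
        · exact ⟨hα.1, hlt⟩
        · exact hα.2 j (Finset.mem_eraseNone.2 hj)
      rw [hI] at this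
      exact this

end Standing

/-- Greedy choice of the lowest remaining label. It completes the active constraints to exactly n.
-/
theorem exists_lowest_superset [Fintype ι] [DecidableEq ι] (ℓ : ι → ℝ) (A : Finset ι) (k : ℕ)
    (hk : A.card + k ≤ Fintype.card ι) :
    ∃ I, A ⊆ I ∧ I.card = A.card + k ∧ ∀ i ∈ I, i ∉ A → ∀ j, j ∉ I → ℓ i ≤ ℓ j := by
  induction k with
  | zero => exact ⟨A, subset_rfl, rfl, fun i hi hi' => absurd hi hi'⟩
  | succ k ih =>
    obtain ⟨I, hAI, hcard, hI⟩ := ih (by omega)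
    have hne : Iᶜ.Nonempty := by
      rw [← Finset.card_pos, Finset.card_compl]
      omega
    obtain ⟨i₀, hi₀, hmin⟩ := Finset.exists_min_image Iᶜ ℓ hne
    rw [Finset.mem_compl] at hi₀
    refine ⟨insert i₀ I, hAI.trans (Finset.subset_insert _ _), ?_, fun i hi hiA j hj => ?_⟩
    · rw [Finset.card_insert_of_notMem hi₀, hcard, add_assoc]
    · rw [Finset.mem_insert, not_or] at hj
      rcases Finset.mem_insert.1 hi with rfl | hi
      · exact hmin j (Finset.mem_compl.2 hj.2)
      · exact hI i hi hiA j hj.2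

/-- If every constraint outside `I` is compatible with `I`, then `I` determines the optimizer. -/
theorem Standing.sol_eq_of_compatible (hR : R.Standing) [Fintype ι] {x : ι → Ω} {I : Finset ι}
    (hI : ∀ j, j ∉ I → R.Compatible x I (x j)) : R.sol x I = R.sol x Finset.univ := by
  refine hR.sol_eq_of_subset (Finset.subset_univ I) ⟨hR.sol_mem x I, fun j _ => ?_⟩
  by_cases hj : j ∈ I
  · exact (hR.isMinimizer_sol x I).1.2 j hj
  · exact (hI j hj).1

/-- In general position there is exactly one set of `n` constraints with which all the others are
compatible. -/
theorem Nondegenerate.existsUnique_compatible [Fintype ι] [DecidableEq ι] (hR : R.Standing)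
    {x : ι → Ω} (hx : R.Nondegenerate x) (hn : n ≤ Fintype.card ι) :
    ∃! I : Finset ι, I.card = n ∧ ∀ j, j ∉ I → R.Compatible x I (x j) := by
  classical
  set α := R.sol x Finset.univ with hα
  have hαfeas := (hR.isMinimizer_sol x Finset.univ).1
  -- The active constraints: in general position they lie in every subset that determines the
  -- optimizer, hence number at most n, and they determine it themselves.
  set A : Finset ι := Finset.univ.filter fun j => α ⬝ᵥ R.s (x j) = R.t (x j) with hA
  have hAsub : ∀ Q : Finset ι, R.sol x Q = α → A ⊆ Q := by
    intro Q hQ j hj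
    by_contra hjQ
    refine hx.inactive Q j hjQ ?_
    rw [hQ]
    exact (Finset.mem_filter.1 hj).2
  obtain ⟨Q, -, hQcard, hQ⟩ := hR.exists_basis x Finset.univ
  have hAcard : A.card ≤ n := (Finset.card_le_card (hAsub Q hQ)).trans hQcard
  have hAsol : R.sol x A = α := by
    refine hR.sol_eq_of_inactive (Finset.subset_univ A) fun j _ hj => ?_
    refine lt_of_le_of_ne (hαfeas.2 j (Finset.mem_univ j)) fun h => hj ?_
    exact Finset.mem_filter.2 ⟨Finset.mem_univ j, h.symm⟩
  obtain ⟨I, hAI, hIcard, hI⟩ := exists_lowest_superset (fun j => R.label (x j)) A (n - A.card)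
    (by omega)
  have hIsol : R.sol x I = α := hR.sol_eq_of_subset_of_subset hAI (Finset.subset_univ I) hAsol
  refine ⟨I, ⟨by omega, fun j hj => ⟨?_, fun i hi hlt => hI i hi (fun hiA => ?_) j hj⟩⟩, ?_⟩
  · rw [hIsol]
    exact hαfeas.2 j (Finset.mem_univ j)
  · rw [hIsol, (Finset.mem_filter.1 hiA).2] at hlt
    exact lt_irrefl _ hlt
  · rintro I' ⟨hI'card, hI'⟩
    have hI'sol : R.sol x I' = α := hR.sol_eq_of_compatible hI'
    by_contra hne
    have hcard : I'.card = I.card := by omega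
    have h1 : ¬ I' ⊆ I := fun h => hne (Finset.eq_of_subset_of_card_le h hcard.ge)
    have h2 : ¬ I ⊆ I' := fun h => hne (Finset.eq_of_subset_of_card_le h hcard.le).symm
    -- Both sets contain A, so i and i' are inactive. Compatibility of I' and the choice of I
    -- compare their labels in opposite directions, forcing equality.
    obtain ⟨i', hi', hi'I⟩ := Finset.not_subset.1 h1
    obtain ⟨i, hi, hiI'⟩ := Finset.not_subset.1 h2
    have hinact : ∀ Q : Finset ι, R.sol x Q = α → ∀ k, k ∉ Q →
        R.t (x k) < α ⬝ᵥ R.s (x k) := by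
      intro Q hQ k hk
      refine lt_of_le_of_ne (hαfeas.2 k (Finset.mem_univ k)) fun h => hx.inactive Q k hk ?_
      rw [hQ, h]
    have e1 := (hI' i hiI').2 i' hi' (by rw [hI'sol]; exact hinact I hIsol i' hi'I)
    have e2 := hI i hi (fun hiA => hiI' (hAsub I' hI'sol hiA)) i' hi'I
    exact hx.labels i i' (fun h => hiI' (h ▸ hi')) (le_antisymm e2 e1)

end RandomProgram

/-! ### Product measures -/

section Pi

variable {Ω ι : Type*} [MeasurableSpace Ω] [Fintype ι] {μ : Measure Ω} [IsProbabilityMeasure μ]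

/-- Fubini in the single coordinate j: every section is null. -/
theorem pi_eq_zero_of_update [DecidableEq ι] {A : Set (ι → Ω)} (hA : MeasurableSet A) (j : ι)
    (h : ∀ x : ι → Ω, μ {ω | Function.update x j ω ∈ A} = 0) :
    Measure.pi (fun _ : ι => μ) A = 0 := by
  have hne : Nonempty Ω := by
    by_contra hne
    rw [not_nonempty_iff] at hne
    have h1 : μ univ = 1 := measure_univ
    rw [univ_eq_empty_iff.2 hne, measure_empty] at h1
    exact zero_ne_one h1
  have x₀ : ι → Ω := fun _ => hne.some
  rw [← lintegral_indicator_one hA, lintegral_eq_lmarginal_univ x₀,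
    lmarginal_erase' _ (measurable_one.indicator hA) (Finset.mem_univ j)]
  have : (fun x : ι → Ω => ∫⁻ ω, A.indicator 1 (Function.update x j ω) ∂μ) = fun _ => 0 := by
    funext x
    have e : (fun ω => A.indicator (1 : (ι → Ω) → ENNReal) (Function.update x j ω)) =
        {ω | Function.update x j ω ∈ A}.indicator 1 := by
      funext ω
      simp [indicator]
    rw [e, lintegral_indicator_one (s := {ω | Function.update x j ω ∈ A})
      (measurable_update x hA), h]
  rw [this]
  simp [lmarginal]

theorem measurePreserving_split {m : ℕ} {p : ι → Prop} [DecidablePred p]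
    (e : Fin m ≃ {j // p j}) :
    MeasurePreserving (fun x : ι → Ω => ((fun i => x (e i) : Fin m → Ω),
        (fun j => x j : {j // ¬ p j} → Ω)))
      (Measure.pi fun _ => μ) ((Measure.pi fun _ => μ).prod (Measure.pi fun _ => μ)) := by
  have h1 := measurePreserving_piEquivPiSubtypeProd (fun _ : ι => μ) p
  have h2 := (measurePreserving_piCongrLeft (fun _ : {j // p j} => μ) e).symm
  exact (h2.prod (MeasurePreserving.id (Measure.pi fun _ : {j // ¬ p j} => μ))).comp h1

/-- Given the coordinates in p, the others are independent and each must fall into the same section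
of W; hence the power. -/
theorem pi_split_eq {m : ℕ} {p : ι → Prop} [DecidablePred p] (e : Fin m ≃ {j // p j})
    {D : Set (Fin m → Ω)} (hD : MeasurableSet D) {W : Set ((Fin m → Ω) × Ω)}
    (hW : MeasurableSet W) :
    Measure.pi (fun _ : ι => μ)
        {x | (fun i => x (e i)) ∈ D ∧ ∀ j, ¬ p j → ((fun i => x (e i)), x j) ∈ W} =
      ∫⁻ y in D, μ {ω | (y, ω) ∈ W} ^ (Fintype.card ι - m) ∂(Measure.pi fun _ => μ) := by
  set T : Set ((Fin m → Ω) × ({j // ¬ p j} → Ω)) :=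
    {q | q.1 ∈ D ∧ ∀ j, (q.1, q.2 j) ∈ W} with hT
  have hTm : MeasurableSet T := by
    rw [hT, ofPred_and, ofPred_forall]
    exact (measurable_fst hD).inter (MeasurableSet.iInter fun j =>
      (measurable_fst.prodMk ((measurable_pi_apply j).comp measurable_snd)) hW)
  have h1 := (measurePreserving_split (μ := μ) e).measure_preimage hTm.nullMeasurableSet
  have e1 : (fun x : ι → Ω => ((fun i => x (e i) : Fin m → Ω),
      (fun j => x j : {j // ¬ p j} → Ω))) ⁻¹' T =
      {x | (fun i => x (e i)) ∈ D ∧ ∀ j, ¬ p j → ((fun i => x (e i)), x j) ∈ W} := by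
    ext x
    simp [hT]
  rw [← e1, h1, Measure.prod_apply hTm, ← lintegral_indicator hD]
  refine lintegral_congr fun y => ?_
  by_cases hy : y ∈ D
  · rw [indicator_of_mem hy]
    have e2 : Prod.mk y ⁻¹' T = univ.pi fun _ : {j // ¬ p j} => {ω | (y, ω) ∈ W} := by
      ext z
      simp [hT, hy]
    rw [e2, Measure.pi_pi, Finset.prod_const, Finset.card_univ]
    congr 1
    rw [Fintype.card_subtype_compl, ← Fintype.card_congr e, Fintype.card_fin]
  · rw [indicator_of_notMem hy]
    have e2 : Prod.mk y ⁻¹' T = ∅ := by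
      ext z
      simp [hT, hy]
    rw [e2, measure_empty]

end Pi

/-! ### Measurability and general position of random programs. -/

namespace RandomProgram

variable {Ω ι : Type*} {n : ℕ} {R : RandomProgram Ω n}

theorem feasSet_congr {κ : Type*} {x : ι → Ω} {y : κ → Ω} {Q : Finset ι} {Q' : Finset κ}
    (h : x '' (Q : Set ι) = y '' (Q' : Set κ)) : R.feasSet x Q = R.feasSet y Q' := by
  have key : ∀ α : Fin n → ℝ, (∀ j ∈ Q, R.t (x j) ≤ α ⬝ᵥ R.s (x j)) ↔
      ∀ ω ∈ x '' (Q : Set ι), R.t ω ≤ α ⬝ᵥ R.s ω := fun α => by simp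
  have key' : ∀ α : Fin n → ℝ, (∀ j ∈ Q', R.t (y j) ≤ α ⬝ᵥ R.s (y j)) ↔
      ∀ ω ∈ y '' (Q' : Set κ), R.t ω ≤ α ⬝ᵥ R.s ω := fun α => by simp
  ext α
  simp only [feasSet, mem_ofPred_eq, key, key', h]

/-- Only the set of constraints matters, not its indexing, so an n-subset can be replaced by a
family over `Fin n`. -/
theorem compatible_congr {κ : Type*} {x : ι → Ω} {y : κ → Ω} {Q : Finset ι} {Q' : Finset κ}
    (h : x '' (Q : Set ι) = y '' (Q' : Set κ)) (ω : Ω) :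
    R.Compatible x Q ω ↔ R.Compatible y Q' ω := by
  have hsol : R.sol x Q = R.sol y Q' := by rw [sol, sol, feasSet_congr h]
  have key : (∀ i ∈ Q, R.t (x i) < R.sol x Q ⬝ᵥ R.s (x i) → R.label (x i) ≤ R.label ω) ↔
      ∀ ω' ∈ x '' (Q : Set ι), R.t ω' < R.sol x Q ⬝ᵥ R.s ω' → R.label ω' ≤ R.label ω := by simp
  have key' : (∀ i ∈ Q', R.t (y i) < R.sol y Q' ⬝ᵥ R.s (y i) → R.label (y i) ≤ R.label ω) ↔
      ∀ ω' ∈ y '' (Q' : Set κ), R.t ω' < R.sol y Q' ⬝ᵥ R.s ω' → R.label ω' ≤ R.label ω := by simp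
  rw [Compatible, Compatible, key, key', h, hsol]

variable [MeasurableSpace Ω]

variable (R) in
/-- Measurability of the random data. -/
structure IsMeasurable : Prop where
  s : Measurable R.s
  t : Measurable R.t
  label : Measurable R.label

/-- The optimizer lies in a closed F iff every rational level reached by a feasible point is reached
by one in F. Reachability is closed in the constraint data, being a projection along a compact set.
-/
theorem Standing.measurable_sol (hR : R.Standing) (hm : R.IsMeasurable) [Finite ι]
    (Q : Finset ι) : Measurable fun x : ι → Ω => R.sol x Q := by
  set S : Set (Fin n → ℝ) → ℝ → Set (ι → (Fin n → ℝ) × ℝ) := fun F r =>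
    {p | ∃ α, α ∈ R.K ∩ F ∧ R.f α ≤ r ∧ ∀ j ∈ Q, (p j).2 ≤ α ⬝ᵥ (p j).1} with hS
  have hSclosed : ∀ F r, IsClosed F → IsClosed (S F r) := by
    intro F r hF
    have hcomp : CompactSpace ↥(R.K ∩ F) :=
      isCompact_iff_compactSpace.1 (hR.compact.inter_right hF)
    have hc : IsClosed {q : ↥(R.K ∩ F) × (ι → (Fin n → ℝ) × ℝ) |
        R.f q.1 ≤ r ∧ ∀ j ∈ Q, (q.2 j).2 ≤ (q.1 : Fin n → ℝ) ⬝ᵥ (q.2 j).1} := by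
      have hf := hR.continuous
      simp only [ofPred_and, ofPred_forall]
      refine (isClosed_le (by fun_prop) continuous_const).inter ?_
      refine isClosed_iInter fun j => isClosed_iInter fun _ => isClosed_le (by fun_prop) ?_
      exact continuous_finsetSum _ fun i _ =>
        ((continuous_apply i).comp (continuous_subtype_val.comp continuous_fst)).mul
          ((continuous_apply i).comp (continuous_fst.comp ((continuous_apply j).comp
            continuous_snd)))
    convert isClosedMap_snd_of_compactSpace _ hc using 1
    ext p
    constructor
    · rintro ⟨α, hα, h1, h2⟩
      exact ⟨(⟨α, hα⟩, p), ⟨h1, h2⟩, rfl⟩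
    · rintro ⟨⟨α, p'⟩, ⟨h1, h2⟩, rfl⟩
      exact ⟨α, α.2, h1, h2⟩
  set Θ : (ι → Ω) → ι → (Fin n → ℝ) × ℝ := fun x j => (R.s (x j), R.t (x j)) with hΘ
  have hΘm : Measurable Θ := measurable_pi_lambda _ fun j =>
    (hm.s.comp (measurable_pi_apply j)).prodMk (hm.t.comp (measurable_pi_apply j))
  refine measurable_of_isClosed fun F hF => ?_
  have e : (fun x : ι → Ω => R.sol x Q) ⁻¹' F =
      ⋂ r : ℚ, (Θ ⁻¹' S univ r)ᶜ ∪ Θ ⁻¹' S F r := by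
    ext x
    have hsol := hR.isMinimizer_sol x Q
    simp only [mem_preimage, mem_iInter, mem_union, mem_compl_iff, ← imp_iff_not_or]
    constructor
    · rintro hx r ⟨α, hα, hαr, hαQ⟩
      exact ⟨R.sol x Q, ⟨hsol.1.1, hx⟩, (hsol.2 α ⟨hα.1, hαQ⟩).trans hαr, hsol.1.2⟩
    · intro h
      by_contra hx
      have hu : ∀ r : ℚ, R.f (R.sol x Q) < r → Θ x ∈ S univ r := fun r hr =>
        ⟨R.sol x Q, ⟨hsol.1.1, mem_univ _⟩, hr.le, hsol.1.2⟩
      have hclosed : IsClosed {α : Fin n → ℝ | ∀ j ∈ Q, R.t (x j) ≤ α ⬝ᵥ R.s (x j)} := by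
        simp only [ofPred_forall]
        exact isClosed_iInter fun j => isClosed_iInter fun _ =>
          isClosed_le continuous_const (continuous_dot _)
      obtain ⟨r₀, hr₀⟩ := exists_rat_gt (R.f (R.sol x Q))
      obtain ⟨α₁, hα₁, -, hα₁Q⟩ := h r₀ (hu r₀ hr₀)
      obtain ⟨α', hα', hmin⟩ := ((hR.compact.inter_right hF).inter_right hclosed).exists_isMinOn
        ⟨α₁, hα₁, hα₁Q⟩ hR.continuous.continuousOn
      have hlt : R.f (R.sol x Q) < R.f α' := by
        by_contra! hle
        refine hx ?_
        rw [← hR.eq_sol (α := α') ⟨⟨hα'.1.1, hα'.2⟩, fun γ hγ => hle.trans (hsol.2 γ hγ)⟩]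
        exact hα'.1.2
      obtain ⟨r, hr1, hr2⟩ := exists_rat_btwn hlt
      obtain ⟨α₂, hα₂, hα₂r, hα₂Q⟩ := h r (hu r hr1)
      have : R.f α' ≤ R.f α₂ := hmin ⟨hα₂, hα₂Q⟩
      linarith
  rw [e]
  refine MeasurableSet.iInter fun r => ?_
  exact ((hSclosed _ _ isClosed_univ).measurableSet.preimage hΘm).compl.union
    ((hSclosed _ _ hF).measurableSet.preimage hΘm)

theorem measurable_dot {α : Type*} [MeasurableSpace α] {u v : α → Fin n → ℝ} (hu : Measurable u)
    (hv : Measurable v) : Measurable fun a => u a ⬝ᵥ v a := by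
  unfold dotProduct
  fun_prop

theorem Standing.measurableSet_compatible (hR : R.Standing) (hm : R.IsMeasurable) [Finite ι]
    (Q : Finset ι) : MeasurableSet {p : (ι → Ω) × Ω | R.Compatible p.1 Q p.2} := by
  have h1 : Measurable fun p : (ι → Ω) × Ω => R.sol p.1 Q := (hR.measurable_sol hm Q).comp
    measurable_fst
  have hx : ∀ i, Measurable fun p : (ι → Ω) × Ω => p.1 i := fun i =>
    (measurable_pi_apply i).comp measurable_fst
  simp only [Compatible, ofPred_and, ofPred_forall]
  refine (measurableSet_le (hm.t.comp measurable_snd)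
    (measurable_dot h1 (hm.s.comp measurable_snd))).inter ?_
  refine MeasurableSet.iInter fun i => MeasurableSet.iInter fun _ => ?_
  simp only [imp_iff_not_or, ofPred_or]
  exact (measurableSet_lt (hm.t.comp (hx i)) (measurable_dot h1 (hm.s.comp (hx i)))).compl.union
    (measurableSet_le (hm.label.comp (hx i)) (hm.label.comp measurable_snd))

variable {μ : Measure Ω} [IsProbabilityMeasure μ]

/-- The optimizer for Q ignores the coordinate j ∉ Q, so resampling that coordinate would have to
hit a fixed equality, a null event. Labels are treated alike. -/
theorem Standing.ae_nondegenerate (hR : R.Standing) (hm : R.IsMeasurable) [Fintype ι]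
    (hnd : ∀ α : Fin n → ℝ, μ {ω | α ⬝ᵥ R.s ω = R.t ω} = 0)
    (hlab : ∀ r, μ {ω | R.label ω = r} = 0) :
    ∀ᵐ x ∂(Measure.pi fun _ : ι => μ), R.Nondegenerate x := by
  classical
  have h1 : ∀ᵐ x ∂(Measure.pi fun _ : ι => μ), ∀ (Q : Finset ι) (j : ι), j ∉ Q →
      R.sol x Q ⬝ᵥ R.s (x j) ≠ R.t (x j) := by
    rw [ae_all_iff]
    intro Q
    rw [ae_all_iff]
    intro j
    by_cases hj : j ∈ Q
    · exact Filter.Eventually.of_forall fun _ h => absurd hj h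
    · rw [ae_iff]
      simp only [hj, not_false_eq_true, forall_const, ne_eq, not_not]
      refine pi_eq_zero_of_update (measurableSet_eq_fun
        (measurable_dot (hR.measurable_sol hm Q) (hm.s.comp (measurable_pi_apply j)))
        (hm.t.comp (measurable_pi_apply j))) j fun x => ?_
      have e : ∀ ω, R.sol (Function.update x j ω) Q = R.sol x Q := fun ω => by
        rw [sol, sol, feasSet_congr]
        refine image_congr fun i hi => Function.update_of_ne ?_ _ _
        rintro rfl
        exact hj hi
      simp only [mem_ofPred_eq, e, Function.update_self]
      exact hnd _
  have h2 : ∀ᵐ x ∂(Measure.pi fun _ : ι => μ), ∀ i j, i ≠ j →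
      R.label (x i) ≠ R.label (x j) := by
    rw [ae_all_iff]
    intro i
    rw [ae_all_iff]
    intro j
    by_cases hij : i = j
    · exact Filter.Eventually.of_forall fun _ h => absurd hij h
    · rw [ae_iff]
      simp only [hij, not_false_eq_true, forall_const, ne_eq, not_not]
      refine pi_eq_zero_of_update (measurableSet_eq_fun
        (hm.label.comp (measurable_pi_apply i)) (hm.label.comp (measurable_pi_apply j))) j
        fun x => ?_
      simp only [mem_ofPred_eq, Function.update_self, Function.update_of_ne hij]
      simp only [eq_comm (a := R.label (x i))]
      exact hlab _
  filter_upwards [h1, h2] with x hx1 hx2 using ⟨hx1, hx2⟩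

end RandomProgram

namespace RandomProgram

/-! ### The violation probability in general position -/

variable {Ω : Type*} {n : ℕ} {R : RandomProgram Ω n} [MeasurableSpace Ω] {μ : Measure Ω}
  [IsProbabilityMeasure μ]

variable (R μ) in
/-- The probability that a constraint is compatible with the `n` constraints `y`. -/
def compatProb (y : Fin n → Ω) : ℝ := μ.real {ω | R.Compatible y Finset.univ ω}

theorem Standing.measurable_compatProb (hR : R.Standing) (hm : R.IsMeasurable) :
    Measurable (R.compatProb μ) :=
  (measurable_measure_prodMk_left (ν := μ)
    (hR.measurableSet_compatible hm Finset.univ)).ennreal_toReal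

theorem compatProb_mem (y : Fin n → Ω) : R.compatProb μ y ∈ Icc (0 : ℝ) 1 :=
  ⟨measureReal_nonneg, measureReal_le_one⟩

theorem Standing.measurableSet_all_compatible (hR : R.Standing) (hm : R.IsMeasurable) {m : ℕ}
    (I : Finset (Fin m)) :
    MeasurableSet {x : Fin m → Ω | ∀ j, j ∉ I → R.Compatible x I (x j)} := by
  simp only [ofPred_forall]
  refine MeasurableSet.iInter fun j => MeasurableSet.iInter fun _ => ?_
  exact (measurable_id.prodMk (measurable_pi_apply j)) (hR.measurableSet_compatible hm I)

/-- Given the constraints in I, the others are independently compatible with probability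
`compatProb`. D is all of ℝ for the moments and a half-line for the tail. -/
theorem Standing.pi_compatible_eq (hR : R.Standing) (hm : R.IsMeasurable) {m : ℕ}
    {I : Finset (Fin m)} (hI : I.card = n) {D : Set ℝ} (hD : MeasurableSet D) :
    Measure.pi (fun _ : Fin m => μ) {x | μ.real {ω | R.Compatible x I ω} ∈ D ∧
        ∀ j, j ∉ I → R.Compatible x I (x j)} =
      ENNReal.ofReal (∫ u in D, u ^ (m - n)
        ∂((Measure.pi fun _ : Fin n => μ).map (R.compatProb μ))) := by
  set e : Fin n ≃ {j // j ∈ I} := (I.equivFinOfCardEq hI).symm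
  have hc : ∀ (x : Fin m → Ω) (ω : Ω),
      R.Compatible x I ω ↔ R.Compatible (fun i => x (e i)) Finset.univ ω := by
    intro x ω
    refine compatible_congr ?_ ω
    ext ω'
    simp only [mem_image, Finset.mem_coe, Finset.coe_univ, mem_univ, true_and]
    constructor
    · rintro ⟨i, hi, rfl⟩
      exact ⟨e.symm ⟨i, hi⟩, by simp⟩
    · rintro ⟨i, rfl⟩
      exact ⟨e i, (e i).2, rfl⟩
  have hmp := hR.measurable_compatProb (μ := μ) hm
  have h1 := pi_split_eq (μ := μ) e (hmp hD) (hR.measurableSet_compatible hm Finset.univ)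
  have e1 : {x : Fin m → Ω | μ.real {ω | R.Compatible x I ω} ∈ D ∧
        ∀ j, j ∉ I → R.Compatible x I (x j)} =
      {x | (fun i => x (e i)) ∈ R.compatProb μ ⁻¹' D ∧ ∀ j, ¬ j ∈ I →
        ((fun i => x (e i)), x j) ∈ {p : (Fin n → Ω) × Ω |
          R.Compatible p.1 Finset.univ p.2}} := by
    ext x
    simp only [mem_ofPred_eq, mem_preimage, compatProb, hc]
  rw [e1, h1, Fintype.card_fin, setIntegral_map hD (by fun_prop) hmp.aemeasurable,
    ofReal_integral_eq_lintegral_ofReal]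
  · refine lintegral_congr fun y => ?_
    rw [ENNReal.ofReal_pow (compatProb_mem y).1, compatProb, measureReal_def,
      ENNReal.ofReal_toReal (measure_ne_top _ _)]
    rfl
  · refine Integrable.of_bound (hmp.pow_const _).aestronglyMeasurable 1
      (Filter.Eventually.of_forall fun y => ?_)
    rw [Real.norm_of_nonneg (pow_nonneg (compatProb_mem y).1 _)]
    exact pow_le_one₀ (compatProb_mem y).1 (compatProb_mem y).2
  · exact Filter.Eventually.of_forall fun y => pow_nonneg (compatProb_mem y).1 _

/-- Almost surely exactly one of the C(n + k, n) subsets is compatible with the rest, and each is so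
with probability equal to the k-th moment. -/
theorem Standing.compatProb_moments (hR : R.Standing) (hm : R.IsMeasurable)
    (hnd : ∀ α : Fin n → ℝ, μ {ω | α ⬝ᵥ R.s ω = R.t ω} = 0)
    (hlab : ∀ r, μ {ω | R.label ω = r} = 0) (k : ℕ) :
    ((n + k).choose n : ℝ) * ∫ u, u ^ k ∂((Measure.pi fun _ : Fin n => μ).map (R.compatProb μ)) =
      1 := by
  set c : ℝ := ∫ u, u ^ k ∂((Measure.pi fun _ : Fin n => μ).map (R.compatProb μ)) with hc
  have hc0 : 0 ≤ c := by
    rw [hc, integral_map (hR.measurable_compatProb hm).aemeasurable (by fun_prop)]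
    exact integral_nonneg fun y => pow_nonneg (compatProb_mem y).1 _
  set G : Finset (Fin (n + k)) → Set (Fin (n + k) → Ω) := fun I =>
    {x | ∀ j, j ∉ I → R.Compatible x I (x j)} with hG
  have hGm : ∀ I, MeasurableSet (G I) := fun I => hR.measurableSet_all_compatible hm I
  have h1 : ∀ I ∈ Finset.powersetCard n (Finset.univ : Finset (Fin (n + k))),
      Measure.pi (fun _ : Fin (n + k) => μ) (G I) = ENNReal.ofReal c := by
    intro I hI
    have := hR.pi_compatible_eq (μ := μ) hm (Finset.mem_powersetCard.1 hI).2 MeasurableSet.univ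
    simpa only [mem_univ, true_and, setIntegral_univ, Nat.add_sub_cancel_left] using this
  have h2 : ∑ I ∈ Finset.powersetCard n (Finset.univ : Finset (Fin (n + k))),
      Measure.pi (fun _ : Fin (n + k) => μ) (G I) = 1 := by
    have h3 : ∀ᵐ x ∂(Measure.pi fun _ : Fin (n + k) => μ),
        ∑ I ∈ Finset.powersetCard n (Finset.univ : Finset (Fin (n + k))),
          (G I).indicator (1 : (Fin (n + k) → Ω) → ENNReal) x = 1 := by
      filter_upwards [hR.ae_nondegenerate hm hnd hlab] with x hx
      obtain ⟨I, ⟨hIcard, hI⟩, huniq⟩ := hx.existsUnique_compatible hR (by simp)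
      rw [Finset.sum_eq_single_of_mem I (Finset.mem_powersetCard.2 ⟨Finset.subset_univ _, hIcard⟩)]
      · exact indicator_of_mem (show x ∈ G I from hI) _
      · intro I' hI' hne
        refine indicator_of_notMem (fun h => hne ?_) _
        exact huniq I' ⟨(Finset.mem_powersetCard.1 hI').2, h⟩
    calc ∑ I ∈ Finset.powersetCard n (Finset.univ : Finset (Fin (n + k))),
        Measure.pi (fun _ : Fin (n + k) => μ) (G I)
        = ∑ I ∈ Finset.powersetCard n (Finset.univ : Finset (Fin (n + k))),
          ∫⁻ x, (G I).indicator 1 x ∂(Measure.pi fun _ : Fin (n + k) => μ) :=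
          Finset.sum_congr rfl fun I _ => (lintegral_indicator_one (hGm I)).symm
      _ = ∫⁻ x, ∑ I ∈ Finset.powersetCard n (Finset.univ : Finset (Fin (n + k))),
          (G I).indicator 1 x ∂(Measure.pi fun _ : Fin (n + k) => μ) :=
          (lintegral_finsetSum _ fun I _ => measurable_one.indicator (hGm I)).symm
      _ = 1 := by rw [lintegral_congr_ae h3]; simp
  rw [Finset.sum_congr rfl h1, Finset.sum_const, Finset.card_powersetCard, Finset.card_univ,
    Fintype.card_fin, nsmul_eq_mul, ← ENNReal.ofReal_natCast,
    ← ENNReal.ofReal_mul (Nat.cast_nonneg _), ENNReal.ofReal_eq_one] at h2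
  exact h2

/-- The binomial bound on the violation probability, in general position. -/
theorem Standing.measure_violation_le (hR : R.Standing) (hm : R.IsMeasurable)
    (hnd : ∀ α : Fin n → ℝ, μ {ω | α ⬝ᵥ R.s ω = R.t ω} = 0)
    (hlab : ∀ r, μ {ω | R.label ω = r} = 0) (hn : 1 ≤ n) {N : ℕ} (hnN : n ≤ N) {ε : ℝ}
    (hε : 0 ≤ ε) (hε1 : ε ≤ 1) :
    Measure.pi (fun _ : Fin N => μ)
        {x | ε < μ.real {ω | R.sol x Finset.univ ⬝ᵥ R.s ω < R.t ω}} ≤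
      ENNReal.ofReal (binTail n N ε) := by
  set T : Finset (Fin N) → Set (Fin N → Ω) := fun I =>
    {x | μ.real {ω | R.Compatible x I ω} ∈ Iio (1 - ε) ∧
        ∀ j, j ∉ I → R.Compatible x I (x j)} with hT
  -- Violators are incompatible with the distinguished subset, so a violation probability above ε
  -- forces its compatibility probability below 1 - ε.
  have hsub : ∀ᵐ x ∂(Measure.pi fun _ : Fin N => μ),
      x ∈ {x | ε < μ.real {ω | R.sol x Finset.univ ⬝ᵥ R.s ω < R.t ω}} →
      x ∈ ⋃ I ∈ Finset.powersetCard n (Finset.univ : Finset (Fin N)), T I := by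
    filter_upwards [hR.ae_nondegenerate hm hnd hlab] with x hx hxε
    obtain ⟨I, ⟨hIcard, hI⟩, -⟩ := hx.existsUnique_compatible hR (by simpa using hnN)
    simp only [mem_iUnion]
    refine ⟨I, Finset.mem_powersetCard.2 ⟨Finset.subset_univ _, hIcard⟩, ?_, hI⟩
    have hmeas : MeasurableSet {ω | R.Compatible x I ω} :=
      measurable_prodMk_left (hR.measurableSet_compatible hm I)
    have h1 : {ω | R.sol x Finset.univ ⬝ᵥ R.s ω < R.t ω} ⊆ {ω | R.Compatible x I ω}ᶜ := by
      intro ω hω hωc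
      have h2 := hωc.1
      rw [hR.sol_eq_of_compatible hI] at h2
      exact absurd h2 (not_le.2 hω)
    have h2 : ε < μ.real {ω | R.Compatible x I ω}ᶜ :=
      lt_of_lt_of_le hxε (measureReal_mono h1)
    rw [probReal_compl_eq_one_sub hmeas] at h2
    rw [mem_Iio]
    linarith
  refine (measure_mono_ae hsub).trans ((measure_biUnion_finset_le _ _).trans ?_)
  have h1 : ∀ I ∈ Finset.powersetCard n (Finset.univ : Finset (Fin N)),
      Measure.pi (fun _ : Fin N => μ) (T I) = ENNReal.ofReal (∫ u in Iio (1 - ε), u ^ (N - n)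
        ∂((Measure.pi fun _ : Fin n => μ).map (R.compatProb μ))) := fun I hI =>
    hR.pi_compatible_eq (μ := μ) hm (Finset.mem_powersetCard.1 hI).2 measurableSet_Iio
  rw [Finset.sum_congr rfl h1, Finset.sum_const, Finset.card_powersetCard, Finset.card_univ,
    Fintype.card_fin, nsmul_eq_mul, ← ENNReal.ofReal_natCast,
    ← ENNReal.ofReal_mul (Nat.cast_nonneg _)]
  have hmp := hR.measurable_compatProb (μ := μ) hm
  have : IsProbabilityMeasure ((Measure.pi fun _ : Fin n => μ).map (R.compatProb μ)) :=
    Measure.isProbabilityMeasure_map hmp.aemeasurable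
  rw [integral_eq_binTail_of_moments
    ((ae_map_iff hmp.aemeasurable measurableSet_Icc).2 (Filter.Eventually.of_forall compatProb_mem))
    hn (hR.compatProb_moments hm hnd hlab) hnN hε hε1]

end RandomProgram

section Perturbation

open Filter Topology

/-! ### Perturbation of random programs -/

/-- Continuity from below along the increasing sets ⋂_{k ≥ m} s k; no measurability is needed. -/
theorem eventually_lt_measure {α : Type*} [MeasurableSpace α] {ν : Measure α} {A : Set α}
    {s : ℕ → Set α} (h : ∀ a ∈ A, ∀ᶠ k in atTop, a ∈ s k) {c : ENNReal} (hc : c < ν A) :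
    ∀ᶠ k in atTop, c < ν (s k) := by
  set T : ℕ → Set α := fun m => ⋂ k ≥ m, s k with hT
  have hmono : Monotone T := fun m m' hmm' =>
    biInter_subset_biInter_left fun k (hk : m' ≤ k) => hmm'.trans hk
  have hsub : A ⊆ ⋃ m, T m := fun a ha => by
    obtain ⟨m, hm⟩ := eventually_atTop.1 (h a ha)
    exact mem_iUnion.2 ⟨m, mem_iInter₂.2 hm⟩
  have h1 : c < ⨆ m, ν (T m) := by
    rw [← hmono.measure_iUnion]
    exact hc.trans_le (measure_mono hsub)
  obtain ⟨m, hm⟩ := lt_iSup_iff.1 h1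
  filter_upwards [eventually_ge_atTop m] with k hk
  exact hm.trans_le (measure_mono (biInter_subset_of_mem hk))

theorem measure_le_of_eventually {α : Type*} [MeasurableSpace α] {ν : Measure α} {A : Set α}
    {s : ℕ → Set α} (h : ∀ a ∈ A, ∀ᶠ k in atTop, a ∈ s k) {c : ENNReal}
    (hc : ∀ k, ν (s k) ≤ c) : ν A ≤ c := by
  by_contra! hlt
  obtain ⟨k, hk⟩ := (eventually_lt_measure h hlt).exists
  exact absurd (hc k) (not_le.2 hk)

theorem eventually_lt_measureReal {α : Type*} [MeasurableSpace α] {ν : Measure α}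
    [IsFiniteMeasure ν] {A : Set α} {s : ℕ → Set α} (h : ∀ a ∈ A, ∀ᶠ k in atTop, a ∈ s k) {c : ℝ}
    (hc0 : 0 ≤ c) (hc : c < ν.real A) : ∀ᶠ k in atTop, c < ν.real (s k) := by
  have h1 : ENNReal.ofReal c < ν A :=
    (ENNReal.ofReal_lt_iff_lt_toReal hc0 (measure_ne_top _ _)).2 hc
  filter_upwards [eventually_lt_measure h h1] with k hk
  exact (ENNReal.ofReal_lt_iff_lt_toReal hc0 (measure_ne_top _ _)).1 hk

/-- Minimizers of perturbed programs converge to a unique minimizer of the limit program. -/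
theorem tendsto_minimizers {n : ℕ} {ι : Type*} {K : Set (Fin n → ℝ)} (hK : IsCompact K)
    {f h : (Fin n → ℝ) → ℝ} (hf : Continuous f) (hh : Continuous h) {τ : ℕ → ℝ}
    (hτ : Tendsto τ atTop (𝓝 0)) {s : ι → Fin n → ℝ} {t : ι → ℝ} {t' : ℕ → ι → ℝ}
    (ht : ∀ j, Tendsto (fun k => t' k j) atTop (𝓝 (t j))) (hle : ∀ k j, t' k j ≤ t j)
    {α : ℕ → Fin n → ℝ} (hα : ∀ k, IsMinimizer (fun γ => f γ + τ k * h γ)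
      {γ | γ ∈ K ∧ ∀ j, t' k j ≤ γ ⬝ᵥ s j} (α k)) {β : Fin n → ℝ}
    (huniq : ∀ γ, IsMinimizer f {γ | γ ∈ K ∧ ∀ j, t j ≤ γ ⬝ᵥ s j} γ → γ = β) :
    Tendsto α atTop (𝓝 β) := by
  -- Every subsequential limit is a minimizer: by `hle`, points feasible for the limit program are
  -- feasible for the perturbed ones and can be compared.
  refine tendsto_of_subseq_tendsto fun ns hns => ?_
  obtain ⟨γ, hγK, ms, hms, hlim⟩ := hK.tendsto_subseq fun k => (hα (ns k)).1.1
  refine ⟨ms, ?_⟩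
  have hns' : Tendsto (fun k => ns (ms k)) atTop atTop := hns.comp hms.tendsto_atTop
  suffices γ = β by
    rw [← this]
    exact hlim
  refine huniq γ ⟨⟨hγK, fun j => ?_⟩, fun γ' hγ' => ?_⟩
  · exact le_of_tendsto_of_tendsto' ((ht j).comp hns')
      (((continuous_dot (s j)).tendsto γ).comp hlim) fun k => (hα (ns (ms k))).1.2 j
  · have h1 : Tendsto (fun k => f (α (ns (ms k))) + τ (ns (ms k)) * h (α (ns (ms k)))) atTop
        (𝓝 (f γ + 0 * h γ)) :=
      ((hf.tendsto γ).comp hlim).add ((hτ.comp hns').mul ((hh.tendsto γ).comp hlim))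
    have h2 : Tendsto (fun k => f γ' + τ (ns (ms k)) * h γ') atTop (𝓝 (f γ' + 0 * h γ')) :=
      ((hτ.comp hns').mul_const _).const_add _
    have h3 := le_of_tendsto_of_tendsto' h1 h2 fun k =>
      (hα (ns (ms k))).2 γ' ⟨hγ'.1, fun j => (hle _ j).trans (hγ'.2 j)⟩
    simpa using h3

namespace RandomProgram

variable {Ω : Type*} {n : ℕ} [MeasurableSpace Ω] {μ : Measure Ω} [IsProbabilityMeasure μ]

/-- The program whose constraints are relaxed by a random amount in `[0, σ]`. -/
def relax (R : RandomProgram Ω n) (σ : ℝ) : RandomProgram (Ω × unitInterval) n where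
  K := R.K
  f := R.f
  s p := R.s p.1
  t p := R.t p.1 - σ * p.2
  label p := p.2

variable {R : RandomProgram Ω n}

theorem Standing.relax (hR : R.Standing) {σ : ℝ} (hσ : 0 ≤ σ) : (R.relax σ).Standing where
  compact := hR.compact
  convex := hR.convex
  continuous := hR.continuous
  strictConvex := hR.strictConvex
  feasible := by
    obtain ⟨α, hα, h⟩ := hR.feasible
    refine ⟨α, hα, fun p => ?_⟩
    have := mul_nonneg hσ p.2.2.1
    simp only [RandomProgram.relax]
    linarith [h p.1]

theorem IsMeasurable.relax (hm : R.IsMeasurable) (σ : ℝ) : (R.relax σ).IsMeasurable where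
  s := hm.s.comp measurable_fst
  t := (hm.t.comp measurable_fst).sub
    ((measurable_subtype_coe.comp measurable_snd).const_mul σ)
  label := measurable_subtype_coe.comp measurable_snd

/-- The binomial bound on the violation probability for strictly convex objective functions. -/
theorem Standing.measure_violation_le' (hR : R.Standing) (hm : R.IsMeasurable) (hn : 1 ≤ n)
    {N : ℕ} (hnN : n ≤ N) {ε : ℝ} (hε : 0 ≤ ε) (hε1 : ε ≤ 1) :
    Measure.pi (fun _ : Fin N => μ)
        {x | ε < μ.real {ω | R.sol x Finset.univ ⬝ᵥ R.s ω < R.t ω}} ≤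
      ENNReal.ofReal (binTail n N ε) := by
  -- An independent uniform variable attached to each constraint plays two roles: as a shift of the
  -- offset it makes equality at a fixed point a null event, and it is an atomless label.
  set μ' : Measure (Ω × unitInterval) := μ.prod volume with hμ'
  set σ : ℕ → ℝ := fun k => 1 / ((k : ℝ) + 1) with hσ
  have hσpos : ∀ k, 0 < σ k := fun k => Nat.one_div_pos_of_nat
  have hσlim : Tendsto σ atTop (𝓝 0) := tendsto_one_div_add_atTop_nhds_zero_nat
  have hmp : MeasurePreserving (fun (x : Fin N → Ω × unitInterval) i => (x i).1)
      (Measure.pi fun _ => μ') (Measure.pi fun _ => μ) :=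
    measurePreserving_pi _ _ fun _ => measurePreserving_fst
  have hviol : ∀ α : Fin n → ℝ, MeasurableSet {ω | α ⬝ᵥ R.s ω < R.t ω} := fun α =>
    measurableSet_lt (measurable_dot measurable_const hm.s) hm.t
  have hE : MeasurableSet {x : Fin N → Ω |
      ε < μ.real {ω | R.sol x Finset.univ ⬝ᵥ R.s ω < R.t ω}} := by
    have hW : MeasurableSet {p : (Fin N → Ω) × Ω |
        R.sol p.1 Finset.univ ⬝ᵥ R.s p.2 < R.t p.2} :=
      measurableSet_lt (measurable_dot ((hR.measurable_sol hm _).comp measurable_fst)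
        (hm.s.comp measurable_snd)) (hm.t.comp measurable_snd)
    exact measurableSet_lt measurable_const
      (measurable_measure_prodMk_left (ν := μ) hW).ennreal_toReal
  rw [← hmp.measure_preimage hE.nullMeasurableSet]
  refine measure_le_of_eventually (s := fun k => {x | ε < μ'.real {p |
    (R.relax (σ k)).sol x Finset.univ ⬝ᵥ (R.relax (σ k)).s p < (R.relax (σ k)).t p}})
    (fun x hx => ?_) fun k => ?_
  · set β := R.sol (fun i => (x i).1) Finset.univ with hβ
    have hx' : ε < μ'.real {p | β ⬝ᵥ R.s p.1 < R.t p.1} := by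
      have := (measurePreserving_fst (μ := μ)
        (ν := (volume : Measure unitInterval))).measureReal_preimage (hviol β).nullMeasurableSet
      exact lt_of_lt_of_eq hx this.symm
    have hlim : Tendsto (fun k => (R.relax (σ k)).sol x Finset.univ) atTop (𝓝 β) := by
      refine tendsto_minimizers hR.compact hR.continuous (continuous_const (y := (0 : ℝ)))
        (τ := fun _ => 0) tendsto_const_nhds (s := fun i => R.s (x i).1)
        (t := fun i => R.t (x i).1) (t' := fun k i => R.t (x i).1 - σ k * (x i).2)
        (fun j => ?_) (fun k j => ?_) (fun k => ?_) (fun γ hγ => ?_)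
      · simpa using (hσlim.mul_const ((x j).2 : ℝ)).const_sub (R.t (x j).1)
      · exact sub_le_self _ (mul_nonneg (hσpos k).le (x j).2.2.1)
      · have := (hR.relax (hσpos k).le).isMinimizer_sol x Finset.univ
        simpa [IsMinimizer, feasSet, RandomProgram.relax] using this
      · refine hR.eq_sol ?_
        simpa [IsMinimizer, feasSet] using hγ
    -- Strict violation survives small perturbations, so a constraint violated in the limit is
    -- violated for all large k.
    refine eventually_lt_measureReal (A := {p : Ω × unitInterval | β ⬝ᵥ R.s p.1 < R.t p.1})
      (fun p hp => ?_) hε hx'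
    have h1 : Tendsto (fun k => (R.relax (σ k)).sol x Finset.univ ⬝ᵥ R.s p.1) atTop
        (𝓝 (β ⬝ᵥ R.s p.1)) := ((continuous_dot _).tendsto β).comp hlim
    have h2 : Tendsto (fun k => R.t p.1 - σ k * p.2) atTop (𝓝 (R.t p.1)) := by
      simpa using (hσlim.mul_const (p.2 : ℝ)).const_sub (R.t p.1)
    exact h1.eventually_lt h2 hp
  · refine (hR.relax (hσpos k).le).measure_violation_le (hm.relax _) (fun α => ?_) (fun r => ?_)
      hn hnN hε hε1
    · have hmeas : MeasurableSet {p | α ⬝ᵥ (R.relax (σ k)).s p = (R.relax (σ k)).t p} :=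
        measurableSet_eq_fun (measurable_dot measurable_const (hm.relax _).s) (hm.relax _).t
      rw [hμ', Measure.prod_apply hmeas]
      refine (lintegral_congr fun ω => ?_).trans lintegral_zero
      refine Set.Subsingleton.measure_zero (fun u hu v hv => ?_) _
      have hu' : α ⬝ᵥ R.s ω = R.t ω - σ k * u := hu
      have hv' : α ⬝ᵥ R.s ω = R.t ω - σ k * v := hv
      exact Subtype.ext (mul_left_cancel₀ (hσpos k).ne' (by linarith))
    · have hmeas : MeasurableSet {p | (R.relax (σ k)).label p = r} :=
        (hm.relax _).label (measurableSet_singleton r)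
      rw [hμ', Measure.prod_apply hmeas]
      refine (lintegral_congr fun ω => ?_).trans lintegral_zero
      refine Set.Subsingleton.measure_zero (fun u hu v hv => ?_) _
      have hu' : (u : ℝ) = r := hu
      have hv' : (v : ℝ) = r := hv
      exact Subtype.ext (hu'.trans hv'.symm)

end RandomProgram

theorem strictConvexOn_quadratic {n : ℕ} (c : Fin n → ℝ) {τ : ℝ} (hτ : 0 < τ) :
    StrictConvexOn ℝ univ fun α : Fin n → ℝ => α ⬝ᵥ c + τ * (α ⬝ᵥ α) := by
  refine ⟨convex_univ, fun u _ v _ huv a b ha hb hab => ?_⟩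
  have hpos : 0 < (u - v) ⬝ᵥ (u - v) :=
    lt_of_le_of_ne (Finset.sum_nonneg fun i _ => mul_self_nonneg _) fun h =>
      huv (sub_eq_zero.1 (dotProduct_self_eq_zero.1 h.symm))
  have h1 : 0 < τ * (a * b) * ((u - v) ⬝ᵥ (u - v)) := by positivity
  simp only [sub_dotProduct, dotProduct_sub, add_dotProduct, dotProduct_add, smul_dotProduct,
    dotProduct_smul, smul_eq_mul, dotProduct_comm v u] at h1 ⊢
  obtain rfl : b = 1 - a := by linarith
  nlinarith

/-- The binomial bound on the violation probability of the optimizer of a random linear program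
over a compact convex set. -/
theorem measure_violation_le {Ω : Type*} [MeasurableSpace Ω] {μ : Measure Ω}
    [IsProbabilityMeasure μ] {n : ℕ} (hn : 1 ≤ n) {K : Set (Fin n → ℝ)} (hK : IsCompact K)
    (hKconv : Convex ℝ K) (c : Fin n → ℝ) {s : Ω → Fin n → ℝ} {t : Ω → ℝ} (hs : Measurable s)
    (ht : Measurable t) {α₀ : Fin n → ℝ} (hα₀ : α₀ ∈ K) (hfeas : ∀ᵐ ω ∂μ, t ω ≤ α₀ ⬝ᵥ s ω)
    {N : ℕ} (hnN : n ≤ N) {αN : (Fin N → Ω) → Fin n → ℝ}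
    (hαN : ∀ᵐ x ∂(Measure.pi fun _ : Fin N => μ), ∀ α, IsMinimizer (fun α => α ⬝ᵥ c)
      {α | α ∈ K ∧ ∀ j, t (x j) ≤ α ⬝ᵥ s (x j)} α → α = αN x)
    {ε : ℝ} (hε : 0 ≤ ε) (hε1 : ε ≤ 1) :
    Measure.pi (fun _ : Fin N => μ) {x | ε < μ.real {ω | αN x ⬝ᵥ s ω < t ω}} ≤
      ENNReal.ofReal (binTail n N ε) := by
  -- Makes α₀ feasible for every ω while changing t only on a null set.
  set t' : Ω → ℝ := fun ω => min (t ω) (α₀ ⬝ᵥ s ω) with ht'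
  have htt' : ∀ᵐ ω ∂μ, t' ω = t ω := hfeas.mono fun ω h => min_eq_left h
  -- Vanishing weights of a strictly convex quadratic term; almost sure uniqueness makes the
  -- regularized optimizers converge to `αN x`.
  set τ : ℕ → ℝ := fun k => 1 / ((k : ℝ) + 1) with hτ
  have hτpos : ∀ k, 0 < τ k := fun k => Nat.one_div_pos_of_nat
  have hτlim : Tendsto τ atTop (𝓝 0) := tendsto_one_div_add_atTop_nhds_zero_nat
  let R : ℕ → RandomProgram Ω n := fun k =>
    { K := K, f := fun α => α ⬝ᵥ c + τ k * (α ⬝ᵥ α), s := s, t := t', label := 0 }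
  have hsq : Continuous fun α : Fin n → ℝ => α ⬝ᵥ α := by
    unfold dotProduct
    fun_prop
  have hR : ∀ k, (R k).Standing := fun k =>
    { compact := hK
      convex := hKconv
      continuous := (continuous_dot c).add (hsq.const_mul _)
      strictConvex := strictConvexOn_quadratic c (hτpos k)
      feasible := ⟨α₀, hα₀, fun ω => min_le_right _ _⟩ }
  have hm : ∀ k, (R k).IsMeasurable := fun k =>
    { s := hs
      t := ht.min (RandomProgram.measurable_dot measurable_const hs)
      label := measurable_const }
  have hae : ∀ᵐ x ∂(Measure.pi fun _ : Fin N => μ), ∀ j, t' (x j) = t (x j) := by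
    rw [ae_all_iff]
    exact fun j => (measurePreserving_eval (fun _ : Fin N => μ) j).quasiMeasurePreserving.ae htt'
  have key : Measure.pi (fun _ : Fin N => μ) ({x | ε < μ.real {ω | αN x ⬝ᵥ s ω < t ω}} ∩
      {x | (∀ α, IsMinimizer (fun α => α ⬝ᵥ c) {α | α ∈ K ∧ ∀ j, t (x j) ≤ α ⬝ᵥ s (x j)} α →
        α = αN x) ∧ ∀ j, t' (x j) = t (x j)}) ≤ ENNReal.ofReal (binTail n N ε) := by
    refine measure_le_of_eventually (s := fun k => {x | ε < μ.real {ω |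
      (R k).sol x Finset.univ ⬝ᵥ (R k).s ω < (R k).t ω}}) ?_ fun k =>
      (hR k).measure_violation_le' (hm k) hn hnN hε hε1
    rintro x ⟨hxε, hxu, hxt⟩
    have hlim : Tendsto (fun k => (R k).sol x Finset.univ) atTop (𝓝 (αN x)) := by
      refine tendsto_minimizers hK (continuous_dot c) hsq hτlim (s := fun j => s (x j))
        (t := fun j => t (x j)) (t' := fun _ j => t' (x j)) (fun j => ?_) (fun k j => ?_)
        (fun k => ?_) hxu
      · rw [hxt]
        exact tendsto_const_nhds
      · exact (hxt j).le
      · have := (hR k).isMinimizer_sol x Finset.univ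
        simpa [IsMinimizer, RandomProgram.feasSet, R] using this
    have hx' : ε < μ.real {ω | αN x ⬝ᵥ s ω < t' ω} := by
      refine lt_of_lt_of_eq hxε (measureReal_congr ?_)
      rw [eventuallyEq_set]
      filter_upwards [htt'] with ω hω
      simp only [hω]
    refine eventually_lt_measureReal (fun ω hω => ?_) hε hx'
    have h1 : Tendsto (fun k => (R k).sol x Finset.univ ⬝ᵥ s ω) atTop (𝓝 (αN x ⬝ᵥ s ω)) :=
      ((continuous_dot _).tendsto _).comp hlim
    exact h1.eventually_lt_const hω
  refine (measure_mono_ae ?_).trans key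
  filter_upwards [hαN, hae] with x h1 h2 hx using ⟨hx, h1, h2⟩

/-- The bound for the non-strict inequality. -/
theorem measure_le_violation_le {Ω' : Type*} [MeasurableSpace Ω'] {ν : Measure Ω'} {V : Ω' → ℝ}
    {n N : ℕ} (h : ∀ ε, 0 ≤ ε → ε ≤ 1 → ν {x | ε < V x} ≤ ENNReal.ofReal (binTail n N ε)) {ε : ℝ}
    (hε : 0 < ε) (hε1 : ε ≤ 1) : ν {x | ε ≤ V x} ≤ ENNReal.ofReal (binTail n N ε) := by
  -- Apply the strict bound at levels increasing to ε and use the continuity of the tail.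
  have hlim : Tendsto (fun k : ℕ => ε * (1 - 1 / ((k : ℝ) + 1))) atTop (𝓝 (ε * (1 - 0))) :=
    (tendsto_one_div_add_atTop_nhds_zero_nat.const_sub 1).const_mul ε
  rw [sub_zero, mul_one] at hlim
  refine ge_of_tendsto' ((ENNReal.continuous_ofReal.comp (continuous_binTail n N)).tendsto ε |>.comp
    hlim) fun k => ?_
  have hk : (0 : ℝ) < 1 / ((k : ℝ) + 1) := Nat.one_div_pos_of_nat
  have hk1 : 1 / ((k : ℝ) + 1) ≤ 1 := by
    rw [div_le_one (by positivity)]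
    linarith [(Nat.cast_nonneg k : (0 : ℝ) ≤ k)]
  have hlt : ε * (1 - 1 / ((k : ℝ) + 1)) < ε := mul_lt_of_lt_one_right hε (by linarith)
  refine (measure_mono fun x (hx : ε ≤ V x) => ?_).trans
    (h _ (mul_nonneg hε.le (by linarith)) (hlt.le.trans hε1))
  exact hlt.trans_le hx

end Perturbation

/-! ### The scenario program -/

section Scenario

variable {X C B Y : Type*} [NormedAddCommGroup X] [NormedSpace ℝ X]
  [AddCommGroup C] [Module ℝ C] [NormedAddCommGroup B] [NormedSpace ℝ B]
  [AddCommGroup Y] [Module ℝ Y] {P : Program X C B Y} {S : Scheme X} {n N : ℕ} {γ JLB : ℝ}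

theorem Program.Standing.inv_smul_mem_sphere (hP : P.Standing) {y : Y} (hy : y ∈ P.Kstar)
    (hpos : 0 < P.normY y) : (P.normY y)⁻¹ • y ∈ P.sphere := by
  refine ⟨P.Kstar.smul_mem (inv_pos.2 hpos).le hy, le_antisymm ?_ ?_⟩
  · have := hP.normY_smul_le (inv_pos.2 hpos).le y
    rwa [inv_mul_cancel₀ hpos.ne'] at this
  · have := hP.normY_smul_le hpos.le ((P.normY y)⁻¹ • y)
    rw [smul_inv_smul₀ hpos.ne'] at this
    exact (le_mul_iff_one_le_right hpos).1 this

/-- A bound on the extreme points extends to the whole sphere. -/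
theorem Program.ExtGenerates.pB_le (hext : P.ExtGenerates) {v : B} {M : ℝ}
    (h : ∀ κ ∈ P.ext, P.pB v κ ≤ M) {y : Y} (hy : y ∈ P.sphere) : P.pB v y ≤ M := by
  have hclosed : IsClosed (X := WeakBilin P.pB.flip) {y : Y | P.pB v y ≤ M} :=
    isClosed_le (WeakBilin.eval_continuous P.pB.flip v) continuous_const
  have hconv : Convex ℝ {y : Y | P.pB v y ≤ M} := convex_halfSpace_le (P.pB v).isLinear M
  have hsub : convexHull ℝ P.ext ⊆ {y : Y | P.pB v y ≤ M} := convexHull_min h hconv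
  exact closure_minimal (X := WeakBilin P.pB.flip) hsub hclosed (hext hy)

/-- A nonzero y is a multiple, by a factor at most θ, of a point of the sphere, where the extreme
points decide; M ≥ 0 allows that factor to be raised to θ. -/
theorem Program.Standing.supportFun_ballY_le (hP : P.Standing) (hext : P.ExtGenerates) {v : B}
    {M θ : ℝ} (hM : 0 ≤ M) (hθ : 0 ≤ θ) (h : ∀ κ ∈ P.ext, P.pB v κ ≤ M) :
    supportFun (P.ballY θ) (P.pB v) ≤ θ * M := by
  refine csSup_le ⟨_, 0, ⟨P.Kstar.zero_mem, by rwa [Program.normY_zero]⟩, rfl⟩ ?_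
  rintro _ ⟨y, hy, rfl⟩
  rcases (hP.normY_nonneg y).eq_or_lt with h0 | hpos
  · have := hP.pB_le v y
    rw [← h0, mul_zero] at this
    exact this.trans (mul_nonneg hθ hM)
  · have h1 := hext.pB_le h (hP.inv_smul_mem_sphere hy.1 hpos)
    rw [map_smul, smul_eq_mul, inv_mul_le_iff₀ hpos] at h1
    exact h1.trans (mul_le_mul_of_nonneg_right hy.2 hM)

theorem Program.Regular.Jn_le_of_ext_bound (hreg : P.Regular S n γ) (hP : P.Standing)
    (hS : S.Standing) (hext : P.ExtGenerates) (hJ : JLB ≤ P.Jn S n) {α : Fin n → ℝ}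
    (hα : α ∈ S.ballR n) {M : ℝ} (hM : 0 ≤ M)
    (h : ∀ κ ∈ P.ext, P.pB (P.b - P.An S n α) κ ≤ M) :
    P.Jn S n ≤ α ⬝ᵥ P.cvec S n + P.θD S n γ JLB * M := by
  refine (hreg.Jn_le_upperVal hP hS hJ hα).trans ?_
  rw [Program.upperVal]
  exact add_le_add_right (hP.supportFun_ballY_le hext hM (hreg.θD_nonneg hS hJ) h) _

theorem Program.Standing.bddAbove_ext (hP : P.Standing) (v : B) :
    BddAbove (P.pB v '' P.ext) := by
  refine ⟨‖v‖, ?_⟩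
  rintro _ ⟨κ, hκ, rfl⟩
  have := hP.pB_le v κ
  rwa [hκ.1.2, mul_one] at this

theorem Program.IsScenarioOptimizer.JnN_eq {y : Fin N → Y} {α : Fin n → ℝ}
    (h : P.IsScenarioOptimizer S n y α) : P.JnN S n y = α ⬝ᵥ P.cvec S n :=
  IsLeast.csInf_eq ⟨⟨α, h.1, rfl⟩, by rintro _ ⟨α', hα', rfl⟩; exact h.2 α' hα'⟩

theorem Program.pB_le_of_mem_feasN {α : Fin n → ℝ} (hα : α ∈ P.feasN S n) {y : Y}
    (hy : y ∈ P.ext) : P.pB P.b y ≤ α ⬝ᵥ P.AnStar S n y := by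
  have h1 : 0 ≤ P.pB (P.An S n α - P.b) y := Program.mem_Kstar.1 hy.1.1 _ hα.1
  rw [map_sub, LinearMap.sub_apply, Program.pB_An] at h1
  linarith

theorem Program.JnN_le_Jn (hS : S.Standing) (hf : (P.feasN S n).Nonempty) {y : Fin N → Y}
    (hy : ∀ j, y j ∈ P.ext) : P.JnN S n y ≤ P.Jn S n := by
  refine csInf_le_csInf (hS.bddBelow_dot _ fun _ h => h.2) (hf.image _) (image_mono fun α hα => ?_)
  exact ⟨fun j => Program.pB_le_of_mem_feasN hα (hy j), hα.2⟩

theorem Program.pB_sub_An (α : Fin n → ℝ) (y : Y) :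
    P.pB (P.b - P.An S n α) y = P.pB P.b y - α ⬝ᵥ P.AnStar S n y := by
  rw [map_sub, LinearMap.sub_apply, Program.pB_An]

variable [MeasurableSpace Y] {ℙ : Measure Y} [IsProbabilityMeasure ℙ]

variable (P S ℙ) in
/-- The probability that the constraint of a random `y` is violated by `α`. -/
def Program.violation (n : ℕ) (α : Fin n → ℝ) : ℝ :=
  ℙ.real {y | α ⬝ᵥ P.AnStar S n y < P.pB P.b y}

/-- For ζ equal to the support function, the tail event is the violation event, so this ζ is
admissible. If it is negative, h ≥ 0 suffices. -/
theorem Program.IsTailBound.ext_bound {h : (Fin n → ℝ) → ℝ → ℝ} (hh : P.IsTailBound S ℙ n h)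
    (hP : P.Standing) {ε : ℝ} (hε : ε ∈ Ico (0 : ℝ) 1) {α : Fin n → ℝ}
    (hα : P.violation S ℙ n α ≤ ε) : ∀ κ ∈ P.ext, P.pB (P.b - P.An S n α) κ ≤ h α ε := by
  intro κ hκ
  have h1 : P.pB (P.b - P.An S n α) κ ≤ supportFun P.ext (P.pB (P.b - P.An S n α)) :=
    le_csSup (hP.bddAbove_ext _) ⟨κ, hκ, rfl⟩
  refine h1.trans ?_
  rcases le_total (supportFun P.ext (P.pB (P.b - P.An S n α))) 0 with hneg | hpos
  · exact hneg.trans (hh α ε hε).1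
  · refine (hh α ε hε).2 ⟨hpos, le_trans (le_of_eq ?_) hα⟩
    simp only [Program.tailProb, Program.violation, lt_add_iff_pos_left, Program.pB_sub_An,
      sub_pos]

/-- A value above M r at one extreme point stays positive on its whole open r-ball, which has
probability at least g r. -/
theorem Program.IsBallLowerBound.ext_bound {g : ℝ → ℝ} (hg : P.IsBallLowerBound ℙ g)
    (hP : P.Standing) {v : B} {M r : ℝ} (hr : 0 ≤ r) (hM : 0 < M) (hv : ‖v‖ ≤ M)
    (hviol : ℙ.real {y | 0 < P.pB v y} < g r) : ∀ κ ∈ P.ext, P.pB v κ ≤ M * r := by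
  intro κ hκ
  by_contra! hlt
  refine absurd ((hg.le κ hκ r hr).trans (measureReal_mono fun y hy => ?_)) (not_le.2 hviol)
  have h1 := hP.pB_le (-v) (y - κ)
  rw [norm_neg, map_neg, LinearMap.neg_apply, map_sub] at h1
  have h2 : ‖v‖ * P.normY (y - κ) ≤ M * r :=
    mul_le_mul hv (le_of_lt hy) (hP.normY_nonneg _) hM.le
  change 0 < P.pB v y
  linarith

theorem Program.Regular.measure_violation_le (hreg : P.Regular S n γ) (hS : S.Standing)
    (hn : 1 ≤ n) (hmeas : ∀ v : B, Measurable (fun y => P.pB v y))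
    (hsupp : ∀ᵐ y ∂ℙ, y ∈ P.ext) {αN : (Fin N → Y) → Fin n → ℝ}
    (hαN : ∀ᵐ y ∂(Measure.pi fun _ : Fin N => ℙ), P.IsScenarioOptimizer S n y (αN y) ∧
      ∀ α, P.IsScenarioOptimizer S n y α → α = αN y) {ε : ℝ} (hε : 0 ≤ ε) (hε1 : ε ≤ 1) :
    Measure.pi (fun _ : Fin N => ℙ) {y | ε < P.violation S ℙ n (αN y)} ≤
      ENNReal.ofReal (binTail n N ε) := by
  rcases lt_or_ge N n with hN | hN
  · rw [binTail_of_lt hN, ENNReal.ofReal_one]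
    exact prob_le_one
  obtain ⟨α₀, hα₀⟩ := hreg.feasible
  refine InfLP.measure_violation_le hn (hS.isCompact_ballR n) (S.convex_ballR n) (P.cvec S n)
    (measurable_pi_lambda _ fun i => hmeas _) (hmeas P.b) hα₀.2
    (hsupp.mono fun y hy => Program.pB_le_of_mem_feasN hα₀ hy) hN ?_ hε hε1
  filter_upwards [hαN] with y hy α hα
  exact hy.2 α ⟨⟨hα.1.2, hα.1.1⟩, fun α' hα' => hα.2 α' ⟨hα'.2, hα'.1⟩⟩

end Scenario

end InfLP

end

/-- Probabilities of at least `1 - β` are expressed by bounding the (outer) probability of the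
complementary event by `β`. -/
theorem mainTheorem5 {X C B Y : Type*} [NormedAddCommGroup X] [NormedSpace ℝ X]
    [AddCommGroup C] [Module ℝ C] [NormedAddCommGroup B] [NormedSpace ℝ B]
    [AddCommGroup Y] [Module ℝ Y] [MeasurableSpace Y]
    -- the infinite program and its optimizer
    (P : InfLP.Program X C B Y) (hP : P.Standing) (xstar : X) (hx : P.IsOptimizer xstar)
    -- the basis, the norms on the spaces `ℝⁿ`, and the projection residuals
    (S : InfLP.Scheme X) (hS : S.Standing) (d D : ℝ) (hd : 0 < d) (proj : ℕ → X)
    (hproj : ∀ m : ℕ, 1 ≤ m → InfLP.IsProjection (S.ballX m) xstar (proj m))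
    (hres : ∀ m : ℕ, 1 ≤ m → ‖xstar - proj m‖ ≤ D * (m : ℝ) ^ (-1 / d))
    -- semi-infinite regularity and the dual optimizer bound
    (n : ℕ) (hn : 1 ≤ n) (γ : ℝ) (hreg : P.Regular S n γ)
    (JLB : ℝ) (hJLB : JLB ≤ P.Jn S n) (θD : ℝ) (hθD : θD = P.θD S n γ JLB)
    -- the sampling measure, supported on the extreme points
    (hext : P.ExtGenerates) (ℙ : Measure Y) [IsProbabilityMeasure ℙ]
    (hmeas : ∀ v : B, Measurable (fun y => P.pB v y)) (hsupp : ∀ᵐ y ∂ℙ, y ∈ P.ext)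
    -- the scenario program and its (almost surely) unique optimizer
    (N : ℕ) (αN : (Fin N → Y) → Fin n → ℝ)
    (hαN : ∀ᵐ y ∂(Measure.pi fun _ : Fin N => ℙ), P.IsScenarioOptimizer S n y (αN y) ∧
      ∀ α, P.IsScenarioOptimizer S n y α → α = αN y)
    -- the prox-function and `k` iterations of the smoothing algorithm
    (prox : Y → ℝ) (hprox : P.IsProxFun θD prox) (ystar : ℝ → (Fin n → ℝ) → Y)
    (hystar : P.IsProxMaximizer S n θD prox ystar)
    (η L ϑ : ℝ) (hη : 0 < η) (hL : 0 < L) (hLip : P.LipschitzGradient S n ystar L η)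
    (hϑ : 0 < ϑ) (hconv : InfLP.StronglyConvex (S.R n) Set.univ ϑ (fun α => S.R n α ^ 2 / 2))
    (w z a : ℕ → Fin n → ℝ) (hrun : P.IsRun S n ystar η L ϑ w z a) (k : ℕ)
    -- the confidence level
    (β : ℝ) (hβ : β ∈ Set.Ioo (0 : ℝ) 1) :
    -- the a posteriori bounds
    (∀ h : (Fin n → ℝ) → ℝ → ℝ, P.IsTailBound S ℙ n h → ∀ ε ∈ Set.Ioo (0 : ℝ) 1,
      InfLP.sampleBound n ε β ≤ N →
      (Measure.pi fun _ : Fin N => ℙ) {y | ¬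
        (max (P.JnN S n y) (P.lowerVal S n (InfLP.yhat ystar η w k))
            - D * (P.normC + θD * ‖P.A‖) * (n : ℝ) ^ (-1 / d) ≤ P.J ∧
          P.J ≤ min (P.upperVal S n θD (a k)) (P.JnN S n y + θD * h (αN y) ε))}
        ≤ ENNReal.ofReal β) ∧
    -- the a priori bound
    (∀ ε : ℝ, 0 < ε → (D * (P.normC + θD * ‖P.A‖) * ε⁻¹) ^ d ≤ (n : ℝ) →
      (P.EnoughSamples S ℙ n θD ε β N ∨ S.EnoughIterations n prox ystar L ϑ ε η k) →
      (Measure.pi fun _ : Fin N => ℙ) {y | ¬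
        min |P.J - P.JnN S n y| |P.J - P.lowerVal S n (InfLP.yhat ystar η w k)| ≤ ε}
        ≤ ENNReal.ofReal β) := by
  have hθP := hreg.θP_pos
  have hθD0 : 0 ≤ θD := hθD ▸ hreg.θD_nonneg hS hJLB
  have hw := hrun.mem_ballR
  have hnpos : (0 : ℝ) < n := by exact_mod_cast hn
  have hJle : P.J ≤ P.Jn S n := hx.J_le_Jn hreg.feasible
  have hcoef : 0 ≤ P.normC + θD * ‖P.A‖ :=
    add_nonneg hP.normC_nonneg (mul_nonneg hθD0 (norm_nonneg _))
  have hJge : P.Jn S n - D * (P.normC + θD * ‖P.A‖) * (n : ℝ) ^ (-1 / d) ≤ P.J := by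
    have h1 := hreg.Jn_sub_le_J hP hS hJLB hx (hproj n hn).1
    rw [← hθD] at h1
    have h2 := mul_le_mul_of_nonneg_left (hres n hn) hcoef
    linarith
  -- The sign of D is forced by the residual bound.
  have hD : 0 ≤ D := by
    have h1 := (norm_nonneg _).trans (hres n hn)
    exact nonneg_of_mul_nonneg_left h1 (Real.rpow_pos_of_pos hnpos _)
  have hlow : P.lowerVal S n (InfLP.yhat ystar η w k) ≤ P.Jn S n :=
    InfLP.Program.lowerVal_le_Jn hS hreg.feasible (hP.yhat_mem hystar hη hw k).1
  have hup : P.Jn S n ≤ P.upperVal S n θD (a k) := by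
    rw [hθD]
    exact hreg.Jn_le_upperVal hP hS hJLB (hrun.stepA k).1
  have hsample : ∀ᵐ y ∂(Measure.pi fun _ : Fin N => ℙ), ∀ j, y j ∈ P.ext := by
    rw [ae_all_iff]
    exact fun j => (measurePreserving_eval (fun _ : Fin N => ℙ) j).quasiMeasurePreserving.ae hsupp
  have hJnN : ∀ᵐ y ∂(Measure.pi fun _ : Fin N => ℙ), P.JnN S n y ≤ P.Jn S n :=
    hsample.mono fun y hy => InfLP.Program.JnN_le_Jn hS hreg.feasible hy
  have hviol : ∀ ε, 0 ≤ ε → ε ≤ 1 →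
      (Measure.pi fun _ : Fin N => ℙ) {y | ε < P.violation S ℙ n (αN y)} ≤
        ENNReal.ofReal (InfLP.binTail n N ε) := fun ε h0 h1 =>
    hreg.measure_violation_le hS hn hmeas hsupp hαN h0 h1
  constructor
  · intro h hh ε hε hN
    have hβ' : (Measure.pi fun _ : Fin N => ℙ) {y | ε < P.violation S ℙ n (αN y)} ≤
        ENNReal.ofReal β := (hviol ε hε.1.le hε.2.le).trans
      (ENNReal.ofReal_le_ofReal (InfLP.binTail_le_of_sampleBound hε.1.le hε.2.le hN))
    refine (measure_mono_ae ?_).trans hβ'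
    filter_upwards [hJnN, hαN] with y hy hyα hbad
    by_contra hlt
    refine hbad ⟨?_, le_min (hJle.trans hup) ?_⟩
    · have := max_le hy hlow
      linarith
    · have hε' : ε ∈ Set.Ico (0 : ℝ) 1 := ⟨hε.1.le, hε.2⟩
      have h1 := hreg.Jn_le_of_ext_bound hP hS hext hJLB hyα.1.1.2 (hh (αN y) ε hε').1
        (hh.ext_bound hP hε' (not_lt.1 hlt))
      rw [hyα.1.JnN_eq]
      rw [← hθD] at h1
      exact hJle.trans h1
  · intro ε hε hnε hor
    have hJge' : P.Jn S n - ε ≤ P.J := by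
      refine le_trans (sub_le_sub_left ?_ _) hJge
      set Q := D * (P.normC + θD * ‖P.A‖) with hQ
      have hQ0 : 0 ≤ Q := mul_nonneg hD hcoef
      have h1 : Q * ε⁻¹ ≤ (n : ℝ) ^ (1 / d) := by
        have h2 := Real.rpow_le_rpow (by positivity) hnε (one_div_pos.2 hd).le
        rwa [← Real.rpow_mul (by positivity), mul_one_div_cancel hd.ne', Real.rpow_one] at h2
      have h3 : 0 < (n : ℝ) ^ (1 / d) := Real.rpow_pos_of_pos hnpos _
      rw [neg_div, Real.rpow_neg hnpos.le, ← div_eq_mul_inv, div_le_iff₀ h3]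
      rw [← div_eq_mul_inv, div_le_iff₀ hε] at h1
      linarith
    rcases hor with ⟨g, hg, hgN⟩ | hit
    · obtain ⟨y₀, hy₀⟩ := hsupp.exists
      set M := S.θP * S.rho n * ‖P.A‖ + ‖P.b‖ with hM
      have hMbound : ∀ α ∈ S.ballR n, ‖P.b - P.An S n α‖ ≤ M := by
        intro α hα
        have h1 := norm_sub_le P.b (P.An S n α)
        have h2 := InfLP.Program.norm_An_le (P := P) hS α
        have h3 := mul_le_mul_of_nonneg_left (hS.sum_abs_le hα hθP) (norm_nonneg P.A)
        linarith
      obtain ⟨α₀, hα₀⟩ := hreg.feasible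
      have hM0 : 0 ≤ M := (norm_nonneg _).trans (hMbound α₀ hα₀.2)
      have hz : P.zn S n θD = (θD * M)⁻¹ := rfl
      have hr0 : 0 ≤ P.zn S n θD * ε := by
        rw [hz]
        positivity
      set r := P.zn S n θD * ε with hr
      have hgr := hg.mem r hr0
      have htail := InfLP.binTail_le_of_sampleBound hgr.1 hgr.2 hgN
      -- At level 0 the binomial tail is 1 > β, so no sample size would be enough.
      have hgpos : 0 < g r := by
        refine lt_of_le_of_ne hgr.1 fun h0 => ?_
        rw [← h0, InfLP.binTail_zero hn] at htail
        exact absurd htail (not_le.2 hβ.2)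
      -- A ball of radius 0 is empty and would give g r ≤ 0. Hence the inverse in `zn` is not the
      -- default value 0, and θD M > 0.
      have hrpos : 0 < r := by
        refine lt_of_le_of_ne hr0 fun h0 => ?_
        have h1 := hg.le y₀ hy₀ r hr0
        have h2 : {y | P.normY (y - y₀) < r} = ∅ := by
          rw [← h0]
          exact Set.eq_empty_of_forall_notMem fun y hy =>
            absurd (hP.normY_nonneg _) (not_le.2 hy)
        rw [h2, measureReal_empty] at h1
        exact absurd h1 (not_le.2 hgpos)
      have hθM : 0 < θD * M := by
        have h1 : 0 < P.zn S n θD := pos_of_mul_pos_left hrpos hε.le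
        rw [hz] at h1
        exact inv_pos.1 h1
      have hMpos : 0 < M := pos_of_mul_pos_right hθM hθD0
      -- The ball argument needs a violation probability strictly below g r, so the exceptional
      -- event is the non-strict inequality.
      refine (measure_mono_ae ?_).trans
        ((InfLP.measure_le_violation_le hviol hgpos hgr.2).trans (ENNReal.ofReal_le_ofReal htail))
      filter_upwards [hJnN, hαN] with y hy hyα hbad
      by_contra hlt
      refine hbad ((min_le_left _ _).trans (abs_le.2 ⟨by linarith, ?_⟩))
      have h1 : ∀ κ ∈ P.ext, P.pB (P.b - P.An S n (αN y)) κ ≤ M * r := by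
        refine hg.ext_bound hP hr0 hMpos (hMbound _ hyα.1.1.2) ?_
        have hlt' : P.violation S ℙ n (αN y) < g r := not_le.1 hlt
        simpa only [InfLP.Program.pB_sub_An, sub_pos, InfLP.Program.violation] using hlt'
      have h2 := hreg.Jn_le_of_ext_bound hP hS hext hJLB hyα.1.1.2 (by positivity) h1
      have h3 : θD * (M * r) = ε := by
        rw [← mul_assoc, hr, hz, ← mul_assoc, mul_inv_cancel₀ hθM.ne', one_mul]
      rw [← hθD, h3, ← hyα.1.JnN_eq] at h2
      linarith
    -- This alternative is deterministic: Jₙ lies between `lowerVal` and `upperVal`, which are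
    -- ε-close, and Jₙ - ε ≤ J ≤ Jₙ.
    · have h1 := hrun.upperVal_le_lowerVal_add hS hn hθP hθD0 hprox hystar hη hL hLip hϑ hconv hε
        hit
      have h2 : ∀ y : Fin N → Y, min |P.J - P.JnN S n y|
          |P.J - P.lowerVal S n (InfLP.yhat ystar η w k)| ≤ ε := fun y =>
        (min_le_right _ _).trans (abs_le.2 ⟨by linarith, by linarith⟩)
      simp [h2]
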